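/- Let $M,Q,\Lambda\in\mathbb R$ satisfy $Q\neq 0$, $0<\Lambda<\frac1{12Q^2}$ and $M_1<M<M_2$, where $R=\frac1{\sqrt{6\Lambda}}$, $m_1=R\sqrt{1-\sqrt{1-12Q^2\Lambda}}$, $m_2=R\sqrt{1+\sqrt{1-12Q^2\Lambda}}$ and $M_i=m_i-2\Lambda m_i^3$. Then $f(r)=1-\frac{2M}{r}+\frac{Q^2}{r^2}-\Lambda r^2$ has exactly three positive zeros $r_1<r_2<r_3$. On $]r_2,r_3[$ define $r_*$ by $\frac{dr_*}{dr}=\frac1f$ and $r_*=0$ at $r=\frac12\big(3M+\sqrt{9M^2-8Q^2}\big)$. This is a bijection onto $\mathbb R$, and we regard $r$ and $V=f(r)/r^2$ as functions of $r_*\in\mathbb R$. Let $\mathcal S^2$ be the unit round sphere with area measure $d^2\omega$, gradient $\nabla_{\mathcal S^2}$ and Laplacian $\Delta_{\mathcal S^2}$. For a smooth function $u:\mathbb R_t\times\mathbb R_{r_*}\times \mathcal S^2\to\mathbb C$ put $$e=|\partial_t u|^2+|\partial_{r_*}u|^2+V|\nabla_{\mathcal S^2} u|^2,\qquad e_{\mathcal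 C}=\tfrac12(t^2+r_*^2)\,e+2tr_*\,\mathrm{Re}\big(\partial_t u\,\overline{\partial_{r_*}u}\big)+e,$$ $$E[u](t)=\tfrac12\int_{\{t\}\times\mathbb R\times \mathcal S^2}e\,dr_*\,d^2\omega,\qquad E_{\mathcal C}[u](t)=\tfrac12\int_{\{t\}\times\mathbb R\times \mathcal S^2}e_{\mathcal C}\,dr_*\,d^2\omega .$$ Consider the smooth solutions $u$ of $$\partial_t^2u=\partial_{r_*}^2u+V\Delta_{\mathcal S^2}u$$ on $\mathbb R\times\mathbb R\times \mathcal S^2$ that have no $l=0$ component, that is, $\int_{\mathcal S^2}u(t,r_*,\omega)\,d^2\omega=0$ for all $t,r_*$, and for which $E_{\mathcal C}[u](0)$ and $E[\Delta_{\mathcal S^2}^2u](0)$ are finite. (i) There is a constant $C>0$, depending only on $M,Q,\Lambda$, such that for every such $u$ and every $t\ge0$ the conformal charge $E_{\mathcal C}[u](t)$ is finite and $$E_{\mathcal C}[u](t)\le C\big(E_{\mathcal C}[u](0)+E[\Delta_{\mathcal S^2}^2u](0)\big).$$ (ii) For every smooth compactly supported $\chi:\mathbb R_{r_*}\to\mathbb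 R$ there is a constant $C>0$, depending only on $M,Q,\Lambda$ and $\chi$, such that for every such $u$ the following integral converges absolutely and $$\int_{[0,+\infty[\times\mathbb R\times \mathcal S^2}t\,\chi(r_*)\,|\nabla_{\mathcal S^2} u|^2\,dt\,dr_*\,d^2\omega\le C\big(E_{\mathcal C}[u](0)+E[\Delta_{\mathcal S^2}^2u](0)\big).$$ -/

import Mathlib

open MeasureTheory Set
open scoped Manifold ContDiff

noncomputable section

namespace RNdS

/-! The exterior static region of the Reissner-Nordstrom-de Sitter black hole. -/

/-- The horizon function `f(r) = 1 - 2M/r + Q²/r² - Λr²`. -/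
def horizonFn (M Q Λ r : ℝ) : ℝ := 1 - 2 * M / r + Q ^ 2 / r ^ 2 - Λ * r ^ 2

/-- `m₁ = R √(1 - √Δ)` with `R = 1/√(6Λ)` and `Δ = 1 - 12Q²Λ`. -/
def m₁ (Q Λ : ℝ) : ℝ :=
  1 / Real.sqrt (6 * Λ) * Real.sqrt (1 - Real.sqrt (1 - 12 * Q ^ 2 * Λ))

/-- `m₂ = R √(1 + √Δ)` with `R = 1/√(6Λ)` and `Δ = 1 - 12Q²Λ`. -/
def m₂ (Q Λ : ℝ) : ℝ :=
  1 / Real.sqrt (6 * Λ) * Real.sqrt (1 + Real.sqrt (1 - 12 * Q ^ 2 * Λ))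

/-- The standing condition on mass, charge and cosmological constant; it is equivalent to `f`
having exactly three distinct positive zeros. -/
structure Admissible (M Q Λ : ℝ) : Prop where
  charge_ne_zero : Q ≠ 0
  cosm_pos : 0 < Λ
  cosm_lt : Λ < 1 / (12 * Q ^ 2)
  mass_gt : m₁ Q Λ - 2 * Λ * m₁ Q Λ ^ 3 < M
  mass_lt : M < m₂ Q Λ - 2 * Λ * m₂ Q Λ ^ 3

/-- The cosmological horizon `r₃`: the largest positive zero of `f`. -/
def cosmologicalHorizon (M Q Λ : ℝ) : ℝ := sSup {r : ℝ | 0 < r ∧ horizonFn M Q Λ r = 0}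

/-- The horizon of the black hole `r₂`: the second largest positive zero of `f`. -/
def outerHorizon (M Q Λ : ℝ) : ℝ :=
  sSup {r : ℝ | 0 < r ∧ r < cosmologicalHorizon M Q Λ ∧ horizonFn M Q Λ r = 0}

/-- The radius `P₂` of the photon sphere. -/
def photonRadius (M Q : ℝ) : ℝ := (3 * M + Real.sqrt (9 * M ^ 2 - 8 * Q ^ 2)) / 2

/-- The Regge-Wheeler coordinate `r_*` as a function of `r ∈ ]r₂, r₃[`:
`dr_*/dr = 1/f` and `r_*(P₂) = 0`. -/
def reggeWheeler (M Q Λ r : ℝ) : ℝ := ∫ x in (photonRadius M Q)..r, 1 / horizonFn M Q Λ x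

/-- The area radius `r ∈ ]r₂, r₃[` as a function of `r_*`: the inverse of the bijection
`r_* : ]r₂, r₃[ → ℝ`. -/
def radius (M Q Λ : ℝ) : ℝ → ℝ :=
  Function.invFunOn (reggeWheeler M Q Λ) (Ioo (outerHorizon M Q Λ) (cosmologicalHorizon M Q Λ))

/-- The potential `V = f / r²` as a function of `r_*`. -/
def potential (M Q Λ s : ℝ) : ℝ :=
  horizonFn M Q Λ (radius M Q Λ s) / radius M Q Λ s ^ 2

/-! Calculus on the unit round sphere `S²`. -/

/-- The unit sphere of Euclidean `ℝ³`. -/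
abbrev S2 : Type := Metric.sphere (0 : EuclideanSpace ℝ (Fin 3)) 1

/-- The area measure `d²ω` of the round sphere (of total mass `4π`). -/
def area : Measure S2 := (volume : Measure (EuclideanSpace ℝ (Fin 3))).toSphere

/-- The extension of `φ : S² → ℂ` to `ℝ³ \ {0}` that is constant along rays
(with the value `0` at the origin). -/
def radialExt (φ : S2 → ℂ) (x : EuclideanSpace ℝ (Fin 3)) : ℂ :=
  if hx : x = 0 then 0
  else φ ⟨‖x‖⁻¹ • x, by
    rw [mem_sphere_zero_iff_norm, norm_smul, norm_inv, norm_norm,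
      inv_mul_cancel₀ (norm_ne_zero_iff.mpr hx)]⟩

/-- The Laplace-Beltrami operator of the round sphere: the restriction to `S²` of the Euclidean
Laplacian of the extension that is constant along rays. -/
def sphLaplacian (φ : S2 → ℂ) (w : S2) : ℂ := Laplacian.laplacian (radialExt φ) (w : EuclideanSpace ℝ (Fin 3))

/-- `|∇̸φ|²` for the round metric. The extension has no radial derivative, so this is the squared
length of its Euclidean gradient on `S²` (real and imaginary parts added). -/
def sphGradSq (φ : S2 → ℂ) (w : S2) : ℝ :=
  ∑ i : Fin 3, ‖fderiv ℝ (radialExt φ) (w : EuclideanSpace ℝ (Fin 3))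
    (EuclideanSpace.single i (1 : ℝ))‖ ^ 2

/-! Fields `u (t, r_*, ω)`, their derivatives, and the wave-like equation. -/

/-- `∂_t u`. -/
def dt (u : ℝ → ℝ → S2 → ℂ) : ℝ → ℝ → S2 → ℂ := fun t s w => deriv (fun τ => u τ s w) t

/-- `∂_{r_*} u`. -/
def dr (u : ℝ → ℝ → S2 → ℂ) : ℝ → ℝ → S2 → ℂ := fun t s w => deriv (fun y => u t y w) s

/-- `Δ_{S²} u`. -/
def lap (u : ℝ → ℝ → S2 → ℂ) : ℝ → ℝ → S2 → ℂ := fun t s => sphLaplacian (u t s)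

/-- `u` is a smooth function on the manifold `ℝ_t × ℝ_{r_*} × S²`. -/
def SmoothField (u : ℝ → ℝ → S2 → ℂ) : Prop :=
  ContMDiff (𝓘(ℝ, ℝ × ℝ).prod (𝓡 2)) 𝓘(ℝ, ℂ) ∞
    (fun p : (ℝ × ℝ) × S2 => u p.1.1 p.1.2 p.2)

/-- The wave-like equation `∂_t² u = ∂_{r_*}² u + V Δ_{S²} u` on `ℝ × ℝ × S²`. -/
def WaveLike (M Q Λ : ℝ) (u : ℝ → ℝ → S2 → ℂ) : Prop :=
  ∀ (t s : ℝ) (w : S2),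
    dt (dt u) t s w = dr (dr u) t s w + (potential M Q Λ s : ℂ) * lap u t s w

/-- The `l = 0` spherical harmonic component of `u` vanishes: each `u(t, r_*, ·)` is orthogonal to
the constants in `L²(S²)`. -/
def NoZeroMode (u : ℝ → ℝ → S2 → ℂ) : Prop := ∀ t s : ℝ, ∫ w, u t s w ∂area = 0

/-! Energy and conformal charge. -/

/-- The energy density `e = |∂_t u|² + |∂_{r_*} u|² + V |∇̸u|²`. -/
def energyDensity (M Q Λ : ℝ) (u : ℝ → ℝ → S2 → ℂ) (t s : ℝ) (w : S2) : ℝ :=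
  ‖dt u t s w‖ ^ 2 + ‖dr u t s w‖ ^ 2 + potential M Q Λ s * sphGradSq (u t s) w

/-- The conformal charge density `½ (t² + r_*²) e + 2 t r_* ∂_t u · ∂_{r_*} u + e`, where the dot is
the real inner product `Re (a * conj b)` of `ℂ` (the product of real numbers if `u` is real). -/
def conformalDensity (M Q Λ : ℝ) (u : ℝ → ℝ → S2 → ℂ) (t s : ℝ) (w : S2) : ℝ :=
  1 / 2 * (t ^ 2 + s ^ 2) * energyDensity M Q Λ u t s w
    + 2 * t * s * (dt u t s w * (starRingEnd ℂ) (dr u t s w)).re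
    + energyDensity M Q Λ u t s w

/-- The measure `dr_* d²ω` on `Σ_t = {t} × ℝ × S²`. -/
def sliceMeasure : Measure (ℝ × S2) := (volume : Measure ℝ).prod area

/-- The measure `dt dr_* d²ω` on `[0, ∞[ × ℝ × S²`. -/
def futureMeasure : Measure (ℝ × ℝ × S2) :=
  ((volume : Measure ℝ).restrict (Ici 0)).prod sliceMeasure

/-- The energy of `u` on `Σ_t` is finite. -/
def FiniteEnergy (M Q Λ : ℝ) (u : ℝ → ℝ → S2 → ℂ) (t : ℝ) : Prop :=
  Integrable (fun p : ℝ × S2 => energyDensity M Q Λ u t p.1 p.2) sliceMeasure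

/-- The energy `E[u](t)`. -/
def energy (M Q Λ : ℝ) (u : ℝ → ℝ → S2 → ℂ) (t : ℝ) : ℝ :=
  1 / 2 * ∫ p : ℝ × S2, energyDensity M Q Λ u t p.1 p.2 ∂sliceMeasure

/-- The conformal charge of `u` on `Σ_t` is finite. -/
def FiniteConformalCharge (M Q Λ : ℝ) (u : ℝ → ℝ → S2 → ℂ) (t : ℝ) : Prop :=
  Integrable (fun p : ℝ × S2 => conformalDensity M Q Λ u t p.1 p.2) sliceMeasure

/-- The conformal charge `E_C[u](t)`. -/
def conformalCharge (M Q Λ : ℝ) (u : ℝ → ℝ → S2 → ℂ) (t : ℝ) : ℝ :=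
  1 / 2 * ∫ p : ℝ × S2, conformalDensity M Q Λ u t p.1 p.2 ∂sliceMeasure

end RNdS

end

/-!
The uniform bound on the conformal charge and the decay of the localised angular energy follow from
two vector field identities for a problem in one space dimension.

*Reduction.* Integrating over the sphere turns a solution `u` into the scalar functions `a = ‖∂_t u‖²`,
`b = ‖∂_s u‖²`, `n = ‖∇u‖²`, `z = ‖u‖²` and the pairings `p = ⟨∂_t u, ∂_s u⟩`, `y₁ = ⟨u, ∂_t u⟩`,
`y₂ = ⟨u, ∂_s u⟩` of time `t` and the Regge-Wheeler coordinate `s`. The structure `ReducedWave`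
records all that is used about them: balance laws for the energy, the momentum and the virial `y₁`,
the Cauchy-Schwarz inequalities, and the Poincaré inequality `z ≤ 2 n`. Green's formula on the sphere
(`integral_gradInner_add`) is the divergence theorem in `ℝ³` for fields that are constant along rays,
with a radial cutoff. The Poincaré inequality (`integral_norm_sq_le`) compares the values at two
independent Gaussian points along a quarter circle joining them, which a rotation in the pair
preserves; the resulting constant `2` is not sharp, but sufficient.

*Potential.* With `P` the photon radius and `g = 1 / P - 1 / r`, the potential satisfies `g' = V` and
`V' = -V g q`, where `q` lies between two positive constants (`TrappingPotential`). Hence `V` has a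
single nondegenerate maximum, where the trapped null geodesics live, and decays exponentially on both
sides. Only these facts about the metric enter the estimates.

*Conformal charge.* The density `eC` and its flux satisfy `∂_t eC - ∂_s fluxC = t (2 V + s V') n`, and
the right-hand side is nonpositive outside a bounded interval `|s| ≤ S`, because `s g q` grows there.
The flux is dominated by the density, so a cutoff `coneCutoff` that decreases along backward light cones
localises the identity at the cost of a term of favourable sign. In the cone of radius `R` the charge
`E` therefore grows at most at the rate of a constant times `t N`, with `N` the integral of `n` over
`|s| ≤ S` (`exists_hasDerivAt_coneCharge`).

*Local decay.* The multiplier `g ∂_s`, corrected by a small multiple of `g V |u|²` in the flux, has a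
bulk term that dominates `V² z` (`mora_t_sub_moraFlux_s_le`); it does not dominate `n`, since `g`
vanishes at the photon sphere. The weight `(t² - s²)₊³` compensates the degeneracy of the conformal
density on the light cone, and after division by `t ^ (17 / 4)` the errors are `t ^ (-5 / 4) E`. To
recover `n`, one pays with derivatives: `n ≤ A z + A⁻³ ‖Δ² u‖²` for all `A > 0`
(`ip_lap_interpolation`), and `Δ² u` is again a solution, with bounded energy. The choice
`A = t ^ (3 / 4)` bounds `t N` by an exact time derivative plus `t ^ (-5 / 4) (E + F)`, with `F` the
energy of `Δ² u` (`exists_hasDerivAt_local_decay`). The exact derivative is of a quantity of size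
`t ^ (-1 / 4) E`, negligible for large times.

*Conclusion.* As `t ^ (-5 / 4)` is integrable at infinity, a Gronwall argument
(`exists_gronwall_bound`) bounds both `E` and the time integral of `t N` by the data. The constants do
not depend on `R` (`exists_conformal_bound`), so `R → ∞` yields the finiteness of the conformal
charge and the convergence of the space-time integral.
-/

noncomputable section

namespace RNdS

/-! ### Fields on the sphere and their extensions to `ℝ³ \ {0}` -/

/-- Euclidean three-space, in which the sphere sits. -/
abbrev E3 : Type := EuclideanSpace ℝ (Fin 3)

/-- The `i`-th vector of the standard basis of `ℝ³`. -/
def basisVec (i : Fin 3) : E3 := EuclideanSpace.single i (1 : ℝ)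

/-- The extension of a field to `ℝ × ℝ × ℝ³` that is constant along the rays of `ℝ³`. -/
def fieldExt (u : ℝ → ℝ → S2 → ℂ) (p : (ℝ × ℝ) × E3) : ℂ := radialExt (u p.1.1 p.1.2) p.2

/-- Smoothness on `ℝ × ℝ × (ℝ³ \ {0})`. -/
def SmoothOff (G : (ℝ × ℝ) × E3 → ℂ) : Prop :=
  ∀ p : (ℝ × ℝ) × E3, p.2 ≠ 0 → ContDiffAt ℝ ∞ G p

/-- The dimension count behind the smooth structure of the sphere. -/
lemma finrank_E3 : Fact (Module.finrank ℝ E3 = 2 + 1) := ⟨by simp⟩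

lemma norm_inv_smul_mem_sphere {x : E3} (hx : x ≠ 0) : ‖x‖⁻¹ • x ∈ Metric.sphere (0 : E3) 1 := by
  rw [mem_sphere_zero_iff_norm, norm_smul, norm_inv, norm_norm,
    inv_mul_cancel₀ (norm_ne_zero_iff.mpr hx)]

/-- The radial projection of `ℝ³ \ {0}` onto the sphere, with an arbitrary value at the origin. -/
def toS2 (x : E3) : S2 :=
  if hx : x = 0 then ⟨EuclideanSpace.single 0 1, by simp⟩
  else ⟨‖x‖⁻¹ • x, norm_inv_smul_mem_sphere hx⟩

lemma radialExt_eq_comp_toS2 (φ : S2 → ℂ) {x : E3} (hx : x ≠ 0) :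
    radialExt φ x = φ (toS2 x) := by
  simp [radialExt, toS2, hx]

lemma S2.coe_ne_zero (w : S2) : (w : E3) ≠ 0 := by
  intro h
  have := w.2
  rw [mem_sphere_zero_iff_norm, h] at this
  simp at this

lemma toS2_coe (w : S2) : toS2 (w : E3) = w := by
  have h1 : ‖(w : E3)‖ = 1 := mem_sphere_zero_iff_norm.1 w.2
  apply Subtype.ext
  simp [toS2, S2.coe_ne_zero w]

lemma radialExt_coe (φ : S2 → ℂ) (w : S2) : radialExt φ (w : E3) = φ w := by
  rw [radialExt_eq_comp_toS2 φ (S2.coe_ne_zero w), toS2_coe]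

lemma toS2_smul {c : ℝ} (hc : 0 < c) {x : E3} (hx : x ≠ 0) : toS2 (c • x) = toS2 x := by
  have h : c • x ≠ 0 := smul_ne_zero hc.ne' hx
  apply Subtype.ext
  simp only [toS2, h, hx, dite_false]
  rw [norm_smul, Real.norm_of_nonneg hc.le, smul_smul]
  congr 1
  field_simp

lemma radialExt_smul (φ : S2 → ℂ) {c : ℝ} (hc : 0 < c) {x : E3} (hx : x ≠ 0) :
    radialExt φ (c • x) = radialExt φ x := by
  rw [radialExt_eq_comp_toS2 φ hx, radialExt_eq_comp_toS2 φ (smul_ne_zero hc.ne' hx),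
    toS2_smul hc hx]

lemma contMDiffAt_toS2 {x : E3} (hx : x ≠ 0) : ContMDiffAt 𝓘(ℝ, E3) (𝓡 2) ∞ toS2 x := by
  let U : TopologicalSpace.Opens E3 := ⟨{0}ᶜ, isOpen_compl_singleton⟩
  have h0 : ∀ y : U, (y : E3) ≠ 0 := fun y => y.2
  have h1 : ContMDiff 𝓘(ℝ, E3) 𝓘(ℝ, E3) ∞ (fun y : U => ‖(y : E3)‖⁻¹ • (y : E3)) := by
    intro y
    refine (contMDiffAt_subtype_iff (f := fun y : E3 => ‖y‖⁻¹ • y)).2 ?_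
    exact ((((contDiffAt_norm ℝ (h0 y))).inv (norm_ne_zero_iff.2 (h0 y))).smul
      contDiffAt_id).contMDiffAt
  have := finrank_E3
  have h2 := h1.codRestrict_sphere (n := 2) (fun y => norm_inv_smul_mem_sphere (h0 y))
  refine (contMDiffAt_subtype_iff (U := U) (x := ⟨x, hx⟩)).1 ?_
  refine (h2 ⟨x, hx⟩).congr_of_eventuallyEq (Filter.Eventually.of_forall fun y => ?_)
  apply Subtype.ext
  simp [toS2, h0 y]

lemma SmoothField.smoothOff {u : ℝ → ℝ → S2 → ℂ} (hu : SmoothField u) :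
    SmoothOff (fieldExt u) := by
  intro p hp
  have h1 : ContMDiffAt 𝓘(ℝ, (ℝ × ℝ) × E3) (𝓘(ℝ, ℝ × ℝ).prod (𝓡 2)) ∞
      (fun q : (ℝ × ℝ) × E3 => (q.1, toS2 q.2)) p :=
    (contDiff_fst.contMDiff.contMDiffAt).prodMk
      ((contMDiffAt_toS2 hp).comp p contDiff_snd.contMDiff.contMDiffAt)
  have h2 := ((hu _).comp p h1).contDiffAt
  refine h2.congr_of_eventuallyEq ?_
  have : ∀ᶠ q : (ℝ × ℝ) × E3 in nhds p, q.2 ≠ 0 :=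
    continuous_snd.continuousAt.eventually_ne hp
  filter_upwards [this] with q hq
  exact radialExt_eq_comp_toS2 _ hq

lemma SmoothOff.smoothField {G : (ℝ × ℝ) × E3 → ℂ} (hG : SmoothOff G) :
    SmoothField (fun t s w => G ((t, s), (w : E3))) := by
  have := finrank_E3
  intro p
  have h1 : ContMDiffAt (𝓘(ℝ, ℝ × ℝ).prod (𝓡 2)) 𝓘(ℝ, (ℝ × ℝ) × E3) ∞
      (fun q : (ℝ × ℝ) × S2 => (q.1, (q.2 : E3))) p :=
    (contMDiffAt_fst).prodMk_space ((contMDiff_coe_sphere (n := 2)).contMDiffAt.comp p contMDiffAt_snd)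
  exact (hG (p.1, (p.2 : E3)) (S2.coe_ne_zero p.2)).contMDiffAt.comp p h1

/-- The derivative of a function on `ℝ × ℝ × ℝ³` in a fixed direction. -/
def pd (v : (ℝ × ℝ) × E3) (G : (ℝ × ℝ) × E3 → ℂ) : (ℝ × ℝ) × E3 → ℂ := fun p => fderiv ℝ G p v

/-- The direction of `t`. -/
def tDir : (ℝ × ℝ) × E3 := ((1, 0), 0)
/-- The direction of `r_*`. -/
def sDir : (ℝ × ℝ) × E3 := ((0, 1), 0)
/-- The directions of `ℝ³`. -/
def xDir (i : Fin 3) : (ℝ × ℝ) × E3 := (0, basisVec i)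

lemma SmoothOff.pd {G : (ℝ × ℝ) × E3 → ℂ} (hG : SmoothOff G) (v : (ℝ × ℝ) × E3) :
    SmoothOff (pd v G) := fun p hp =>
  ((hG p hp).fderiv_right (m := ∞) (by norm_num)).clm_apply contDiffAt_const

lemma SmoothOff.differentiableAt {G : (ℝ × ℝ) × E3 → ℂ} (hG : SmoothOff G) {p : (ℝ × ℝ) × E3}
    (hp : p.2 ≠ 0) : DifferentiableAt ℝ G p :=
  (hG p hp).differentiableAt (by norm_num)

lemma SmoothOff.pd_comm {G : (ℝ × ℝ) × E3 → ℂ} (hG : SmoothOff G) (v w : (ℝ × ℝ) × E3)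
    {p : (ℝ × ℝ) × E3} (hp : p.2 ≠ 0) : RNdS.pd v (RNdS.pd w G) p = RNdS.pd w (RNdS.pd v G) p := by
  have hd : DifferentiableAt ℝ (fderiv ℝ G) p :=
    ((hG p hp).fderiv_right (m := ∞) (by norm_num)).differentiableAt (by norm_num)
  have hs := (hG p hp).isSymmSndFDerivAt
    (by rw [minSmoothness_of_isRCLikeNormedField]; exact WithTop.coe_le_coe.2 le_top)
  unfold RNdS.pd
  rw [fderiv_clm_apply hd (by fun_prop), fderiv_clm_apply hd (by fun_prop)]
  simpa using hs v w

lemma pd_congr {G H : (ℝ × ℝ) × E3 → ℂ} (h : ∀ p, p.2 ≠ 0 → G p = H p) (v : (ℝ × ℝ) × E3)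
    {p : (ℝ × ℝ) × E3} (hp : p.2 ≠ 0) : pd v G p = pd v H p := by
  have : G =ᶠ[nhds p] H := by
    filter_upwards [continuous_snd.continuousAt.eventually_ne hp] with q hq using h q hq
  simp [pd, this.fderiv_eq]

lemma SmoothOff.congr {G H : (ℝ × ℝ) × E3 → ℂ} (hG : SmoothOff G)
    (h : ∀ p, p.2 ≠ 0 → H p = G p) : SmoothOff H := fun p hp =>
  (hG p hp).congr_of_eventuallyEq <| by
    filter_upwards [continuous_snd.continuousAt.eventually_ne hp] with q hq using h q hq

lemma fieldExt_eq (u : ℝ → ℝ → S2 → ℂ) {p : (ℝ × ℝ) × E3} (hp : p.2 ≠ 0) :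
    fieldExt u p = u p.1.1 p.1.2 (toS2 p.2) := radialExt_eq_comp_toS2 _ hp

lemma fieldExt_coe (u : ℝ → ℝ → S2 → ℂ) (t s : ℝ) (w : S2) :
    fieldExt u ((t, s), (w : E3)) = u t s w := radialExt_coe _ w

lemma hasDerivAt_fst_line (G : (ℝ × ℝ) × E3 → ℂ) {t s : ℝ} {x : E3}
    (hG : DifferentiableAt ℝ G ((t, s), x)) :
    HasDerivAt (fun τ => G ((τ, s), x)) (pd tDir G ((t, s), x)) t := by
  have h : HasDerivAt (fun τ : ℝ => ((τ, s), x)) tDir t :=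
    ((hasDerivAt_id t).prodMk (hasDerivAt_const t s)).prodMk (hasDerivAt_const t x)
  exact HasFDerivAt.comp_hasDerivAt t hG.hasFDerivAt h

lemma hasDerivAt_snd_line (G : (ℝ × ℝ) × E3 → ℂ) {t s : ℝ} {x : E3}
    (hG : DifferentiableAt ℝ G ((t, s), x)) :
    HasDerivAt (fun τ => G ((t, τ), x)) (pd sDir G ((t, s), x)) s := by
  have h : HasDerivAt (fun τ : ℝ => ((t, τ), x)) sDir s :=
    ((hasDerivAt_const s t).prodMk (hasDerivAt_id s)).prodMk (hasDerivAt_const s x)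
  exact HasFDerivAt.comp_hasDerivAt s hG.hasFDerivAt h

lemma fieldExt_dt {u : ℝ → ℝ → S2 → ℂ} (hu : SmoothField u) {p : (ℝ × ℝ) × E3} (hp : p.2 ≠ 0) :
    fieldExt (dt u) p = pd tDir (fieldExt u) p := by
  rw [← (hasDerivAt_fst_line _ (hu.smoothOff.differentiableAt hp)).deriv, fieldExt_eq _ hp]
  unfold dt
  congr 1
  ext τ
  exact (fieldExt_eq u (p := ((τ, p.1.2), p.2)) hp).symm

lemma fieldExt_dr {u : ℝ → ℝ → S2 → ℂ} (hu : SmoothField u) {p : (ℝ × ℝ) × E3} (hp : p.2 ≠ 0) :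
    fieldExt (dr u) p = pd sDir (fieldExt u) p := by
  rw [← (hasDerivAt_snd_line _ (hu.smoothOff.differentiableAt hp)).deriv, fieldExt_eq _ hp]
  unfold dr
  congr 1
  ext τ
  exact (fieldExt_eq u (p := ((p.1.1, τ), p.2)) hp).symm

lemma SmoothField.of_fieldExt {u : ℝ → ℝ → S2 → ℂ} (h : SmoothOff (fieldExt u)) :
    SmoothField u := by
  have := h.smoothField
  simpa only [fieldExt_coe] using this

lemma SmoothField.dt {u : ℝ → ℝ → S2 → ℂ} (hu : SmoothField u) : SmoothField (dt u) :=
  .of_fieldExt ((hu.smoothOff.pd tDir).congr fun _ hp => fieldExt_dt hu hp)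

lemma SmoothField.dr {u : ℝ → ℝ → S2 → ℂ} (hu : SmoothField u) : SmoothField (dr u) :=
  .of_fieldExt ((hu.smoothOff.pd sDir).congr fun _ hp => fieldExt_dr hu hp)

lemma fderiv_slice {G : (ℝ × ℝ) × E3 → ℂ} {q : ℝ × ℝ} {x : E3}
    (hG : DifferentiableAt ℝ G (q, x)) (y : E3) :
    fderiv ℝ (fun x => G (q, x)) x y = fderiv ℝ G (q, x) (0, y) := by
  have h : HasFDerivAt (fun x : E3 => (q, x)) (ContinuousLinearMap.inr ℝ (ℝ × ℝ) E3) x :=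
    hasFDerivAt_prodMk_right q x
  have h2 : HasFDerivAt (fun x => G (q, x)) _ x := hG.hasFDerivAt.comp x h
  rw [h2.fderiv]
  simp

/-- The Laplacian in the coordinates of `ℝ³`, as a sum of second derivatives. -/
lemma laplacian_slice {G : (ℝ × ℝ) × E3 → ℂ} (hG : SmoothOff G) {q : ℝ × ℝ} {x : E3}
    (hx : x ≠ 0) : Laplacian.laplacian (fun x => G (q, x)) x
      = ∑ i, pd (xDir i) (pd (xDir i) G) (q, x) := by
  rw [InnerProductSpace.laplacian_eq_iteratedFDeriv_orthonormalBasis _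
    (EuclideanSpace.basisFun (Fin 3) ℝ)]
  refine Finset.sum_congr rfl fun i _ => ?_
  rw [iteratedFDeriv_two_apply]
  have hs : ContDiffAt ℝ ∞ (fun x => G (q, x)) x :=
    (hG (q, x) hx).comp x (contDiffAt_const.prodMk contDiffAt_id)
  have hd : DifferentiableAt ℝ (fderiv ℝ fun x => G (q, x)) x :=
    (hs.fderiv_right (m := ∞) (by norm_num)).differentiableAt (by norm_num)
  have e : (fun x => fderiv ℝ (fun x => G (q, x)) x (basisVec i)) =ᶠ[nhds x]
      fun x => pd (xDir i) G (q, x) := by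
    filter_upwards [isOpen_ne.mem_nhds hx] with y hy
    exact fderiv_slice (hG.differentiableAt hy) _
  have e2 := e.fderiv_eq (𝕜 := ℝ)
  have e3 : HasFDerivAt (fun x => fderiv ℝ (fun x => G (q, x)) x (basisVec i)) _ x :=
    hd.hasFDerivAt.clm_apply (hasFDerivAt_const (basisVec i) x)
  rw [e3.fderiv] at e2
  have e4 := congrArg (fun L : E3 →L[ℝ] ℂ => L (basisVec i)) e2
  have e5 := fderiv_slice (q := q) ((hG.pd (xDir i)).differentiableAt (p := (q, x)) hx) (basisVec i)
  rw [e5] at e4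
  simpa [basisVec, pd, xDir] using e4

lemma lap_eq {u : ℝ → ℝ → S2 → ℂ} (hu : SmoothField u) (t s : ℝ) (w : S2) :
    lap u t s w = ∑ i, pd (xDir i) (pd (xDir i) (fieldExt u)) ((t, s), (w : E3)) := by
  rw [← laplacian_slice hu.smoothOff (S2.coe_ne_zero w)]
  rfl

lemma SmoothOff.sum {ι : Type*} {G : ι → (ℝ × ℝ) × E3 → ℂ} {A : Finset ι}
    (hG : ∀ i, SmoothOff (G i)) : SmoothOff (fun p => ∑ i ∈ A, G i p) := fun p hp =>
  ContDiffAt.sum fun i _ => hG i p hp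

lemma SmoothField.lap {u : ℝ → ℝ → S2 → ℂ} (hu : SmoothField u) : SmoothField (lap u) := by
  have h := (SmoothOff.sum (A := Finset.univ)
    fun i => (hu.smoothOff.pd (xDir i)).pd (xDir i)).smoothField
  have e : RNdS.lap u = fun (t s : ℝ) (w : S2) =>
      ∑ i, RNdS.pd (xDir i) (RNdS.pd (xDir i) (fieldExt u)) ((t, s), (w : E3)) := by
    funext t s w
    exact lap_eq hu t s w
  rw [e]
  exact h

lemma SmoothField.dt_apply {u : ℝ → ℝ → S2 → ℂ} (hu : SmoothField u) (t s : ℝ) (w : S2) :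
    RNdS.dt u t s w = RNdS.pd tDir (fieldExt u) ((t, s), (w : E3)) := by
  rw [← fieldExt_dt hu (S2.coe_ne_zero w), fieldExt_coe]

lemma SmoothField.dr_apply {u : ℝ → ℝ → S2 → ℂ} (hu : SmoothField u) (t s : ℝ) (w : S2) :
    RNdS.dr u t s w = RNdS.pd sDir (fieldExt u) ((t, s), (w : E3)) := by
  rw [← fieldExt_dr hu (S2.coe_ne_zero w), fieldExt_coe]

lemma SmoothField.hasDerivAt_fst {u : ℝ → ℝ → S2 → ℂ} (hu : SmoothField u) (t s : ℝ) (w : S2) :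
    HasDerivAt (fun τ => u τ s w) (RNdS.dt u t s w) t := by
  have h := hasDerivAt_fst_line (fieldExt u) (t := t) (s := s) (x := w)
    (hu.smoothOff.differentiableAt (S2.coe_ne_zero w))
  rw [← hu.dt_apply] at h
  simpa only [fieldExt_coe] using h

lemma SmoothField.hasDerivAt_snd {u : ℝ → ℝ → S2 → ℂ} (hu : SmoothField u) (t s : ℝ) (w : S2) :
    HasDerivAt (fun τ => u t τ w) (RNdS.dr u t s w) s := by
  have h := hasDerivAt_snd_line (fieldExt u) (t := t) (s := s) (x := w)
    (hu.smoothOff.differentiableAt (S2.coe_ne_zero w))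
  rw [← hu.dr_apply] at h
  simpa only [fieldExt_coe] using h

lemma pd_pd_pd_comm {G : (ℝ × ℝ) × E3 → ℂ} (hG : SmoothOff G) (v e : (ℝ × ℝ) × E3)
    {p : (ℝ × ℝ) × E3} (hp : p.2 ≠ 0) :
    pd v (pd e (pd e G)) p = pd e (pd e (pd v G)) p := by
  rw [(hG.pd e).pd_comm v e hp]
  exact pd_congr (fun q hq => hG.pd_comm v e hq) e hp

lemma pd_sum {ι : Type*} {G : ι → (ℝ × ℝ) × E3 → ℂ} {A : Finset ι} (hG : ∀ i, SmoothOff (G i))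
    (v : (ℝ × ℝ) × E3) {p : (ℝ × ℝ) × E3} (hp : p.2 ≠ 0) :
    pd v (fun p => ∑ i ∈ A, G i p) p = ∑ i ∈ A, pd v (G i) p := by
  unfold pd
  rw [fderiv_fun_sum fun i _ => (hG i).differentiableAt hp]
  simp

/-- The derivative of `Δu` along a line of `ℝ × ℝ`. -/
lemma lap_dt_comm {u : ℝ → ℝ → S2 → ℂ} (hu : SmoothField u) : dt (lap u) = lap (dt u) := by
  funext t s w
  have hw := S2.coe_ne_zero w
  rw [lap_eq hu.dt]
  have h := hasDerivAt_fst_line (fun p => ∑ i, pd (xDir i) (pd (xDir i) (fieldExt u)) p)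
    (t := t) (s := s) (x := w) ((SmoothOff.sum (A := Finset.univ)
    fun i => (hu.smoothOff.pd (xDir i)).pd (xDir i)).differentiableAt hw)
  simp only [← lap_eq hu] at h
  rw [show dt (lap u) t s w = _ from h.deriv,
    pd_sum (fun i => (hu.smoothOff.pd (xDir i)).pd (xDir i)) _ hw]
  refine Finset.sum_congr rfl fun i _ => ?_
  rw [pd_pd_pd_comm hu.smoothOff _ _ hw]
  exact (pd_congr (fun q hq => pd_congr (fun r hr => fieldExt_dt hu hr) _ hq) _ hw).symm

lemma lap_dr_comm {u : ℝ → ℝ → S2 → ℂ} (hu : SmoothField u) : dr (lap u) = lap (dr u) := by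
  funext t s w
  have hw := S2.coe_ne_zero w
  rw [lap_eq hu.dr]
  have h := hasDerivAt_snd_line (fun p => ∑ i, pd (xDir i) (pd (xDir i) (fieldExt u)) p)
    (t := t) (s := s) (x := w) ((SmoothOff.sum (A := Finset.univ)
    fun i => (hu.smoothOff.pd (xDir i)).pd (xDir i)).differentiableAt hw)
  simp only [← lap_eq hu] at h
  rw [show dr (lap u) t s w = _ from h.deriv,
    pd_sum (fun i => (hu.smoothOff.pd (xDir i)).pd (xDir i)) _ hw]
  refine Finset.sum_congr rfl fun i _ => ?_
  rw [pd_pd_pd_comm hu.smoothOff _ _ hw]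
  exact (pd_congr (fun q hq => pd_congr (fun r hr => fieldExt_dr hu hr) _ hq) _ hw).symm

lemma dt_dr_comm {u : ℝ → ℝ → S2 → ℂ} (hu : SmoothField u) : dt (dr u) = dr (dt u) := by
  funext t s w
  have hw := S2.coe_ne_zero w
  rw [hu.dr.dt_apply, hu.dt.dr_apply, pd_congr (fun q hq => fieldExt_dr hu hq) _ hw,
    pd_congr (fun q hq => fieldExt_dt hu hq) _ hw]
  exact hu.smoothOff.pd_comm _ _ hw

lemma SmoothField.continuous {u : ℝ → ℝ → S2 → ℂ} (hu : SmoothField u) :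
    Continuous (fun p : (ℝ × ℝ) × S2 => u p.1.1 p.1.2 p.2) := ContMDiff.continuous hu

/-! ### Polar coordinates -/

instance : IsFiniteMeasure area := inferInstanceAs (IsFiniteMeasure (Measure.toSphere _))

lemma homeomorphUnitSphereProd_fst {x : E3} (hx : x ≠ 0) :
    (homeomorphUnitSphereProd E3 ⟨x, hx⟩).1 = toS2 x := by
  apply Subtype.ext
  simp [toS2, hx]

lemma measurePreserving_polar :
    MeasurePreserving (homeomorphUnitSphereProd E3) ((volume : Measure E3).comap Subtype.val)
      (area.prod (Measure.volumeIoiPow 2)) := by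
  have h := (volume : Measure E3).measurePreserving_homeomorphUnitSphereProd
  simpa [area] using h

lemma integral_volumeIoiPow (k : ℝ → ℝ) :
    ∫ r : Ioi (0 : ℝ), k r ∂(Measure.volumeIoiPow 2) = ∫ r in Ioi (0 : ℝ), r ^ 2 * k r := by
  simp only [Measure.volumeIoiPow, ENNReal.ofReal]
  rw [integral_withDensity_eq_integral_smul,
    integral_subtype_comap measurableSet_Ioi fun a ↦ Real.toNNReal (a ^ 2) • k a,
    setIntegral_congr_fun measurableSet_Ioi fun x hx ↦ ?_]
  · rw [NNReal.smul_def, Real.coe_toNNReal _ (pow_nonneg hx.out.le _), smul_eq_mul]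
  · exact (measurable_subtype_coe.pow_const _).real_toNNReal

lemma integrable_volumeIoiPow {k : ℝ → ℝ}
    (hk : IntegrableOn (fun r : ℝ => r ^ 2 * k r) (Ioi 0)) :
    Integrable (fun r : Ioi (0 : ℝ) => k r) (Measure.volumeIoiPow 2) := by
  rw [integrableOn_iff_comap_subtypeVal measurableSet_Ioi] at hk
  rw [Measure.volumeIoiPow, integrable_withDensity_iff_integrable_smul']
  · refine hk.congr (.of_forall ?_)
    rintro ⟨x, hx : 0 < x⟩
    simp (disch := positivity) [ENNReal.toReal_ofReal]
  · fun_prop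
  · simp

/-- Integration in polar coordinates of the product of a function of the direction and a function
of the radius. -/
lemma integral_polar {F : Type*} [NormedAddCommGroup F] [NormedSpace ℝ F]
    (φ : S2 → F) (k : ℝ → ℝ) :
    ∫ x : E3, k ‖x‖ • φ (toS2 x) = (∫ r in Ioi (0 : ℝ), r ^ 2 * k r) • ∫ w, φ w ∂area := by
  calc
    ∫ x : E3, k ‖x‖ • φ (toS2 x)
      = ∫ x : ({(0)}ᶜ : Set E3), k ‖x.1‖ • φ (toS2 x.1) ∂((volume : Measure E3).comap Subtype.val) := by
      rw [integral_subtype_comap (measurableSet_singleton _).compl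
        fun x : E3 ↦ k ‖x‖ • φ (toS2 x), restrict_compl_singleton]
    _ = ∫ p, k (p.2 : ℝ) • φ p.1 ∂(area.prod (Measure.volumeIoiPow 2)) := by
      rw [← measurePreserving_polar.integral_comp (Homeomorph.measurableEmbedding _)
        (fun p => k (p.2 : ℝ) • φ p.1)]
      refine integral_congr_ae (.of_forall fun x => ?_)
      have := homeomorphUnitSphereProd_fst x.2
      simp only [Subtype.coe_eta] at this
      simp [this]
    _ = (∫ r : Ioi (0 : ℝ), k r ∂(Measure.volumeIoiPow 2)) • ∫ w, φ w ∂area := by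
      rw [← integral_prod_swap]
      exact integral_prod_smul (fun r : Ioi (0 : ℝ) => k r) φ
    _ = _ := by rw [integral_volumeIoiPow]

lemma integrable_polar {F : Type*} [NormedAddCommGroup F] [NormedSpace ℝ F]
    {φ : S2 → F} {k : ℝ → ℝ} (hφ : Integrable φ area)
    (hk : IntegrableOn (fun r : ℝ => r ^ 2 * k r) (Ioi 0)) :
    Integrable (fun x : E3 => k ‖x‖ • φ (toS2 x)) := by
  have h1 : Integrable (fun p : S2 × Ioi (0 : ℝ) => k (p.2 : ℝ) • φ p.1)
      (area.prod (Measure.volumeIoiPow 2)) :=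
    ((integrable_volumeIoiPow hk).smul_prod hφ).swap
  have h2 := (measurePreserving_polar.integrable_comp_emb
    (Homeomorph.measurableEmbedding _)).2 h1
  rw [← restrict_compl_singleton (μ := (volume : Measure E3)) 0, ← IntegrableOn,
    integrableOn_iff_comap_subtypeVal (measurableSet_singleton _).compl]
  refine h2.congr (.of_forall fun x => ?_)
  have := homeomorphUnitSphereProd_fst x.2
  simp only [Subtype.coe_eta] at this
  simp [this]

/-! ### Green's formula on the sphere -/

/-- Smoothness of a function on the sphere, expressed through its extension along rays. -/
def SmoothS (φ : S2 → ℂ) : Prop := ∀ x : E3, x ≠ 0 → ContDiffAt ℝ ∞ (radialExt φ) x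

/-- The partial derivative of a function on `ℝ³`. -/
def pdx (i : Fin 3) (H : E3 → ℂ) : E3 → ℂ := fun x => fderiv ℝ H x (basisVec i)

/-- The real part of the inner product of the gradients of two functions on the sphere. -/
def gradInner (φ ψ : S2 → ℂ) (w : S2) : ℝ :=
  ∑ i, inner ℝ (pdx i (radialExt φ) w) (pdx i (radialExt ψ) w)

lemma SmoothField.smoothS {u : ℝ → ℝ → S2 → ℂ} (hu : SmoothField u) (t s : ℝ) :
    SmoothS (u t s) := fun x hx =>
  (hu.smoothOff ((t, s), x) hx).comp x (contDiffAt_const.prodMk contDiffAt_id)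

lemma sphGradSq_eq_gradInner (φ : S2 → ℂ) (w : S2) : sphGradSq φ w = gradInner φ φ w := by
  simp [sphGradSq, gradInner, pdx, basisVec]

lemma gradInner_comm (φ ψ : S2 → ℂ) (w : S2) : gradInner φ ψ w = gradInner ψ φ w := by
  simp only [gradInner, real_inner_comm]

lemma contDiffAt_pdx {H : E3 → ℂ} {x : E3} (hH : ContDiffAt ℝ ∞ H x) (i : Fin 3) :
    ContDiffAt ℝ ∞ (pdx i H) x :=
  (hH.fderiv_right (m := ∞) (by norm_num)).clm_apply contDiffAt_const

lemma sphLaplacian_eq {φ : S2 → ℂ} (hφ : SmoothS φ) (w : S2) :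
    sphLaplacian φ w = ∑ i, pdx i (pdx i (radialExt φ)) w := by
  have hw := S2.coe_ne_zero w
  unfold sphLaplacian
  rw [InnerProductSpace.laplacian_eq_iteratedFDeriv_orthonormalBasis _
    (EuclideanSpace.basisFun (Fin 3) ℝ)]
  refine Finset.sum_congr rfl fun i _ => ?_
  rw [iteratedFDeriv_two_apply]
  have hd : DifferentiableAt ℝ (fderiv ℝ (radialExt φ)) (w : E3) :=
    ((hφ _ hw).fderiv_right (m := ∞) (by norm_num)).differentiableAt (by norm_num)
  have e3 : HasFDerivAt (pdx i (radialExt φ)) _ (w : E3) :=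
    hd.hasFDerivAt.clm_apply (hasFDerivAt_const (basisVec i) (w : E3))
  rw [pdx, e3.fderiv]
  simp [basisVec]

lemma pdx_smul {H : E3 → ℂ} {c a : ℝ} (hc : 0 < c)
    (hH : ∀ x : E3, x ≠ 0 → H (c • x) = a • H x) {x : E3} (hx : x ≠ 0)
    (hd : DifferentiableAt ℝ H x) (i : Fin 3) :
    pdx i H (c • x) = (c⁻¹ * a) • pdx i H x := by
  have h1 : fderiv ℝ (fun y => H (c • y)) x = c • fderiv ℝ H (c • x) := fderiv_comp_smul c
  have h2 : (fun y => H (c • y)) =ᶠ[nhds x] fun y => a • H y := by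
    filter_upwards [isOpen_ne.mem_nhds hx] with y hy using hH y hy
  rw [h2.fderiv_eq, fderiv_fun_const_smul hd] at h1
  have h3 := congrArg (fun L : E3 →L[ℝ] ℂ => c⁻¹ • L (basisVec i)) h1
  simp only [smul_apply, smul_smul, inv_mul_cancel₀ hc.ne', one_smul] at h3
  exact h3.symm

lemma SmoothS.differentiableAt {φ : S2 → ℂ} (hφ : SmoothS φ) {x : E3} (hx : x ≠ 0) :
    DifferentiableAt ℝ (radialExt φ) x := (hφ x hx).differentiableAt (by norm_num)

lemma pdx_radialExt_smul {φ : S2 → ℂ} (hφ : SmoothS φ) {c : ℝ} (hc : 0 < c) {x : E3}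
    (hx : x ≠ 0) (i : Fin 3) : pdx i (radialExt φ) (c • x) = c⁻¹ • pdx i (radialExt φ) x := by
  have := pdx_smul (a := 1) hc (fun y hy => by rw [radialExt_smul φ hc hy, one_smul]) hx
    (hφ.differentiableAt hx) i
  simpa using this

lemma pdx_pdx_radialExt_smul {φ : S2 → ℂ} (hφ : SmoothS φ) {c : ℝ} (hc : 0 < c) {x : E3}
    (hx : x ≠ 0) (i : Fin 3) : pdx i (pdx i (radialExt φ)) (c • x)
      = (c⁻¹ * c⁻¹) • pdx i (pdx i (radialExt φ)) x :=
  pdx_smul hc (fun y hy => pdx_radialExt_smul hφ hc hy i) hx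
    ((contDiffAt_pdx (hφ x hx) i).differentiableAt (by norm_num)) i

/-- A vector of `ℝ³` in terms of the standard basis. -/
lemma sum_smul_basisVec (x : E3) : ∑ i, x i • basisVec i = x := by
  ext j
  simp [basisVec, Finset.sum_apply, Pi.single_apply]

/-- Euler's identity: the extension has no radial derivative. -/
lemma sum_mul_pdx_radialExt {φ : S2 → ℂ} (hφ : SmoothS φ) {x : E3} (hx : x ≠ 0) :
    ∑ i, x i • pdx i (radialExt φ) x = 0 := by
  have h1 : ∑ i, x i • pdx i (radialExt φ) x = fderiv ℝ (radialExt φ) x x := by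
    have h := congrArg (fderiv ℝ (radialExt φ) x) (sum_smul_basisVec x)
    rw [map_sum] at h
    simpa [pdx] using h
  rw [h1]
  have h2 : HasDerivAt (fun c : ℝ => c • x) x 1 := by
    simpa using (hasDerivAt_id (1 : ℝ)).smul_const x
  have h3 : HasDerivAt (fun c : ℝ => radialExt φ (c • x)) (fderiv ℝ (radialExt φ) x x) 1 := by
    have h4 : HasFDerivAt (radialExt φ) (fderiv ℝ (radialExt φ) x) ((1 : ℝ) • x) := by
      rw [one_smul]; exact (hφ.differentiableAt hx).hasFDerivAt
    exact h4.comp_hasDerivAt (1 : ℝ) h2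
  have h5 : (fun c : ℝ => radialExt φ (c • x)) =ᶠ[nhds 1] fun _ => radialExt φ x := by
    filter_upwards [lt_mem_nhds (zero_lt_one (α := ℝ))] with c hc using radialExt_smul φ hc hx
  have h6 := h5.hasDerivAt_iff.1 h3
  exact h6.unique (hasDerivAt_const _ _)

lemma integral_fderiv_eq_zero {F : E3 → ℝ} (hF : ContDiff ℝ 1 F) (hc : HasCompactSupport F)
    (v : E3) : ∫ x, fderiv ℝ F x v = 0 := by
  have hi : Integrable (fun x => fderiv ℝ F x v) :=
    ((hF.continuous_fderiv one_ne_zero).clm_apply continuous_const).integrable_of_hasCompactSupport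
      (hc.fderiv_apply (𝕜 := ℝ) v)
  have h := integral_mul_fderiv_eq_neg_fderiv_mul_of_integrable (μ := (volume : Measure E3))
    (f := fun _ => (1 : ℝ)) (g := F) (v := v) (by simp) (by simpa using hi)
    (by simpa using hF.continuous.integrable_of_hasCompactSupport hc)
    (fun x _ => differentiableAt_const _)
    (fun x _ => (hF.differentiable one_ne_zero) x)
  simpa using h

lemma norm_smul_toS2 {x : E3} (hx : x ≠ 0) : ‖x‖ • (toS2 x : E3) = x := by
  simp [toS2, hx, smul_smul]

/-- A radial cutoff, supported in a shell around the unit sphere. -/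
def shellBump : ContDiffBump (2 : ℝ) := ⟨1 / 2, 1, by norm_num, by norm_num⟩

lemma shellBump_zero_of_lt {x : E3} (hx : ‖x‖ < 1) : shellBump (‖x‖ ^ 2) = 0 := by
  refine shellBump.zero_of_le_dist ?_
  have : ‖x‖ ^ 2 < 1 := by nlinarith [norm_nonneg x]
  rw [Real.dist_eq, abs_of_neg (by linarith)]
  show (1 : ℝ) ≤ _
  linarith

lemma shellBump_zero_of_gt {x : E3} (hx : 2 < ‖x‖) : shellBump (‖x‖ ^ 2) = 0 := by
  refine shellBump.zero_of_le_dist ?_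
  have : 4 < ‖x‖ ^ 2 := by nlinarith [norm_nonneg x]
  rw [Real.dist_eq, abs_of_pos (by linarith)]
  show (1 : ℝ) ≤ _
  linarith

lemma integral_shellBump_pos :
    0 < ∫ r in Ioi (0 : ℝ), r ^ 2 * (shellBump (r ^ 2) * (r ^ 2)⁻¹) := by
  have e : ∫ r in Ioi (0 : ℝ), r ^ 2 * (shellBump (r ^ 2) * (r ^ 2)⁻¹)
      = ∫ r in Ioi (0 : ℝ), shellBump (r ^ 2) := by
    refine setIntegral_congr_fun measurableSet_Ioi fun r hr => ?_
    have : (r : ℝ) ≠ 0 := (mem_Ioi.1 hr).ne'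
    field_simp
  rw [e]
  have hcont : Continuous fun r : ℝ => shellBump (r ^ 2) :=
    shellBump.continuous.comp (by fun_prop)
  have hcs : HasCompactSupport fun r : ℝ => shellBump (r ^ 2) := by
    refine HasCompactSupport.of_support_subset_isCompact (isCompact_Icc (a := -2) (b := 2)) ?_
    intro r hr
    by_contra hr2
    apply hr
    refine shellBump.zero_of_le_dist ?_
    have : 4 < r ^ 2 := by
      rw [mem_Icc, not_and_or, not_le, not_le] at hr2
      rcases hr2 with h | h <;> nlinarith
    rw [Real.dist_eq, abs_of_pos (by linarith)]
    show (1 : ℝ) ≤ _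
    linarith
  rw [setIntegral_pos_iff_support_of_nonneg_ae (.of_forall fun r => shellBump.nonneg)
    (hcont.integrable_of_hasCompactSupport hcs).integrableOn]
  have hsub : Ioo (13 / 10 : ℝ) (3 / 2) ⊆ Function.support (fun r : ℝ => shellBump (r ^ 2)) ∩ Ioi 0 := by
    intro r hr
    refine ⟨?_, by have := hr.1; simp only [mem_Ioi]; linarith⟩
    refine (shellBump.pos_of_mem_ball ?_).ne'
    rw [Metric.mem_ball, Real.dist_eq, abs_lt]
    show (-1 : ℝ) < _ ∧ _ < (1 : ℝ)
    constructor <;> nlinarith [hr.1, hr.2]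
  refine lt_of_lt_of_le ?_ (measure_mono hsub)
  rw [Real.volume_Ioo]
  norm_num

/-- Green's formula on the round sphere: the divergence theorem in `ℝ³` applied to
`ρ ⟪Φ, ∇Ψ⟫`, where `Φ`, `Ψ` are the extensions along rays and `ρ` is a radial cutoff. The gradient
of `ρ` is radial, hence orthogonal to `∇Ψ`. -/
theorem integral_gradInner_add {φ ψ : S2 → ℂ} (hφ : SmoothS φ) (hψ : SmoothS ψ) :
    ∫ w, (gradInner φ ψ w + inner ℝ (φ w) (sphLaplacian ψ w)) ∂area = 0 := by
  let B : E3 → ℝ := fun x =>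
    ∑ i, (inner ℝ (pdx i (radialExt φ) x) (pdx i (radialExt ψ) x) + inner ℝ (radialExt φ x) (pdx i (pdx i (radialExt ψ)) x))
  let F : Fin 3 → E3 → ℝ := fun i x => shellBump (‖x‖ ^ 2) * inner ℝ (radialExt φ x) (pdx i (radialExt ψ) x)
  have hbump : ContDiff ℝ ∞ fun x : E3 => shellBump (‖x‖ ^ 2) :=
    shellBump.contDiff.comp (contDiff_norm_sq ℝ)
  have hF0 : ∀ i (x : E3), x ≠ 0 → ContDiffAt ℝ ∞ (F i) x := fun i x hx =>
    hbump.contDiffAt.mul ((hφ x hx).inner ℝ (contDiffAt_pdx (hψ x hx) i))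
  have hF : ∀ i, ContDiff ℝ 1 (F i) := by
    intro i
    rw [contDiff_iff_contDiffAt]
    intro x
    by_cases hx : x = 0
    · have : F i =ᶠ[nhds x] fun _ => 0 := by
        filter_upwards [Metric.ball_mem_nhds x one_pos] with y hy
        rw [hx, mem_ball_zero_iff] at hy
        simp [F, shellBump_zero_of_lt hy]
      exact contDiffAt_const.congr_of_eventuallyEq this
    · exact (hF0 i x hx).of_le (by norm_num)
  have hFc : ∀ i, HasCompactSupport (F i) := by
    intro i
    refine HasCompactSupport.of_support_subset_isCompact (isCompact_closedBall (0 : E3) 2) ?_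
    intro x hx
    by_contra h
    apply hx
    rw [mem_closedBall_zero_iff, not_le] at h
    simp [F, shellBump_zero_of_gt h]
  have h0 : ∫ x, ∑ i, fderiv ℝ (F i) x (basisVec i) = 0 := by
    rw [integral_finsetSum]
    · exact Finset.sum_eq_zero fun i _ => integral_fderiv_eq_zero (hF i) (hFc i) _
    · intro i _
      exact (((hF i).continuous_fderiv one_ne_zero).clm_apply
        continuous_const).integrable_of_hasCompactSupport ((hFc i).fderiv_apply (𝕜 := ℝ) _)
  -- the gradient of the cutoff is radial and `ψ` is extended constantly along rays, so the cutoff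
  -- contributes nothing to the divergence
  have h1 : ∀ x : E3, x ≠ 0 → ∑ i, fderiv ℝ (F i) x (basisVec i)
      = shellBump (‖x‖ ^ 2) * B x := by
    intro x hx
    have hbd : HasFDerivAt (fun x : E3 => shellBump (‖x‖ ^ 2))
        (deriv shellBump (‖x‖ ^ 2) • (2 • innerSL ℝ x)) x := by
      have a1 : HasDerivAt shellBump (deriv shellBump (‖x‖ ^ 2)) (‖x‖ ^ 2) :=
        ((shellBump.contDiff (n := 1)).differentiable one_ne_zero _).hasDerivAt
      exact HasDerivAt.comp_hasFDerivAt (h₂ := fun r : ℝ => shellBump r) x a1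
        (hasStrictFDerivAt_norm_sq x).hasFDerivAt
    have hi : ∀ i, fderiv ℝ (F i) x (basisVec i)
        = shellBump (‖x‖ ^ 2) * (inner ℝ (pdx i (radialExt φ) x) (pdx i (radialExt ψ) x)
            + inner ℝ (radialExt φ x) (pdx i (pdx i (radialExt ψ)) x))
          + 2 * deriv shellBump (‖x‖ ^ 2) * inner ℝ (radialExt φ x) (x i • pdx i (radialExt ψ) x) := by
      intro i
      have hin : HasFDerivAt (fun x => inner ℝ (radialExt φ x) (pdx i (radialExt ψ) x)) _ x :=
        (hφ.differentiableAt hx).hasFDerivAt.inner ℝ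
          ((contDiffAt_pdx (hψ x hx) i).differentiableAt (by norm_num)).hasFDerivAt
      have : HasFDerivAt (F i) _ x := hbd.mul hin
      have hxi : inner ℝ x (EuclideanSpace.single i (1 : ℝ)) = x i := by
        simp [EuclideanSpace.inner_single_right]
      rw [this.fderiv]
      simp [basisVec, pdx, hxi]
      ring
    rw [Finset.sum_congr rfl fun i _ => hi i, Finset.sum_add_distrib, ← Finset.mul_sum,
      ← Finset.mul_sum, ← inner_sum, sum_mul_pdx_radialExt hψ hx]
    simp [B]
  -- the integrand is homogeneous of degree `-2`, so the radial integral splits off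
  have h2 : ∀ x : E3, x ≠ 0 → B x = (‖x‖ ^ 2)⁻¹ * B (toS2 x) := by
    intro x hx
    have hn : 0 < ‖x‖ := norm_pos_iff.2 hx
    have hw := S2.coe_ne_zero (toS2 x)
    conv_lhs => rw [← norm_smul_toS2 hx]
    simp only [B]
    rw [Finset.mul_sum]
    refine Finset.sum_congr rfl fun i _ => ?_
    rw [pdx_radialExt_smul hφ hn hw, pdx_radialExt_smul hψ hn hw,
      pdx_pdx_radialExt_smul hψ hn hw, radialExt_smul φ hn hw]
    simp only [inner_smul_left, inner_smul_right, RCLike.conj_to_real]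
    field_simp
  have h3 : ∫ x : E3, (shellBump (‖x‖ ^ 2) * (‖x‖ ^ 2)⁻¹) • B (toS2 x) = 0 := by
    rw [← h0]
    refine integral_congr_ae ?_
    have : ∀ᵐ x : E3, x ≠ 0 := by simp [ae_iff, measure_singleton]
    filter_upwards [this] with x hx
    rw [h1 x hx, h2 x hx, smul_eq_mul, mul_assoc]
  rw [integral_polar (fun w => B w) (fun r => shellBump (r ^ 2) * (r ^ 2)⁻¹)] at h3
  rcases smul_eq_zero.1 h3 with h4 | h4
  · exact absurd h4 integral_shellBump_pos.ne'
  · rw [← h4]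
    refine integral_congr_ae (.of_forall fun w => ?_)
    simp only [B, gradInner, sphLaplacian_eq hψ, inner_sum, Finset.sum_add_distrib]
    rw [radialExt_coe]

/-! ### The Poincaré inequality on the sphere -/

/-- The Gaussian weight `exp (-|x|² / 2)` on `ℝ³`. -/
def gw (x : E3) : ℝ := Real.exp (-(1 / 2) * ‖x‖ ^ 2)

lemma gw_pos (x : E3) : 0 < gw x := Real.exp_pos _

lemma continuous_gw : Continuous gw := by unfold gw; fun_prop

lemma integrable_pow_mul_gaussian (n : ℕ) :
    Integrable (fun r : ℝ => r ^ n * Real.exp (-(1 / 2) * r ^ 2)) := by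
  have h := integrable_rpow_mul_exp_neg_mul_sq (b := 1 / 2) (by norm_num) (s := n)
    (by have : (0 : ℝ) ≤ n := n.cast_nonneg
        linarith)
  simpa only [Real.rpow_natCast] using h

lemma integrable_norm_pow_mul_gw (n : ℕ) : Integrable (fun x : E3 => ‖x‖ ^ n * gw x) := by
  have h := (integrable_fun_norm_addHaar (volume : Measure E3)
    (f := fun r => r ^ n * Real.exp (-(1 / 2) * r ^ 2))).2 ?_
  · exact h
  · have := (integrable_pow_mul_gaussian (n + 2)).integrableOn (s := Ioi 0)
    refine this.congr (.of_forall fun r => ?_)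
    simp only [finrank_euclideanSpace, Fintype.card_fin, smul_eq_mul]
    ring

lemma integrable_gw : Integrable gw := by simpa using integrable_norm_pow_mul_gw 0

/-- The total mass of the Gaussian weight. -/
def gwMass : ℝ := ∫ x, gw x

lemma gwMass_pos : 0 < gwMass :=
  (integral_pos_iff_support_of_nonneg (fun x => (gw_pos x).le) integrable_gw).2 <| by
    have : Function.support gw = univ := by
      ext x
      simp [(gw_pos x).ne']
    rw [this]
    simp

lemma gw_radial_moment : ∫ r in Ioi (0 : ℝ), r ^ 2 * Real.exp (-(1 / 2) * r ^ 2)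
    = ∫ r in Ioi (0 : ℝ), Real.exp (-(1 / 2) * r ^ 2) := by
  have h2 := integral_rpow_mul_exp_neg_mul_rpow (p := 2) (q := 2) (b := 1 / 2)
    (by norm_num) (by norm_num) (by norm_num)
  have h0 := integral_rpow_mul_exp_neg_mul_rpow (p := 2) (q := 0) (b := 1 / 2)
    (by norm_num) (by norm_num) (by norm_num)
  have e : ((2 : ℝ) + 1) / 2 = 1 / 2 + 1 := by norm_num
  have e2 : -((2 : ℝ) + 1) / 2 = -(0 + 1) / 2 - 1 := by norm_num
  rw [e, Real.Gamma_add_one (by norm_num), e2, Real.rpow_sub_one (by norm_num)] at h2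
  simp only [Real.rpow_two, Real.rpow_zero, one_mul] at h2 h0
  rw [h2, h0, zero_add]
  ring

lemma gw_radial_pos : 0 < ∫ r in Ioi (0 : ℝ), Real.exp (-(1 / 2) * r ^ 2) := by
  rw [integral_gaussian_Ioi]
  positivity

lemma hasFDerivAt_gw (x : E3) : HasFDerivAt gw (-(gw x) • innerSL ℝ x) x := by
  have h := ((hasStrictFDerivAt_norm_sq x).hasFDerivAt.const_mul (-(1 / 2))).exp
  refine h.congr_fderiv ?_
  ext v
  simp [gw]

lemma abs_coord_le (x : E3) (i : Fin 3) : |x i| ≤ ‖x‖ := by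
  simpa using PiLp.norm_apply_le x i

lemma integrable_coord_mul_coord_mul_gw (i j : Fin 3) :
    Integrable (fun x : E3 => x i * (x j * gw x)) := by
  refine (integrable_norm_pow_mul_gw 2).mono' ?_ (.of_forall fun x => ?_)
  · have := continuous_gw
    exact Continuous.aestronglyMeasurable (by fun_prop)
  · rw [Real.norm_eq_abs, abs_mul, abs_mul, abs_of_pos (gw_pos x), ← mul_assoc, sq]
    have := gw_pos x
    gcongr <;> exact abs_coord_le x _

/-- The second moments of the Gaussian weight, by integration by parts. -/
lemma integral_coord_mul_coord_mul_gw (i j : Fin 3) :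
    ∫ x : E3, x i * (x j * gw x) = if i = j then gwMass else 0 := by
  have hd : ∀ x, fderiv ℝ gw x (basisVec j) = -(x j * gw x) := by
    intro x
    have hxi : inner ℝ x (EuclideanSpace.single j (1 : ℝ)) = x j := by
      simp [EuclideanSpace.inner_single_right]
    rw [(hasFDerivAt_gw x).fderiv]
    simp [basisVec, hxi, mul_comm]
  have hp : ∀ x : E3, fderiv ℝ (fun x : E3 => x i) x (basisVec j) = if i = j then 1 else 0 := by
    intro x
    have : HasFDerivAt (fun x : E3 => x i) (EuclideanSpace.proj i : E3 →L[ℝ] ℝ) x :=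
      (EuclideanSpace.proj i : E3 →L[ℝ] ℝ).hasFDerivAt
    rw [this.fderiv]
    simp [basisVec]
  have hi : Integrable (fun x : E3 => x i * gw x) := by
    refine (integrable_norm_pow_mul_gw 1).mono' ?_ (.of_forall fun x => ?_)
    · have := continuous_gw
      exact Continuous.aestronglyMeasurable (by fun_prop)
    · rw [Real.norm_eq_abs, abs_mul, abs_of_pos (gw_pos x), pow_one]
      have := gw_pos x
      gcongr
      exact abs_coord_le x _
  have h := integral_mul_fderiv_eq_neg_fderiv_mul_of_integrable (μ := (volume : Measure E3))
    (f := fun x : E3 => x i) (g := gw) (v := basisVec j) ?_ ?_ hi ?_ ?_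
  · simp only [hd, hp, mul_neg, integral_neg, neg_inj] at h
    rw [h, integral_const_mul, gwMass]
    split_ifs <;> simp
  · simp only [hp]
    exact integrable_gw.const_mul _
  · simp only [hd, mul_neg]
    exact (integrable_coord_mul_coord_mul_gw i j).neg
  · exact fun x _ => (EuclideanSpace.proj i : E3 →L[ℝ] ℝ).differentiableAt
  · exact fun x _ => (hasFDerivAt_gw x).differentiableAt

lemma norm_sq_apply_eq (L : E3 →L[ℝ] ℂ) (y : E3) : ‖L y‖ ^ 2
    = ∑ i, ∑ j, (y i * y j) * inner ℝ (L (basisVec i)) (L (basisVec j)) := by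
  conv_lhs => rw [← sum_smul_basisVec y]
  rw [map_sum, ← real_inner_self_eq_norm_sq, sum_inner]
  refine Finset.sum_congr rfl fun i _ => ?_
  rw [inner_sum]
  refine Finset.sum_congr rfl fun j _ => ?_
  rw [map_smul, map_smul, real_inner_smul_left, real_inner_smul_right]
  ring

/-- The Gaussian mean of `‖L y‖ ^ 2` is a multiple of the Hilbert-Schmidt norm of `L`. -/
lemma lintegral_norm_sq_mul_gw (L : E3 →L[ℝ] ℂ) :
    ∫⁻ y, ENNReal.ofReal (‖L y‖ ^ 2) * ENNReal.ofReal (gw y)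
      = ENNReal.ofReal (gwMass * ∑ i, ‖L (basisVec i)‖ ^ 2) := by
  have e : ∀ y, ‖L y‖ ^ 2 * gw y
      = ∑ i, ∑ j, (y i * (y j * gw y)) * inner ℝ (L (basisVec i)) (L (basisVec j)) := by
    intro y
    rw [norm_sq_apply_eq, Finset.sum_mul]
    refine Finset.sum_congr rfl fun i _ => ?_
    rw [Finset.sum_mul]
    exact Finset.sum_congr rfl fun j _ => by ring
  have hi : Integrable fun y => ‖L y‖ ^ 2 * gw y := by
    simp only [e]
    exact integrable_finsetSum _ fun i _ => integrable_finsetSum _ fun j _ =>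
      (integrable_coord_mul_coord_mul_gw i j).mul_const _
  have h : ∫ y, ‖L y‖ ^ 2 * gw y = gwMass * ∑ i, ‖L (basisVec i)‖ ^ 2 := by
    simp only [e]
    rw [integral_finsetSum _ fun i _ => integrable_finsetSum _ fun j _ =>
      (integrable_coord_mul_coord_mul_gw i j).mul_const _, Finset.mul_sum]
    refine Finset.sum_congr rfl fun i _ => ?_
    rw [integral_finsetSum _ fun j _ => (integrable_coord_mul_coord_mul_gw i j).mul_const _]
    simp only [integral_mul_const, integral_coord_mul_coord_mul_gw, ite_mul, zero_mul,
      Finset.sum_ite_eq, Finset.mem_univ, if_true, real_inner_self_eq_norm_sq]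
  rw [← h, ofReal_integral_eq_lintegral_ofReal hi (.of_forall fun y => by
    have := gw_pos y
    positivity)]
  refine lintegral_congr fun y => ?_
  rw [ENNReal.ofReal_mul (by positivity)]

/-- The rotation of `ℝ³ × ℝ³` with cosine `c` and sine `s`. -/
def rot (c s : ℝ) (p : E3 × E3) : E3 × E3 := (c • p.1 + s • p.2, -(s • p.1) + c • p.2)

lemma measurePreserving_shear (a : ℝ) :
    MeasurePreserving (fun p : E3 × E3 => (p.1, a • p.1 + p.2)) (volume.prod volume)
      (volume.prod volume) := by
  refine (MeasurePreserving.id volume).skew_product (g := fun x y => a • x + y) ?_ ?_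
  · fun_prop
  · exact .of_forall fun x => (measurePreserving_add_left volume (a • x)).map_eq

lemma measurePreserving_shear' (a : ℝ) :
    MeasurePreserving (fun p : E3 × E3 => (p.1 + a • p.2, p.2)) (volume.prod volume)
      (volume.prod volume) := by
  have h := (Measure.measurePreserving_swap (μ := (volume : Measure E3)) (ν := volume)).comp
    ((measurePreserving_shear a).comp
      (Measure.measurePreserving_swap (μ := (volume : Measure E3)) (ν := volume)))
  have e : (Prod.swap ∘ (fun p : E3 × E3 => (p.1, a • p.1 + p.2)) ∘ Prod.swap)
      = fun p : E3 × E3 => (p.1 + a • p.2, p.2) := by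
    funext p
    simp [add_comm]
  rwa [e] at h

/-- A rotation of `ℝ³ × ℝ³` is a product of three shears, hence preserves the volume. -/
lemma measurePreserving_rot {c s : ℝ} (h : c ^ 2 + s ^ 2 = 1) (hc : 0 ≤ c) :
    MeasurePreserving (rot c s) (volume.prod volume) (volume.prod volume) := by
  have hc1 : 1 + c ≠ 0 := by positivity
  have h1 := (measurePreserving_shear' (s / (1 + c))).comp
    ((measurePreserving_shear (-s)).comp (measurePreserving_shear' (s / (1 + c))))
  have e1 : 1 - s * (s / (1 + c)) = c := by field_simp; linarith
  have e2 : s / (1 + c) * (1 + c) = s := by field_simp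
  convert h1 using 1
  funext p
  have k1 : c • p.1 + s • p.2 = (1 - s * (s / (1 + c))) • p.1 + (s / (1 + c) * (1 + c)) • p.2 := by
    rw [e1, e2]
  have k2 : -(s • p.1) + c • p.2 = -(s • p.1) + (1 - s * (s / (1 + c))) • p.2 := by rw [e1]
  refine Prod.ext ?_ ?_
  · simp only [rot, Function.comp]
    have k3 : c • p.1 + s • p.2 = (1 - s * (s / (1 + c))) • p.1
      + (s / (1 + c) + s / (1 + c) * (1 - s * (s / (1 + c)))) • p.2 := by
      rw [e1, ← mul_one_add, e2]
    rw [k3]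
    module
  · simp only [rot, Function.comp]
    rw [k2]
    module

lemma gw_mul_gw_rot {c s : ℝ} (h : c ^ 2 + s ^ 2 = 1) (p : E3 × E3) :
    gw (rot c s p).1 * gw (rot c s p).2 = gw p.1 * gw p.2 := by
  unfold gw rot
  rw [← Real.exp_add, ← Real.exp_add]
  congr 1
  have h1 := norm_add_sq_real (c • p.1) (s • p.2)
  have h2 := norm_add_sq_real (-(s • p.1)) (c • p.2)
  simp only [inner_neg_left, real_inner_smul_left, real_inner_smul_right, norm_neg, norm_smul,
    mul_pow, Real.norm_eq_abs, sq_abs] at h1 h2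
  dsimp only
  rw [h1, h2]
  linear_combination (-(1 / 2) * ‖p.1‖ ^ 2 - (1 / 2) * ‖p.2‖ ^ 2) * h

/-- The Gaussian weight on `ℝ³ × ℝ³` is invariant under rotations. -/
lemma lintegral_rot {c s : ℝ} (h : c ^ 2 + s ^ 2 = 1) (hc : 0 ≤ c) {f : E3 × E3 → ENNReal}
    (hf : Measurable f) :
    ∫⁻ p, f (rot c s p) * ENNReal.ofReal (gw p.1 * gw p.2) ∂(volume.prod volume)
      = ∫⁻ p, f p * ENNReal.ofReal (gw p.1 * gw p.2) ∂(volume.prod volume) := by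
  have hm : Measurable fun p : E3 × E3 => f p * ENNReal.ofReal (gw p.1 * gw p.2) := by
    have := continuous_gw.measurable
    fun_prop
  rw [← (measurePreserving_rot h hc).lintegral_comp hm]
  refine lintegral_congr fun p => ?_
  rw [gw_mul_gw_rot h]

lemma sq_integral_le {f : ℝ → ℝ} {a b : ℝ} (hab : a < b) (hf : Continuous f) :
    (∫ x in a..b, f x) ^ 2 ≤ (b - a) * ∫ x in a..b, f x ^ 2 := by
  set m := (∫ x in a..b, f x) / (b - a) with hm
  have hba : 0 < b - a := sub_pos.2 hab
  have h0 : 0 ≤ ∫ x in a..b, (f x - m) ^ 2 :=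
    intervalIntegral.integral_nonneg hab.le fun x _ => sq_nonneg _
  have e : ∀ x, (f x - m) ^ 2 = f x ^ 2 - (2 * m) * f x + m ^ 2 := fun x => by ring
  simp only [e] at h0
  rw [intervalIntegral.integral_add, intervalIntegral.integral_sub,
    intervalIntegral.integral_const_mul, intervalIntegral.integral_const, smul_eq_mul] at h0
  · have e2 : ∫ x in a..b, f x = m * (b - a) := by rw [hm]; field_simp
    rw [e2] at h0 ⊢
    nlinarith
  all_goals exact Continuous.intervalIntegrable (by fun_prop) _ _

lemma SmoothS.continuous {φ : S2 → ℂ} (hφ : SmoothS φ) : Continuous φ := by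
  rw [continuous_iff_continuousAt]
  intro w
  have h : ContinuousAt (fun w : S2 => radialExt φ (w : E3)) w :=
    ContinuousAt.comp (f := fun w : S2 => (w : E3))
      (hφ w (S2.coe_ne_zero w)).continuousAt continuous_subtype_val.continuousAt
  simpa only [radialExt_coe] using h

lemma SmoothS.continuous_pdx {φ : S2 → ℂ} (hφ : SmoothS φ) (i : Fin 3) :
    Continuous fun w : S2 => pdx i (radialExt φ) (w : E3) := by
  rw [continuous_iff_continuousAt]
  intro w
  exact ContinuousAt.comp (f := fun w : S2 => (w : E3)) (g := pdx i (radialExt φ))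
    (contDiffAt_pdx (hφ w (S2.coe_ne_zero w)) i).continuousAt continuous_subtype_val.continuousAt

lemma SmoothS.continuous_sphGradSq {φ : S2 → ℂ} (hφ : SmoothS φ) : Continuous (sphGradSq φ) := by
  have := hφ.continuous_pdx
  exact continuous_finsetSum _ fun i _ => (this i).norm.pow 2

lemma integrable_area {F : Type*} [NormedAddCommGroup F] {f : S2 → F} (hf : Continuous f) :
    Integrable f area :=
  hf.integrable_of_hasCompactSupport (HasCompactSupport.of_compactSpace f)

/-- The velocity of the path `θ ↦ cos θ x + sin θ y`. -/
lemma hasDerivAt_path (x y : E3) (θ : ℝ) :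
    HasDerivAt (fun θ => Real.cos θ • x + Real.sin θ • y) (-(Real.sin θ • x) + Real.cos θ • y) θ := by
  have h := ((Real.hasDerivAt_cos θ).smul_const x).add ((Real.hasDerivAt_sin θ).smul_const y)
  rw [neg_smul] at h
  exact h

/-- The increment of a function along a quarter circle, bounded by the square integral of its
derivative along the circle. -/
lemma norm_sub_sq_le_path {φ : S2 → ℂ} (hφ : SmoothS φ) {x y : E3}
    (hxy : ∀ θ : ℝ, Real.cos θ • x + Real.sin θ • y ≠ 0) :
    ENNReal.ofReal (‖radialExt φ y - radialExt φ x‖ ^ 2) ≤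
      ENNReal.ofReal (Real.pi / 2) * ∫⁻ θ in Ioc 0 (Real.pi / 2), ENNReal.ofReal
        (‖fderiv ℝ (radialExt φ) (rot (Real.cos θ) (Real.sin θ) (x, y)).1
          (rot (Real.cos θ) (Real.sin θ) (x, y)).2‖ ^ 2) := by
  set c : ℝ → E3 := fun θ => Real.cos θ • x + Real.sin θ • y with hc
  set c' : ℝ → E3 := fun θ => -(Real.sin θ • x) + Real.cos θ • y with hc'
  set D : ℝ → ℂ := fun θ => fderiv ℝ (radialExt φ) (c θ) (c' θ) with hD
  have hcc : Continuous c := by fun_prop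
  have hcc' : Continuous c' := by fun_prop
  have hDc : Continuous D := by
    rw [continuous_iff_continuousAt]
    intro θ
    have h1 : ContinuousAt (fun θ => fderiv ℝ (radialExt φ) (c θ)) θ :=
      ContinuousAt.comp (g := fderiv ℝ (radialExt φ))
        ((hφ _ (hxy θ)).fderiv_right (m := ∞) (by norm_num)).continuousAt hcc.continuousAt
    exact h1.clm_apply hcc'.continuousAt
  have hd : ∀ θ, HasDerivAt (fun θ => radialExt φ (c θ)) (D θ) θ := fun θ =>
    HasFDerivAt.comp_hasDerivAt (f := c) θ (hφ.differentiableAt (hxy θ)).hasFDerivAt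
      (hasDerivAt_path x y θ)
  have hI : ∫ θ in (0 : ℝ)..(Real.pi / 2), D θ = radialExt φ y - radialExt φ x := by
    rw [intervalIntegral.integral_eq_sub_of_hasDerivAt (fun θ _ => hd θ)
      (hDc.intervalIntegrable _ _)]
    simp [hc]
  have hpi : (0 : ℝ) < Real.pi / 2 := by positivity
  have h2 : ‖radialExt φ y - radialExt φ x‖ ^ 2
      ≤ (Real.pi / 2) * ∫ θ in (0 : ℝ)..(Real.pi / 2), ‖D θ‖ ^ 2 := by
    have h3 : ‖radialExt φ y - radialExt φ x‖ ≤ ∫ θ in (0 : ℝ)..(Real.pi / 2), ‖D θ‖ := by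
      rw [← hI]
      exact intervalIntegral.norm_integral_le_integral_norm hpi.le
    calc _ ≤ (∫ θ in (0 : ℝ)..(Real.pi / 2), ‖D θ‖) ^ 2 := by gcongr
      _ ≤ _ := by simpa using sq_integral_le hpi hDc.norm
  refine (ENNReal.ofReal_le_ofReal h2).trans ?_
  rw [ENNReal.ofReal_mul hpi.le, intervalIntegral.integral_of_le hpi.le,
    ofReal_integral_eq_lintegral_ofReal]
  · exact le_rfl
  · exact ((hDc.norm.pow 2).intervalIntegrable 0 (Real.pi / 2)).1
  · exact .of_forall fun θ => by positivity

/-- For almost all `x`, `y` the quarter circle from `x` to `y` avoids the origin. -/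
lemma ae_path_ne_zero : ∀ᵐ x : E3, ∀ᵐ y : E3,
    ∀ θ : ℝ, Real.cos θ • x + Real.sin θ • y ≠ 0 := by
  have h0 : ∀ᵐ x : E3, x ≠ 0 := by simp [ae_iff, measure_singleton]
  filter_upwards [h0] with x hx
  have hne : (Submodule.span ℝ {x} : Submodule ℝ E3) ≠ ⊤ := by
    intro h
    have h1 := finrank_span_singleton (K := ℝ) hx
    rw [h, finrank_top] at h1
    simp at h1
  have h1 : ∀ᵐ y : E3, y ∉ (Submodule.span ℝ {x} : Submodule ℝ E3) :=
    measure_eq_zero_iff_ae_notMem.1 (Measure.addHaar_submodule volume _ hne)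
  filter_upwards [h1] with y hy θ h
  by_cases hs : Real.sin θ = 0
  · have hcos : Real.cos θ ≠ 0 := by
      intro hc
      have := Real.sin_sq_add_cos_sq θ
      rw [hs, hc] at this
      norm_num at this
    rw [hs, zero_smul, add_zero] at h
    exact (smul_ne_zero hcos hx) h
  · apply hy
    have : y = (-(Real.sin θ)⁻¹ * Real.cos θ) • x := by
      have h2 := congrArg (fun z => (Real.sin θ)⁻¹ • z) h
      simp only [smul_add, smul_smul, inv_mul_cancel₀ hs, one_smul, smul_zero] at h2
      rw [neg_mul, neg_smul]
      exact (neg_eq_of_add_eq_zero_right h2).symm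
    rw [this]
    exact Submodule.smul_mem _ _ (Submodule.mem_span_singleton_self x)

lemma sum_norm_pdx_sq {φ : S2 → ℂ} (hφ : SmoothS φ) {x : E3} (hx : x ≠ 0) :
    ∑ i, ‖fderiv ℝ (radialExt φ) x (basisVec i)‖ ^ 2 = (‖x‖ ^ 2)⁻¹ * sphGradSq φ (toS2 x) := by
  have hn : 0 < ‖x‖ := norm_pos_iff.2 hx
  have h := fun i => pdx_radialExt_smul hφ hn (S2.coe_ne_zero (toS2 x)) i
  simp only [norm_smul_toS2 hx, pdx] at h
  simp only [h, norm_smul, norm_inv, norm_norm, sphGradSq, Finset.mul_sum, mul_pow, inv_pow]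
  rfl

/-- The Gaussian-weighted square integral of the derivative of an extension along rays. -/
lemma lintegral_fderiv_gw {φ : S2 → ℂ} (hφ : SmoothS φ) :
    ∫⁻ p : E3 × E3, ENNReal.ofReal (‖fderiv ℝ (radialExt φ) p.1 p.2‖ ^ 2)
        * ENNReal.ofReal (gw p.1 * gw p.2) ∂(volume.prod volume)
      = ENNReal.ofReal (gwMass * ((∫ r in Ioi (0 : ℝ), Real.exp (-(1 / 2) * r ^ 2))
          * ∫ w, sphGradSq φ w ∂area)) := by
  have hm : Measurable fun p : E3 × E3 => fderiv ℝ (radialExt φ) p.1 p.2 :=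
    ContinuousLinearMap.measurable_apply₂.comp
      (((measurable_fderiv ℝ (radialExt φ)).comp measurable_fst).prodMk measurable_snd)
  have hg := continuous_gw.measurable
  have ek : ∀ r ∈ Ioi (0 : ℝ), r ^ 2 * ((r ^ 2)⁻¹ * Real.exp (-(1 / 2) * r ^ 2))
      = Real.exp (-(1 / 2) * r ^ 2) := by
    intro r hr
    have : r ≠ 0 := (mem_Ioi.1 hr).ne'
    field_simp
  have h1 := integral_polar (sphGradSq φ) (fun r => (r ^ 2)⁻¹ * Real.exp (-(1 / 2) * r ^ 2))
  have h2 : Integrable fun x : E3 =>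
      ((‖x‖ ^ 2)⁻¹ * Real.exp (-(1 / 2) * ‖x‖ ^ 2)) • sphGradSq φ (toS2 x) := by
    refine integrable_polar (k := fun r => (r ^ 2)⁻¹ * Real.exp (-(1 / 2) * r ^ 2))
      (integrable_area hφ.continuous_sphGradSq) ?_
    refine IntegrableOn.congr_fun ?_ (fun r hr => (ek r hr).symm) measurableSet_Ioi
    simpa using (integrable_pow_mul_gaussian 0).integrableOn
  rw [setIntegral_congr_fun measurableSet_Ioi ek, smul_eq_mul] at h1
  rw [← h1, lintegral_prod _ (by fun_prop), ← integral_const_mul,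
    ofReal_integral_eq_lintegral_ofReal (h2.const_mul _)]
  · have h0 : ∀ᵐ x : E3, x ≠ 0 := by simp [ae_iff, measure_singleton]
    refine lintegral_congr_ae ?_
    filter_upwards [h0] with x hx
    calc _ = ∫⁻ y, ENNReal.ofReal (gw x) *
            (ENNReal.ofReal (‖fderiv ℝ (radialExt φ) x y‖ ^ 2) * ENNReal.ofReal (gw y)) := by
          refine lintegral_congr fun y => ?_
          rw [ENNReal.ofReal_mul (gw_pos x).le]
          ring
      _ = _ := by
          rw [lintegral_const_mul' _ _ ENNReal.ofReal_ne_top, lintegral_norm_sq_mul_gw,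
            sum_norm_pdx_sq hφ hx, ← ENNReal.ofReal_mul (gw_pos x).le]
          congr 1
          simp only [gw, smul_eq_mul]
          ring
  · refine .of_forall fun x => ?_
    have := gwMass_pos
    have : 0 ≤ sphGradSq φ (toS2 x) := Finset.sum_nonneg fun i _ => by positivity
    simp only [Pi.zero_apply, smul_eq_mul]
    positivity

/-- The Gaussian variance of the extension along rays of a function of mean zero. -/
lemma lintegral_sub_sq_gw {φ : S2 → ℂ} (hφ : SmoothS φ) (h0 : ∫ w, φ w ∂area = 0) :
    ∫⁻ x, ∫⁻ y, ENNReal.ofReal (‖radialExt φ y - radialExt φ x‖ ^ 2)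
        * ENNReal.ofReal (gw x * gw y)
      = ENNReal.ofReal (2 * (gwMass * ((∫ r in Ioi (0 : ℝ), Real.exp (-(1 / 2) * r ^ 2))
          * ∫ w, ‖φ w‖ ^ 2 ∂area))) := by
  set K := ∫ r in Ioi (0 : ℝ), Real.exp (-(1 / 2) * r ^ 2)
  set A := K * ∫ w, ‖φ w‖ ^ 2 ∂area with hA
  have hk : IntegrableOn (fun r : ℝ => r ^ 2 * Real.exp (-(1 / 2) * r ^ 2)) (Ioi 0) :=
    (integrable_pow_mul_gaussian 2).integrableOn
  have i1 : Integrable fun x : E3 => gw x • φ (toS2 x) :=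
    integrable_polar (integrable_area hφ.continuous) hk
  have i2 : Integrable fun x : E3 => gw x • ‖φ (toS2 x)‖ ^ 2 :=
    integrable_polar (φ := fun w => ‖φ w‖ ^ 2) (integrable_area (hφ.continuous.norm.pow 2)) hk
  have e1 : ∫ x : E3, gw x • φ (toS2 x) = 0 := by
    have := integral_polar φ (fun r => Real.exp (-(1 / 2) * r ^ 2))
    rw [h0, smul_zero] at this
    exact this
  have e2 : ∫ x : E3, gw x • ‖φ (toS2 x)‖ ^ 2 = A := by
    have := integral_polar (fun w => ‖φ w‖ ^ 2) (fun r => Real.exp (-(1 / 2) * r ^ 2))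
    rw [gw_radial_moment] at this
    exact this
  have hae : ∀ᵐ x : E3, x ≠ 0 := by simp [ae_iff, measure_singleton]
  have expand : ∀ x y : E3, ‖φ (toS2 y) - φ (toS2 x)‖ ^ 2 * (gw x * gw y)
      = gw x * (gw y • ‖φ (toS2 y)‖ ^ 2) + (gw x * ‖φ (toS2 x)‖ ^ 2) * gw y
        - (2 * gw x) * inner ℝ (φ (toS2 x)) (gw y • φ (toS2 y)) := by
    intro x y
    rw [norm_sub_sq_real, real_inner_smul_right, real_inner_comm, smul_eq_mul]
    ring
  have ii : ∀ x : E3, Integrable fun y => ‖φ (toS2 y) - φ (toS2 x)‖ ^ 2 * (gw x * gw y) := by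
    intro x
    simp only [expand]
    exact ((i2.const_mul _).add (integrable_gw.const_mul _)).sub
      ((i1.const_inner _).const_mul _)
  have inner_int : ∀ x : E3, ∫ y, ‖φ (toS2 y) - φ (toS2 x)‖ ^ 2 * (gw x * gw y)
      = A * gw x + gwMass * (gw x • ‖φ (toS2 x)‖ ^ 2) := by
    intro x
    have i3 : Integrable fun y => gw x * (gw y • ‖φ (toS2 y)‖ ^ 2)
        + (gw x * ‖φ (toS2 x)‖ ^ 2) * gw y :=
      (i2.const_mul _).add (integrable_gw.const_mul _)
    simp only [expand]
    rw [integral_sub i3 ((i1.const_inner _).const_mul _),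
      integral_add (i2.const_mul _) (integrable_gw.const_mul _), integral_const_mul,
      integral_const_mul, integral_const_mul, integral_inner i1, e1, e2, inner_zero_right,
      smul_eq_mul, gwMass]
    ring
  calc _ = ∫⁻ x, ENNReal.ofReal (A * gw x + gwMass * (gw x • ‖φ (toS2 x)‖ ^ 2)) := by
        refine lintegral_congr_ae ?_
        filter_upwards [hae] with x hx
        rw [← inner_int, ofReal_integral_eq_lintegral_ofReal (ii x) (.of_forall fun y => by
          have := gw_pos x
          have := gw_pos y
          positivity)]
        refine lintegral_congr_ae ?_
        filter_upwards [hae] with y hy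
        rw [radialExt_eq_comp_toS2 _ hx, radialExt_eq_comp_toS2 _ hy,
          ← ENNReal.ofReal_mul (by positivity)]
    _ = _ := by
        have hApos : 0 ≤ A := mul_nonneg gw_radial_pos.le (integral_nonneg fun w => by positivity)
        have i4 : Integrable fun x => A * gw x + gwMass * (gw x • ‖φ (toS2 x)‖ ^ 2) :=
          (integrable_gw.const_mul _).add (i2.const_mul _)
        rw [← ofReal_integral_eq_lintegral_ofReal i4]
        · rw [integral_add (integrable_gw.const_mul _) (i2.const_mul _), integral_const_mul,
            integral_const_mul, e2, ← gwMass]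
          congr 1
          ring
        · refine .of_forall fun x => ?_
          have := gw_pos x
          have := gwMass_pos
          simp only [Pi.zero_apply, smul_eq_mul]
          positivity

/-- A Poincaré inequality on the round sphere, obtained from the Gaussian weight on `ℝ³`: the
increment `Φ(y) - Φ(x)` is integrated along the quarter circle `cos θ x + sin θ y`, and the product
weight is invariant under the rotation by `θ`. The constant is not optimal. -/
theorem integral_norm_sq_le {φ : S2 → ℂ} (hφ : SmoothS φ) (h0 : ∫ w, φ w ∂area = 0) :
    ∫ w, ‖φ w‖ ^ 2 ∂area ≤ 2 * ∫ w, sphGradSq φ w ∂area := by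
  set K := ∫ r in Ioi (0 : ℝ), Real.exp (-(1 / 2) * r ^ 2) with hK
  have hKpos : 0 < K := gw_radial_pos
  set f : E3 × E3 → ENNReal := fun p => ENNReal.ofReal (‖fderiv ℝ (radialExt φ) p.1 p.2‖ ^ 2)
    with hf
  have hm : Measurable fun p : E3 × E3 => fderiv ℝ (radialExt φ) p.1 p.2 :=
    ContinuousLinearMap.measurable_apply₂.comp
      (((measurable_fderiv ℝ (radialExt φ)).comp measurable_fst).prodMk measurable_snd)
  have hfm : Measurable f := by fun_prop
  have hg := continuous_gw.measurable
  have hrm : Measurable fun q : (E3 × E3) × ℝ => rot (Real.cos q.2) (Real.sin q.2) q.1 := by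
    unfold rot
    fun_prop
  have hpi : (0 : ℝ) ≤ Real.pi / 2 := by positivity
  have key : ENNReal.ofReal (2 * (gwMass * (K * ∫ w, ‖φ w‖ ^ 2 ∂area)))
      ≤ ENNReal.ofReal ((Real.pi / 2) ^ 2 * (gwMass * (K * ∫ w, sphGradSq φ w ∂area))) := by
    rw [← lintegral_sub_sq_gw hφ h0]
    calc _ ≤ ∫⁻ x, ∫⁻ y, (ENNReal.ofReal (Real.pi / 2) * ∫⁻ θ in Ioc 0 (Real.pi / 2),
            f (rot (Real.cos θ) (Real.sin θ) (x, y))) * ENNReal.ofReal (gw x * gw y) := by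
          refine lintegral_mono_ae ?_
          filter_upwards [ae_path_ne_zero] with x hx
          refine lintegral_mono_ae ?_
          filter_upwards [hx] with y hy
          gcongr
          exact norm_sub_sq_le_path hφ hy
      _ = ∫⁻ p : E3 × E3, (∫⁻ θ : ℝ in Ioc 0 (Real.pi / 2), ENNReal.ofReal (Real.pi / 2) *
            (f (rot (Real.cos θ) (Real.sin θ) p) * ENNReal.ofReal (gw p.1 * gw p.2)))
            ∂(volume.prod volume) := by
          rw [lintegral_prod]
          · refine lintegral_congr fun x => lintegral_congr fun y => ?_
            rw [lintegral_const_mul' _ _ ENNReal.ofReal_ne_top,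
              lintegral_mul_const' _ _ ENNReal.ofReal_ne_top, mul_assoc]
          · refine Measurable.aemeasurable ?_
            refine Measurable.lintegral_prod_right' (f := fun q : (E3 × E3) × ℝ =>
              ENNReal.ofReal (Real.pi / 2) * (f (rot (Real.cos q.2) (Real.sin q.2) q.1)
                * ENNReal.ofReal (gw q.1.1 * gw q.1.2))) ?_
            have := hfm.comp hrm
            exact measurable_const.mul (this.mul (by fun_prop))
      _ = ∫⁻ θ : ℝ in Ioc 0 (Real.pi / 2), ENNReal.ofReal (Real.pi / 2) *
            ∫⁻ p : E3 × E3, f p * ENNReal.ofReal (gw p.1 * gw p.2) ∂(volume.prod volume) := by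
          rw [lintegral_lintegral_swap]
          · refine setLIntegral_congr_fun measurableSet_Ioc fun θ hθ => ?_
            rw [lintegral_const_mul' _ _ ENNReal.ofReal_ne_top,
              lintegral_rot (Real.cos_sq_add_sin_sq θ)
                (Real.cos_nonneg_of_mem_Icc ⟨by linarith [hθ.1], hθ.2⟩) hfm]
          · have := hfm.comp hrm
            exact (measurable_const.mul (this.mul (by fun_prop))).aemeasurable
      _ = _ := by
          rw [hf, lintegral_fderiv_gw hφ, setLIntegral_const, Real.volume_Ioc, sub_zero,
            sq, ENNReal.ofReal_mul (mul_nonneg hpi hpi), ENNReal.ofReal_mul hpi]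
          ring
  have hgrad : 0 ≤ ∫ w, sphGradSq φ w ∂area :=
    integral_nonneg fun w => Finset.sum_nonneg fun i _ => by positivity
  have hM := gwMass_pos
  rw [ENNReal.ofReal_le_ofReal_iff (by positivity)] at key
  have hp4 := Real.pi_lt_four
  have hp0 := Real.pi_pos
  have h5 : (gwMass * K) * (2 * ∫ w, ‖φ w‖ ^ 2 ∂area)
      ≤ (gwMass * K) * ((Real.pi / 2) ^ 2 * ∫ w, sphGradSq φ w ∂area) := by
    linarith
  have h6 := le_of_mul_le_mul_left h5 (by positivity)
  have h7 : (Real.pi / 2) ^ 2 ≤ 4 := by nlinarith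
  nlinarith

section

/-! ### Differentiation under integrals over compact sets -/

lemma hasDerivAt_setIntegral_of_continuous {X : Type*} [TopologicalSpace X] [MeasurableSpace X]
    [OpensMeasurableSpace X] {μ : Measure X} [IsFiniteMeasureOnCompacts μ] {K : Set X}
    (hK : IsCompact K) (hKm : MeasurableSet K) {f f' : ℝ → X → ℝ}
    (hf : Continuous (Function.uncurry f)) (hf' : Continuous (Function.uncurry f'))
    (h : ∀ t x, HasDerivAt (fun τ => f τ x) (f' t x) t) (t : ℝ) :
    HasDerivAt (fun τ => ∫ x in K, f τ x ∂μ) (∫ x in K, f' t x ∂μ) t := by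
  have hc : ∀ {g : ℝ → X → ℝ}, Continuous (Function.uncurry g) → ∀ τ, Continuous (g τ) :=
    fun hg τ => hg.comp (Continuous.prodMk_right τ)
  obtain ⟨C, hC⟩ := ((isCompact_Icc (a := t - 1) (b := t + 1)).prod hK).exists_bound_of_continuousOn
    hf'.continuousOn
  refine (hasDerivAt_integral_of_dominated_loc_of_deriv_le (s := Icc (t - 1) (t + 1))
    (bound := fun _ => C) (Icc_mem_nhds (by linarith) (by linarith))
    (.of_forall fun τ => (hc hf τ).aestronglyMeasurable)
    ((hc hf t).continuousOn.integrableOn_compact' hK hKm)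
    (hc hf' t).aestronglyMeasurable ?_ ?_ ?_).2
  · filter_upwards [ae_restrict_mem hKm] with x hx τ hτ
    exact hC (τ, x) ⟨hτ, hx⟩
  · exact integrableOn_const hK.measure_lt_top.ne
  · exact .of_forall fun x τ _ => h τ x

/-! ### Pairings over the sphere -/

/-- The real part of the `L²` inner product over the sphere of two fields. -/
def ip (u v : ℝ → ℝ → S2 → ℂ) (t s : ℝ) : ℝ := ∫ w, inner ℝ (u t s w) (v t s w) ∂area

variable {u v : ℝ → ℝ → S2 → ℂ}

lemma SmoothField.continuous_slice (hu : SmoothField u) (t s : ℝ) : Continuous (u t s) :=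
  hu.continuous.comp (Continuous.prodMk_right (t, s))

lemma SmoothField.continuous_inner (hu : SmoothField u) (hv : SmoothField v) :
    Continuous fun p : (ℝ × ℝ) × S2 => inner ℝ (u p.1.1 p.1.2 p.2) (v p.1.1 p.1.2 p.2) :=
  hu.continuous.inner hv.continuous

lemma integrable_inner (hu : SmoothField u) (hv : SmoothField v) (t s : ℝ) :
    Integrable (fun w => inner ℝ (u t s w) (v t s w)) area :=
  integrable_area ((hu.continuous_slice t s).inner (hv.continuous_slice t s))

lemma continuous_ip (hu : SmoothField u) (hv : SmoothField v) :
    Continuous (Function.uncurry (ip u v)) := by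
  have h := continuous_parametric_integral_of_continuous (μ := area)
    (f := fun (q : ℝ × ℝ) (w : S2) => inner ℝ (u q.1 q.2 w) (v q.1 q.2 w))
    (hu.continuous_inner hv) (s := univ) isCompact_univ
  simp only [Measure.restrict_univ] at h
  exact h

lemma hasDerivAt_ip_fst (hu : SmoothField u) (hv : SmoothField v) (t s : ℝ) :
    HasDerivAt (fun τ => ip u v τ s) (ip (dt u) v t s + ip u (dt v) t s) t := by
  have cont : ∀ {u v : ℝ → ℝ → S2 → ℂ}, SmoothField u → SmoothField v → Continuous
      (fun p : ℝ × S2 => inner ℝ (u p.1 s p.2) (v p.1 s p.2)) := fun hu hv =>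
    (hu.continuous_inner hv).comp (f := fun p : ℝ × S2 => ((p.1, s), p.2)) (by fun_prop)
  have h := hasDerivAt_setIntegral_of_continuous (μ := area) (K := univ) isCompact_univ
    MeasurableSet.univ
    (f := fun τ w => inner ℝ (u τ s w) (v τ s w))
    (f' := fun τ w => inner ℝ (u τ s w) (dt v τ s w) + inner ℝ (dt u τ s w) (v τ s w))
    (cont hu hv) ((cont hu hv.dt).add (cont hu.dt hv))
    (fun τ w => (hu.hasDerivAt_fst τ s w).inner ℝ (hv.hasDerivAt_fst τ s w)) t
  simp only [Measure.restrict_univ] at h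
  rw [integral_add (integrable_inner hu hv.dt t s) (integrable_inner hu.dt hv t s), add_comm] at h
  exact h

lemma hasDerivAt_ip_snd (hu : SmoothField u) (hv : SmoothField v) (t s : ℝ) :
    HasDerivAt (fun τ => ip u v t τ) (ip (dr u) v t s + ip u (dr v) t s) s := by
  have cont : ∀ {u v : ℝ → ℝ → S2 → ℂ}, SmoothField u → SmoothField v → Continuous
      (fun p : ℝ × S2 => inner ℝ (u t p.1 p.2) (v t p.1 p.2)) := fun hu hv =>
    (hu.continuous_inner hv).comp (f := fun p : ℝ × S2 => ((t, p.1), p.2)) (by fun_prop)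
  have h := hasDerivAt_setIntegral_of_continuous (μ := area) (K := univ) isCompact_univ
    MeasurableSet.univ
    (f := fun τ w => inner ℝ (u t τ w) (v t τ w))
    (f' := fun τ w => inner ℝ (u t τ w) (dr v t τ w) + inner ℝ (dr u t τ w) (v t τ w))
    (cont hu hv) ((cont hu hv.dr).add (cont hu.dr hv))
    (fun τ w => (hu.hasDerivAt_snd t τ w).inner ℝ (hv.hasDerivAt_snd t τ w)) s
  simp only [Measure.restrict_univ] at h
  rw [integral_add (integrable_inner hu hv.dr t s) (integrable_inner hu.dr hv t s), add_comm] at h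
  exact h

lemma ip_comm (u v : ℝ → ℝ → S2 → ℂ) (t s : ℝ) : ip u v t s = ip v u t s := by
  simp only [ip, real_inner_comm]

lemma ip_self (u : ℝ → ℝ → S2 → ℂ) (t s : ℝ) : ip u u t s = ∫ w, ‖u t s w‖ ^ 2 ∂area := by
  simp only [ip, real_inner_self_eq_norm_sq]

lemma ip_self_nonneg (u : ℝ → ℝ → S2 → ℂ) (t s : ℝ) : 0 ≤ ip u u t s := by
  rw [ip_self]
  exact integral_nonneg fun w => by positivity

/-- The `L²` norm over the sphere of `u + c v`, which is nonnegative. -/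
lemma ip_quadratic_nonneg (hu : SmoothField u) (hv : SmoothField v) (t s c : ℝ) :
    0 ≤ ip u u t s + 2 * c * ip u v t s + c ^ 2 * ip v v t s := by
  have h : ∫ w, ‖u t s w + c • v t s w‖ ^ 2 ∂area
      = ip u u t s + 2 * c * ip u v t s + c ^ 2 * ip v v t s := by
    have e : ∀ w, ‖u t s w + c • v t s w‖ ^ 2 = inner ℝ (u t s w) (u t s w)
        + 2 * c * inner ℝ (u t s w) (v t s w) + c ^ 2 * inner ℝ (v t s w) (v t s w) := by
      intro w
      rw [norm_add_sq_real, real_inner_smul_right, norm_smul, mul_pow, real_inner_self_eq_norm_sq,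
        real_inner_self_eq_norm_sq, Real.norm_eq_abs, sq_abs]
      ring
    simp only [e]
    have i1 : Integrable (fun w => inner ℝ (u t s w) (u t s w)
        + 2 * c * inner ℝ (u t s w) (v t s w)) area :=
      (integrable_inner hu hu t s).add ((integrable_inner hu hv t s).const_mul _)
    rw [integral_add i1 ((integrable_inner hv hv t s).const_mul _),
      integral_add (integrable_inner hu hu t s) ((integrable_inner hu hv t s).const_mul _),
      integral_const_mul, integral_const_mul]
    rfl
  rw [← h]
  exact integral_nonneg fun w => by positivity

lemma SmoothS.continuous_gradInner {φ ψ : S2 → ℂ} (hφ : SmoothS φ) (hψ : SmoothS ψ) :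
    Continuous (gradInner φ ψ) :=
  continuous_finsetSum _ fun i _ => (hφ.continuous_pdx i).inner (hψ.continuous_pdx i)

lemma ip_lap (hu : SmoothField u) (hv : SmoothField v) (t s : ℝ) :
    ip u (lap v) t s = - ∫ w, gradInner (u t s) (v t s) w ∂area := by
  have h : ∫ w, (gradInner (u t s) (v t s) w + inner ℝ (u t s w) (lap v t s w)) ∂area = 0 :=
    integral_gradInner_add (hu.smoothS t s) (hv.smoothS t s)
  rw [integral_add (integrable_area ((hu.smoothS t s).continuous_gradInner (hv.smoothS t s)))
    (integrable_inner hu hv.lap t s)] at h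
  exact eq_neg_of_add_eq_zero_right h

lemma ip_lap_symm (hu : SmoothField u) (hv : SmoothField v) (t s : ℝ) :
    ip u (lap v) t s = ip (lap u) v t s := by
  rw [ip_lap hu hv, ip_comm, ip_lap hv hu]
  simp only [gradInner_comm]

lemma integral_sphGradSq (hu : SmoothField u) (t s : ℝ) :
    ∫ w, sphGradSq (u t s) w ∂area = - ip u (lap u) t s := by
  rw [ip_lap hu hu, neg_neg]
  simp only [sphGradSq_eq_gradInner]

lemma sphGradSq_nonneg (φ : S2 → ℂ) (w : S2) : 0 ≤ sphGradSq φ w :=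
  Finset.sum_nonneg fun i _ => by positivity

/-- The image of the Laplacian is orthogonal to the constants. -/
lemma NoZeroMode.lap (hu : SmoothField u) : NoZeroMode (lap u) := by
  intro t s
  have hint : Integrable (RNdS.lap u t s) area := integrable_area (hu.lap.continuous_slice t s)
  have key : ∀ c : ℂ, inner ℝ c (∫ w, RNdS.lap u t s w ∂area) = 0 := by
    intro c
    have hc0 : ∀ x : E3, x ≠ 0 → radialExt (fun _ => c) =ᶠ[nhds x] fun _ => c := by
      intro x hx
      filter_upwards [isOpen_ne.mem_nhds hx] with y hy
      rw [radialExt_eq_comp_toS2 _ hy]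
    have hc : SmoothS (fun _ : S2 => c) := fun x hx =>
      contDiffAt_const.congr_of_eventuallyEq (hc0 x hx)
    have h := integral_gradInner_add hc (hu.smoothS t s)
    have hz : ∀ w, gradInner (fun _ : S2 => c) (u t s) w = 0 := by
      intro w
      refine Finset.sum_eq_zero fun i _ => ?_
      rw [pdx, (hc0 _ (S2.coe_ne_zero w)).fderiv_eq]
      simp
    simp only [hz, zero_add] at h
    rw [← integral_inner hint]
    exact h
  exact inner_self_eq_zero.1 (key _)

lemma radialExt_add_smul (φ ψ : S2 → ℂ) (c : ℂ) :
    radialExt (fun w => φ w + c * ψ w) = radialExt φ + c • radialExt ψ := by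
  funext x
  by_cases hx : x = 0 <;> simp [radialExt, hx]

lemma sphLaplacian_add_mul {φ ψ : S2 → ℂ} (hφ : SmoothS φ) (hψ : SmoothS ψ) (c : ℂ) (w : S2) :
    sphLaplacian (fun w => φ w + c * ψ w) w = sphLaplacian φ w + c * sphLaplacian ψ w := by
  have h1 : ContDiffAt ℝ 2 (radialExt φ) (w : E3) :=
    (hφ _ (S2.coe_ne_zero w)).of_le (WithTop.coe_le_coe.2 le_top)
  have h2 : ContDiffAt ℝ 2 (radialExt ψ) (w : E3) :=
    (hψ _ (S2.coe_ne_zero w)).of_le (WithTop.coe_le_coe.2 le_top)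
  have e : c • radialExt ψ = (ContinuousLinearMap.mul ℝ ℂ c) ∘ radialExt ψ := by
    funext x
    simp
  unfold sphLaplacian
  rw [radialExt_add_smul, e, ContDiffAt.laplacian_add h1
    ((ContinuousLinearMap.mul ℝ ℂ c).contDiff.contDiffAt.comp _ h2),
    h2.laplacian_CLM_comp_left]
  simp

variable {M Q Λ : ℝ}

/-- The Laplacian of the sphere commutes with the equation. -/
lemma WaveLike.lap (hu : SmoothField u) (h : WaveLike M Q Λ u) : WaveLike M Q Λ (lap u) := by
  intro t s w
  rw [lap_dt_comm hu, lap_dt_comm hu.dt, lap_dr_comm hu, lap_dr_comm hu.dr]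
  have e : dt (dt u) = fun t s w => dr (dr u) t s w + (potential M Q Λ s : ℂ) * RNdS.lap u t s w := by
    funext t s w
    exact h t s w
  rw [e]
  exact sphLaplacian_add_mul (hu.dr.dr.smoothS t s) (hu.lap.smoothS t s) _ w

/-! ### The reduced quantities -/

/-- The sphere integrals of a solution, as functions of `t` and `s = r_*`: they satisfy a closed
system of balance laws. Here `a = ‖∂_t u‖²`, `b = ‖∂_s u‖²`, `n = ‖∇u‖²`, `z = ‖u‖²`,
`p = ⟪∂_t u, ∂_s u⟫`, `y₁ = ⟪∂_t u, u⟫` and `y₂ = ⟪∂_s u, u⟫`, in `L²` of the sphere; the fields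
with suffix `s` are derivatives with respect to `s`. -/
structure ReducedWave (V : ℝ → ℝ) where
  (a b n z p y₁ y₂ abs_s n_s p_s y₂s : ℝ → ℝ → ℝ)
  cont_a : Continuous (Function.uncurry a)
  cont_b : Continuous (Function.uncurry b)
  cont_n : Continuous (Function.uncurry n)
  cont_z : Continuous (Function.uncurry z)
  cont_p : Continuous (Function.uncurry p)
  cont_y₁ : Continuous (Function.uncurry y₁)
  cont_y₂ : Continuous (Function.uncurry y₂)
  cont_ab_s : Continuous (Function.uncurry abs_s)
  cont_n_s : Continuous (Function.uncurry n_s)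
  cont_p_s : Continuous (Function.uncurry p_s)
  cont_y₂s : Continuous (Function.uncurry y₂s)
  energy_law : ∀ t s, HasDerivAt (fun τ => a τ s + b τ s + V s * n τ s) (2 * p_s t s) t
  momentum_law : ∀ t s, HasDerivAt (fun τ => p τ s) (1 / 2 * abs_s t s - 1 / 2 * V s * n_s t s) t
  virial_law : ∀ t s, HasDerivAt (fun τ => y₁ τ s) (y₂s t s + a t s - b t s - V s * n t s) t
  deriv_ab : ∀ t s, HasDerivAt (fun σ => a t σ + b t σ) (abs_s t s) s
  deriv_n : ∀ t s, HasDerivAt (fun σ => n t σ) (n_s t s) s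
  deriv_p : ∀ t s, HasDerivAt (fun σ => p t σ) (p_s t s) s
  deriv_y₂ : ∀ t s, HasDerivAt (fun σ => y₂ t σ) (y₂s t s) s
  deriv_z : ∀ t s, HasDerivAt (fun σ => z t σ) (2 * y₂ t s) s
  a_nonneg : ∀ t s, 0 ≤ a t s
  b_nonneg : ∀ t s, 0 ≤ b t s
  z_nonneg : ∀ t s, 0 ≤ z t s
  quad_p : ∀ t s c, 0 ≤ a t s + 2 * c * p t s + c ^ 2 * b t s
  quad_y₁ : ∀ t s c, 0 ≤ a t s + 2 * c * y₁ t s + c ^ 2 * z t s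
  quad_y₂ : ∀ t s c, 0 ≤ b t s + 2 * c * y₂ t s + c ^ 2 * z t s
  poincare : ∀ t s, z t s ≤ 2 * n t s

lemma ip_neg_poincare (hu : SmoothField u) (h0 : NoZeroMode u) (t s : ℝ) :
    ip u u t s ≤ 2 * -ip u (lap u) t s := by
  rw [ip_self, ← integral_sphGradSq hu]
  exact integral_norm_sq_le (hu.smoothS t s) (h0 t s)

lemma ip_wave_right (hv : SmoothField v) (hu : SmoothField u) (h : WaveLike M Q Λ u) (t s : ℝ) :
    ip v (dt (dt u)) t s = ip v (dr (dr u)) t s + potential M Q Λ s * ip v (lap u) t s := by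
  unfold ip
  rw [← integral_const_mul, ← integral_add (integrable_inner hv hu.dr.dr t s)
    ((integrable_inner hv hu.lap t s).const_mul _)]
  refine integral_congr_ae (.of_forall fun w => ?_)
  have e : (potential M Q Λ s : ℂ) * lap u t s w = potential M Q Λ s • lap u t s w := by simp
  simp only [h t s w, e, inner_add_right, real_inner_smul_right]

/-- The reduced quantities of a smooth solution without zero mode. -/
def reducedWave (hu : SmoothField u) (h : WaveLike M Q Λ u) (h0 : NoZeroMode u) :
    ReducedWave (potential M Q Λ) where
  a := ip (dt u) (dt u)
  b := ip (dr u) (dr u)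
  n := fun t s => -ip u (lap u) t s
  z := ip u u
  p := ip (dt u) (dr u)
  y₁ := ip (dt u) u
  y₂ := ip (dr u) u
  abs_s := fun t s => 2 * ip (dt u) (dr (dt u)) t s + 2 * ip (dr u) (dr (dr u)) t s
  n_s := fun t s => -2 * ip (dr u) (lap u) t s
  p_s := fun t s => ip (dr (dt u)) (dr u) t s + ip (dt u) (dr (dr u)) t s
  y₂s := fun t s => ip (dr (dr u)) u t s + ip (dr u) (dr u) t s
  cont_a := continuous_ip hu.dt hu.dt
  cont_b := continuous_ip hu.dr hu.dr
  cont_n := (continuous_ip hu hu.lap).neg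
  cont_z := continuous_ip hu hu
  cont_p := continuous_ip hu.dt hu.dr
  cont_y₁ := continuous_ip hu.dt hu
  cont_y₂ := continuous_ip hu.dr hu
  cont_ab_s := ((continuous_ip hu.dt hu.dt.dr).const_mul 2).add
    ((continuous_ip hu.dr hu.dr.dr).const_mul 2)
  cont_n_s := (continuous_ip hu.dr hu.lap).const_mul (-2)
  cont_p_s := (continuous_ip hu.dt.dr hu.dr).add (continuous_ip hu.dt hu.dr.dr)
  cont_y₂s := (continuous_ip hu.dr.dr hu).add (continuous_ip hu.dr hu.dr)
  energy_law t s := by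
    have h1 := ((hasDerivAt_ip_fst hu.dt hu.dt t s).add (hasDerivAt_ip_fst hu.dr hu.dr t s)).add
      ((hasDerivAt_ip_fst hu hu.lap t s).neg.const_mul (potential M Q Λ s))
    refine h1.congr_deriv ?_
    rw [lap_dt_comm hu, ip_lap_symm hu hu.dt, ip_comm (lap u) (dt u),
      ip_comm (dt (dt u)) (dt u), ip_wave_right hu.dt hu h, dt_dr_comm hu,
      ip_comm (dr u) (dr (dt u))]
    ring
  momentum_law t s := by
    refine (hasDerivAt_ip_fst hu.dt hu.dr t s).congr_deriv ?_
    rw [ip_comm (dt (dt u)) (dr u), ip_wave_right hu.dr hu h, dt_dr_comm hu]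
    ring
  virial_law t s := by
    refine (hasDerivAt_ip_fst hu.dt hu t s).congr_deriv ?_
    rw [ip_comm (dt (dt u)) u, ip_wave_right hu hu h, ip_comm u (dr (dr u))]
    ring
  deriv_ab t s := by
    refine ((hasDerivAt_ip_snd hu.dt hu.dt t s).add
      (hasDerivAt_ip_snd hu.dr hu.dr t s)).congr_deriv ?_
    rw [ip_comm (dr (dt u)) (dt u), ip_comm (dr (dr u)) (dr u)]
    ring
  deriv_n t s := by
    refine (hasDerivAt_ip_snd hu hu.lap t s).neg.congr_deriv ?_
    rw [lap_dr_comm hu, ip_lap_symm hu hu.dr, ip_comm (lap u) (dr u)]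
    ring
  deriv_p t s := hasDerivAt_ip_snd hu.dt hu.dr t s
  deriv_y₂ t s := hasDerivAt_ip_snd hu.dr hu t s
  deriv_z t s := by
    refine (hasDerivAt_ip_snd hu hu t s).congr_deriv ?_
    rw [ip_comm u (dr u)]
    ring
  a_nonneg := ip_self_nonneg _
  b_nonneg := ip_self_nonneg _
  z_nonneg := ip_self_nonneg _
  quad_p := ip_quadratic_nonneg hu.dt hu.dr
  quad_y₁ := ip_quadratic_nonneg hu.dt hu
  quad_y₂ := ip_quadratic_nonneg hu.dr hu
  poincare := ip_neg_poincare hu h0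

/-- One angular gradient is interpolated between no derivative and four of them. -/
lemma ip_lap_interpolation (hu : SmoothField u) (t s : ℝ) {A : ℝ} (hA : 0 < A) :
    -ip u (lap u) t s ≤ A * ip u u t s + (A ^ 3)⁻¹ * ip (lap (lap u)) (lap (lap u)) t s := by
  have h1 := ip_quadratic_nonneg hu.lap hu t s A
  have h2 := ip_quadratic_nonneg hu.lap.lap hu t s (-A ^ 2)
  rw [ip_comm (lap u) u] at h1
  rw [← ip_lap_symm hu.lap hu] at h2
  have hz := ip_self_nonneg u t s
  have hN := ip_self_nonneg (lap (lap u)) t s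
  set z := ip u u t s
  set N := ip (lap (lap u)) (lap (lap u)) t s
  set L := ip (lap u) (lap u) t s
  set n := ip u (lap u) t s
  have h3 : L ≤ A ^ 2 * z + (A ^ 2)⁻¹ * N := by
    have : 0 ≤ (A ^ 2)⁻¹ * (N + 2 * -A ^ 2 * L + (-A ^ 2) ^ 2 * z) := by positivity
    have e : (A ^ 2)⁻¹ * (N + 2 * -A ^ 2 * L + (-A ^ 2) ^ 2 * z)
        = (A ^ 2)⁻¹ * N - 2 * L + A ^ 2 * z := by field_simp; ring
    have : 0 ≤ (A ^ 2)⁻¹ * N + A ^ 2 * z := by positivity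
    linarith
  have h4 : -n ≤ A⁻¹ * (L + A ^ 2 * z) / 2 := by
    have : 0 ≤ A⁻¹ * (L + 2 * A * n + A ^ 2 * z) := by positivity
    have e : A⁻¹ * (L + 2 * A * n + A ^ 2 * z) = A⁻¹ * (L + A ^ 2 * z) + 2 * n := by
      field_simp
      ring
    linarith
  have h5 : A⁻¹ * (L + A ^ 2 * z) ≤ A⁻¹ * (A ^ 2 * z + (A ^ 2)⁻¹ * N + A ^ 2 * z) := by gcongr
  have e : A⁻¹ * (A ^ 2 * z + (A ^ 2)⁻¹ * N + A ^ 2 * z) = 2 * (A * z) + (A ^ 3)⁻¹ * N := by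
    field_simp
    ring
  have : 0 ≤ (A ^ 3)⁻¹ * N := by positivity
  linarith

end

section

/-! ### The exterior region -/

/-- What the wave estimates use of the geometry. The function `g` is increasing and vanishes at the
photon sphere, `V = g'`, and `V' = - V g q` with a factor `q` pinched between positive constants:
`V` has a single, nondegenerate critical point. -/
structure TrappingPotential (V g q : ℝ → ℝ) (q₀ B : ℝ) : Prop where
  q₀_pos : 0 < q₀
  V_pos : ∀ s, 0 < V s
  V_le : ∀ s, V s ≤ B
  g_le : ∀ s, |g s| ≤ B
  le_q : ∀ s, q₀ ≤ q s
  q_le : ∀ s, q s ≤ 3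
  g_zero : g 0 = 0
  deriv_g : ∀ s, HasDerivAt g (V s) s
  deriv_V : ∀ s, HasDerivAt V (-(V s * g s * q s)) s
  cont_q : Continuous q

variable {M Q Λ : ℝ}

/-- The function whose level set at height `M` consists of the horizons. -/
def massFn (Q Λ r : ℝ) : ℝ := (r ^ 2 + Q ^ 2 - Λ * r ^ 4) / (2 * r)

lemma horizonFn_eq (M Q Λ : ℝ) {r : ℝ} (hr : 0 < r) :
    horizonFn M Q Λ r = 2 / r * (massFn Q Λ r - M) := by
  unfold horizonFn massFn
  field_simp
  ring

namespace Admissible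

lemma disc_mem (h : Admissible M Q Λ) :
    0 < 1 - 12 * Q ^ 2 * Λ ∧ 1 - 12 * Q ^ 2 * Λ < 1 := by
  have hQ : 0 < Q ^ 2 := by have := h.charge_ne_zero; positivity
  have h1 := h.cosm_lt
  have h2 := h.cosm_pos
  rw [lt_div_iff₀ (by positivity)] at h1
  constructor
  · linarith
  · have : 0 < 12 * Q ^ 2 * Λ := by positivity
    linarith

lemma m₁_sq (h : Admissible M Q Λ) :
    m₁ Q Λ ^ 2 = (1 - Real.sqrt (1 - 12 * Q ^ 2 * Λ)) / (6 * Λ) := by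
  have hd := h.disc_mem
  have h2 := h.cosm_pos
  have h3 : Real.sqrt (1 - 12 * Q ^ 2 * Λ) ≤ 1 := Real.sqrt_le_one.2 hd.2.le
  rw [m₁, mul_pow, div_pow, Real.sq_sqrt (by positivity), Real.sq_sqrt (by linarith)]
  ring

lemma m₂_sq (h : Admissible M Q Λ) :
    m₂ Q Λ ^ 2 = (1 + Real.sqrt (1 - 12 * Q ^ 2 * Λ)) / (6 * Λ) := by
  have h2 := h.cosm_pos
  have h3 := Real.sqrt_nonneg (1 - 12 * Q ^ 2 * Λ)
  rw [m₂, mul_pow, div_pow, Real.sq_sqrt (by positivity), Real.sq_sqrt (by linarith)]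
  ring

lemma m₁_pos (h : Admissible M Q Λ) : 0 < m₁ Q Λ := by
  have hd := h.disc_mem
  have h2 := h.cosm_pos
  have h3 : Real.sqrt (1 - 12 * Q ^ 2 * Λ) < 1 := by
    rw [Real.sqrt_lt' one_pos]
    linarith
  have : 0 < 1 - Real.sqrt (1 - 12 * Q ^ 2 * Λ) := by linarith
  unfold m₁
  positivity

lemma m₂_pos (h : Admissible M Q Λ) : 0 < m₂ Q Λ := by
  have h2 := h.cosm_pos
  have h3 := Real.sqrt_nonneg (1 - 12 * Q ^ 2 * Λ)
  unfold m₂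
  positivity

lemma m₁_lt_m₂ (h : Admissible M Q Λ) : m₁ Q Λ < m₂ Q Λ := by
  refine lt_of_pow_lt_pow_left₀ 2 h.m₂_pos.le ?_
  have hΛ := h.cosm_pos
  rw [h.m₁_sq, h.m₂_sq]
  have : 0 < Real.sqrt (1 - 12 * Q ^ 2 * Λ) := Real.sqrt_pos.2 h.disc_mem.1
  gcongr
  linarith

/-- The critical points of `massFn` are `m₁` and `m₂`. -/
lemma factor (h : Admissible M Q Λ) (r : ℝ) :
    3 * Λ * r ^ 4 - r ^ 2 + Q ^ 2 = 3 * Λ * (r ^ 2 - m₁ Q Λ ^ 2) * (r ^ 2 - m₂ Q Λ ^ 2) := by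
  have hΛ := h.cosm_pos
  have hs := Real.sq_sqrt h.disc_mem.1.le
  rw [h.m₁_sq, h.m₂_sq]
  set S := Real.sqrt (1 - 12 * Q ^ 2 * Λ)
  field_simp
  linear_combination 3 * hs

lemma massFn_m₁ (h : Admissible M Q Λ) : massFn Q Λ (m₁ Q Λ) < M := by
  have h1 := h.factor (m₁ Q Λ)
  have h2 := h.mass_gt
  have hm := h.m₁_pos
  rw [sub_self, mul_zero, zero_mul] at h1
  have : massFn Q Λ (m₁ Q Λ) = m₁ Q Λ - 2 * Λ * m₁ Q Λ ^ 3 := by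
    unfold massFn
    field_simp
    linear_combination h1
  rwa [this]

lemma lt_massFn_m₂ (h : Admissible M Q Λ) : M < massFn Q Λ (m₂ Q Λ) := by
  have h1 := h.factor (m₂ Q Λ)
  have h2 := h.mass_lt
  have hm := h.m₂_pos
  rw [sub_self, mul_zero] at h1
  have : massFn Q Λ (m₂ Q Λ) = m₂ Q Λ - 2 * Λ * m₂ Q Λ ^ 3 := by
    unfold massFn
    field_simp
    linear_combination h1
  rwa [this]

end Admissible

lemma hasDerivAt_massFn (Q Λ : ℝ) {r : ℝ} (hr : 0 < r) :
    HasDerivAt (massFn Q Λ) (-(3 * Λ * r ^ 4 - r ^ 2 + Q ^ 2) / (2 * r ^ 2)) r := by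
  have h1 : HasDerivAt (fun r : ℝ => r ^ 2 + Q ^ 2 - Λ * r ^ 4) (2 * r - Λ * (4 * r ^ 3)) r := by
    refine (((hasDerivAt_pow 2 r).add_const (Q ^ 2)).sub
      ((hasDerivAt_pow 4 r).const_mul Λ)).congr_deriv ?_
    simp
  have h2 : HasDerivAt (fun r : ℝ => 2 * r) 2 r := by simpa using (hasDerivAt_id r).const_mul 2
  refine (h1.div h2 (by positivity)).congr_deriv ?_
  field_simp
  ring

lemma continuousOn_massFn (Q Λ : ℝ) : ContinuousOn (massFn Q Λ) (Ioi 0) := fun _ hr =>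
  (hasDerivAt_massFn Q Λ (mem_Ioi.1 hr)).continuousAt.continuousWithinAt

namespace Admissible

lemma strictMonoOn_massFn (h : Admissible M Q Λ) :
    StrictMonoOn (massFn Q Λ) (Icc (m₁ Q Λ) (m₂ Q Λ)) := by
  have h1 := h.m₁_pos
  refine strictMonoOn_of_deriv_pos (convex_Icc _ _)
    ((continuousOn_massFn Q Λ).mono fun r hr => h1.trans_le hr.1) fun r hr => ?_
  rw [interior_Icc] at hr
  have hr0 : 0 < r := h1.trans hr.1
  have hΛ := h.cosm_pos
  rw [(hasDerivAt_massFn Q Λ hr0).deriv, h.factor]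
  have e1 : 0 < r ^ 2 - m₁ Q Λ ^ 2 := by nlinarith [hr.1]
  have e2 : 0 < m₂ Q Λ ^ 2 - r ^ 2 := by nlinarith [hr.2, h.m₂_pos]
  have : 0 < 3 * Λ * (r ^ 2 - m₁ Q Λ ^ 2) * (m₂ Q Λ ^ 2 - r ^ 2) := by positivity
  apply div_pos _ (by positivity)
  linarith

lemma strictAntiOn_massFn (h : Admissible M Q Λ) :
    StrictAntiOn (massFn Q Λ) (Ici (m₂ Q Λ)) := by
  have h1 := h.m₂_pos
  refine strictAntiOn_of_deriv_neg (convex_Ici _)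
    ((continuousOn_massFn Q Λ).mono fun r hr => h1.trans_le hr) fun r hr => ?_
  rw [interior_Ici] at hr
  have hr0 : 0 < r := h1.trans hr
  have hΛ := h.cosm_pos
  rw [(hasDerivAt_massFn Q Λ hr0).deriv, h.factor]
  have e2 : 0 < r ^ 2 - m₂ Q Λ ^ 2 := by nlinarith [mem_Ioi.1 hr]
  have e1 : 0 < r ^ 2 - m₁ Q Λ ^ 2 := by nlinarith [h.m₁_lt_m₂, h.m₁_pos]
  have : 0 < 3 * Λ * (r ^ 2 - m₁ Q Λ ^ 2) * (r ^ 2 - m₂ Q Λ ^ 2) := by positivity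
  apply div_neg_of_neg_of_pos _ (by positivity)
  linarith

end Admissible

/-- The horizons `r₂ < r₃` with the photon sphere `P` between them. The second critical point `P₁`
of the potential lies below `r₂`. -/
structure Exterior (M Q Λ r₂ P r₃ P₁ : ℝ) : Prop where
  cosm_pos : 0 < Λ
  P₁_pos : 0 < P₁
  P₁_lt : P₁ < r₂
  r₂_lt : r₂ < P
  lt_r₃ : P < r₃
  sum_eq : P + P₁ = 3 * M
  prod_eq : P * P₁ = 2 * Q ^ 2
  zero_r₂ : horizonFn M Q Λ r₂ = 0
  zero_r₃ : horizonFn M Q Λ r₃ = 0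
  pos : ∀ r ∈ Ioo r₂ r₃, 0 < horizonFn M Q Λ r
  ne_zero : ∀ r, r₃ < r → horizonFn M Q Λ r ≠ 0
  photon : photonRadius M Q = P

lemma horizonFn_pos_iff (M Q Λ : ℝ) {r : ℝ} (hr : 0 < r) :
    0 < horizonFn M Q Λ r ↔ M < massFn Q Λ r := by
  rw [horizonFn_eq M Q Λ hr, mul_pos_iff_of_pos_left (by positivity), sub_pos]

lemma horizonFn_eq_zero_iff (M Q Λ : ℝ) {r : ℝ} (hr : 0 < r) :
    horizonFn M Q Λ r = 0 ↔ massFn Q Λ r = M := by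
  have : (2 : ℝ) / r ≠ 0 := by positivity
  rw [horizonFn_eq M Q Λ hr, mul_eq_zero_iff_left this, sub_eq_zero]

/-- The horizons exist by the intermediate value theorem for `massFn`, which is increasing between
`m₁` and `m₂` and decreasing beyond `m₂`. The critical points of `f / r ^ 2` are the roots of
`r ^ 2 - 3 * M * r + 2 * Q ^ 2`; the signs of this polynomial at the two horizons show that only the
larger root lies in the exterior region. -/
lemma Admissible.exists_exterior (h : Admissible M Q Λ) :
    ∃ r₂ P r₃ P₁, Exterior M Q Λ r₂ P r₃ P₁ := by
  have hΛ := h.cosm_pos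
  have hm1 := h.m₁_pos
  have hm2 := h.m₂_pos
  have hm12 := h.m₁_lt_m₂
  have hQ : 0 < Q ^ 2 := by have := h.charge_ne_zero; positivity
  -- the horizon of the black hole lies between `m₁` and `m₂`
  obtain ⟨r₂, hr₂, e₂⟩ : ∃ r ∈ Ioo (m₁ Q Λ) (m₂ Q Λ), massFn Q Λ r = M :=
    intermediate_value_Ioo hm12.le
      ((continuousOn_massFn Q Λ).mono fun r hr => hm1.trans_le hr.1)
      ⟨h.massFn_m₁, h.lt_massFn_m₂⟩
  -- a large radius, beyond the cosmological horizon
  obtain ⟨b, hb, hbM⟩ : ∃ b, m₂ Q Λ < b ∧ massFn Q Λ b < M := by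
    have hlim : Filter.Tendsto (fun r : ℝ => massFn Q Λ r) Filter.atTop Filter.atBot := by
      have t0 : Filter.Tendsto (fun r : ℝ => Λ * r ^ 2 - (1 + Q ^ 2)) Filter.atTop Filter.atTop :=
        Filter.tendsto_atTop_add_const_right _ _
          ((Filter.tendsto_pow_atTop two_ne_zero).const_mul_atTop hΛ)
      have t1 : Filter.Tendsto (fun r : ℝ => (r / 2) * (Λ * r ^ 2 - (1 + Q ^ 2)))
          Filter.atTop Filter.atTop :=
        (Filter.tendsto_id.atTop_div_const (by norm_num)).atTop_mul_atTop₀ t0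
      refine Filter.tendsto_atBot_mono' _ ?_ (Filter.tendsto_neg_atTop_atBot.comp t1)
      filter_upwards [Filter.eventually_ge_atTop (1 : ℝ)] with r hr
      have hr0 : 0 < r := by linarith
      simp only [massFn, Function.comp]
      rw [div_le_iff₀ (by positivity)]
      nlinarith [mul_nonneg hQ.le (by nlinarith : (0 : ℝ) ≤ r ^ 2 - 1)]
    obtain ⟨b, h1, h2⟩ := ((Filter.eventually_gt_atTop (m₂ Q Λ)).and
      (hlim.eventually (Filter.eventually_lt_atBot M))).exists
    exact ⟨b, h1, h2⟩
  obtain ⟨r₃, hr₃, e₃⟩ : ∃ r ∈ Ioo (m₂ Q Λ) b, massFn Q Λ r = M :=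
    intermediate_value_Ioo' hb.le
      ((continuousOn_massFn Q Λ).mono fun r hr => hm2.trans_le hr.1)
      ⟨hbM, h.lt_massFn_m₂⟩
  have hr₂0 : 0 < r₂ := hm1.trans hr₂.1
  have hr₃0 : 0 < r₃ := hm2.trans hr₃.1
  have hr₂₃ : r₂ < r₃ := hr₂.2.trans hr₃.1
  -- the quadratic polynomial with roots at the critical points of the potential
  have hN : ∀ r, 0 < r → massFn Q Λ r = M → r ^ 2 - 3 * M * r + 2 * Q ^ 2
      = 3 / 2 * Λ * (r ^ 2 - m₁ Q Λ ^ 2) * (r ^ 2 - m₂ Q Λ ^ 2) := by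
    intro r hr e
    have h1 := h.factor r
    unfold massFn at e
    rw [div_eq_iff (by positivity)] at e
    linear_combination (3 / 2) * e + (1 / 2) * h1
  have hN2 : r₂ ^ 2 - 3 * M * r₂ + 2 * Q ^ 2 < 0 := by
    rw [hN r₂ hr₂0 e₂]
    have e1 : 0 < r₂ ^ 2 - m₁ Q Λ ^ 2 := by nlinarith [hr₂.1]
    have e2 : 0 < m₂ Q Λ ^ 2 - r₂ ^ 2 := by nlinarith [hr₂.2]
    have : 0 < 3 / 2 * Λ * (r₂ ^ 2 - m₁ Q Λ ^ 2) * (m₂ Q Λ ^ 2 - r₂ ^ 2) := by positivity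
    linarith
  have hN3 : 0 < r₃ ^ 2 - 3 * M * r₃ + 2 * Q ^ 2 := by
    rw [hN r₃ hr₃0 e₃]
    have e1 : 0 < r₃ ^ 2 - m₁ Q Λ ^ 2 := by nlinarith [hr₃.1]
    have e2 : 0 < r₃ ^ 2 - m₂ Q Λ ^ 2 := by nlinarith [hr₃.1]
    positivity
  have hdisc : 0 < 9 * M ^ 2 - 8 * Q ^ 2 := by nlinarith [sq_nonneg (2 * r₂ - 3 * M)]
  set D := Real.sqrt (9 * M ^ 2 - 8 * Q ^ 2) with hD
  have hD0 : 0 < D := Real.sqrt_pos.2 hdisc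
  have hD2 : D ^ 2 = 9 * M ^ 2 - 8 * Q ^ 2 := Real.sq_sqrt hdisc.le
  have hfac : ∀ r : ℝ, r ^ 2 - 3 * M * r + 2 * Q ^ 2
      = (r - (3 * M - D) / 2) * (r - (3 * M + D) / 2) := by
    intro r
    linear_combination (1 / 4) * hD2
  rw [hfac] at hN2 hN3
  have hM : 0 < M := by nlinarith
  have a1 : (3 * M - D) / 2 < r₂ := by
    by_contra hcon
    nlinarith
  have a2 : r₂ < (3 * M + D) / 2 := by
    by_contra hcon
    nlinarith
  have a3 : (3 * M + D) / 2 < r₃ := by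
    by_contra hcon
    nlinarith
  refine ⟨r₂, (3 * M + D) / 2, r₃, (3 * M - D) / 2, ?_⟩
  refine ⟨hΛ, ?_, a1, a2, a3, by ring, by linear_combination -(1 / 4) * hD2,
    (horizonFn_eq_zero_iff M Q Λ hr₂0).2 e₂, (horizonFn_eq_zero_iff M Q Λ hr₃0).2 e₃, ?_, ?_, ?_⟩
  · have : D < 3 * M := by nlinarith
    linarith
  · intro r hr
    have hr0 : 0 < r := hr₂0.trans hr.1
    rw [horizonFn_pos_iff M Q Λ hr0]
    rcases le_total r (m₂ Q Λ) with h2 | h2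
    · rw [← e₂]
      exact h.strictMonoOn_massFn ⟨hr₂.1.le, hr₂.2.le⟩ ⟨(hr₂.1.trans hr.1).le, h2⟩ hr.1
    · rw [← e₃]
      exact h.strictAntiOn_massFn h2 hr₃.1.le hr.2
  · intro r hr h0
    rw [horizonFn_eq_zero_iff M Q Λ (hr₃0.trans hr)] at h0
    have := h.strictAntiOn_massFn (mem_Ici.2 hr₃.1.le) (mem_Ici.2 (hr₃.1.trans hr).le) hr
    linarith
  · rw [photonRadius]

end

/-! ### The Regge-Wheeler coordinate and the potential -/

lemma hasDerivAt_horizonFn (M Q Λ : ℝ) {r : ℝ} (hr : r ≠ 0) :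
    HasDerivAt (horizonFn M Q Λ)
      (2 * M / r ^ 2 - 2 * Q ^ 2 / r ^ 3 - 2 * Λ * r) r := by
  have h1 : HasDerivAt (fun r : ℝ => 2 * M / r) (2 * M * (-(r ^ 2)⁻¹)) r :=
    (hasDerivAt_inv hr).const_mul (2 * M)
  have h2 : HasDerivAt (fun r : ℝ => Q ^ 2 / r ^ 2) _ r :=
    (hasDerivAt_const r (Q ^ 2)).div (hasDerivAt_pow 2 r) (pow_ne_zero 2 hr)
  have h3 : HasDerivAt (fun r : ℝ => Λ * r ^ 2) _ r := (hasDerivAt_pow 2 r).const_mul Λ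
  have h4 : HasDerivAt (horizonFn M Q Λ) _ r := ((h1.const_sub 1).add h2).sub h3
  refine h4.congr_deriv ?_
  simp
  field_simp
  ring

namespace Exterior

variable {M Q Λ r₂ P r₃ P₁ : ℝ}

lemma r₂_pos (h : Exterior M Q Λ r₂ P r₃ P₁) : 0 < r₂ := h.P₁_pos.trans h.P₁_lt

lemma P_mem (h : Exterior M Q Λ r₂ P r₃ P₁) : P ∈ Ioo r₂ r₃ := ⟨h.r₂_lt, h.lt_r₃⟩

lemma P_pos (h : Exterior M Q Λ r₂ P r₃ P₁) : 0 < P := h.r₂_pos.trans h.r₂_lt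

lemma pos_of_mem (h : Exterior M Q Λ r₂ P r₃ P₁) {r : ℝ} (hr : r ∈ Ioo r₂ r₃) : 0 < r :=
  h.r₂_pos.trans hr.1

lemma cosmologicalHorizon_eq (h : Exterior M Q Λ r₂ P r₃ P₁) :
    cosmologicalHorizon M Q Λ = r₃ := by
  refine IsGreatest.csSup_eq ⟨⟨h.P_pos.trans h.lt_r₃, h.zero_r₃⟩, fun r hr => ?_⟩
  by_contra hlt
  exact h.ne_zero r (not_le.1 hlt) hr.2

lemma outerHorizon_eq (h : Exterior M Q Λ r₂ P r₃ P₁) : outerHorizon M Q Λ = r₂ := by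
  unfold outerHorizon
  rw [h.cosmologicalHorizon_eq]
  refine IsGreatest.csSup_eq ⟨⟨h.r₂_pos, h.r₂_lt.trans h.lt_r₃, h.zero_r₂⟩, fun r hr => ?_⟩
  by_contra hlt
  exact (h.pos r ⟨not_le.1 hlt, hr.2.1⟩).ne' hr.2.2

/-- The horizon function vanishes at least linearly at the horizons. -/
lemma exists_lipschitz (h : Exterior M Q Λ r₂ P r₃ P₁) :
    ∃ K, 0 < K ∧ ∀ r ∈ Ioo r₂ r₃,
      horizonFn M Q Λ r ≤ K * (r - r₂) ∧ horizonFn M Q Λ r ≤ K * (r₃ - r) := by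
  have hc : ContinuousOn (fun r : ℝ => 2 * M / r ^ 2 - 2 * Q ^ 2 / r ^ 3 - 2 * Λ * r)
      (Icc r₂ r₃) := by
    have h0 : ∀ r ∈ Icc r₂ r₃, r ≠ 0 := fun r hr => (h.r₂_pos.trans_le hr.1).ne'
    refine ContinuousOn.sub (ContinuousOn.sub (continuousOn_const.div (by fun_prop) ?_)
      (continuousOn_const.div (by fun_prop) ?_)) (by fun_prop)
    · exact fun r hr => pow_ne_zero 2 (h0 r hr)
    · exact fun r hr => pow_ne_zero 3 (h0 r hr)
  obtain ⟨K, hK⟩ := isCompact_Icc.exists_bound_of_continuousOn hc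
  have hlt : r₂ < r₃ := h.r₂_lt.trans h.lt_r₃
  have hlip : ∀ x ∈ Icc r₂ r₃, ∀ y ∈ Icc r₂ r₃,
      ‖horizonFn M Q Λ y - horizonFn M Q Λ x‖ ≤ K * ‖y - x‖ := fun x hx y hy =>
    (convex_Icc r₂ r₃).norm_image_sub_le_of_norm_hasDerivWithin_le
      (fun r hr => (hasDerivAt_horizonFn M Q Λ (h.r₂_pos.trans_le hr.1).ne').hasDerivWithinAt)
      hK hx hy
  refine ⟨max K 1, by positivity, fun r hr => ?_⟩
  have hr' : r ∈ Icc r₂ r₃ := ⟨hr.1.le, hr.2.le⟩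
  have h2 := hlip r₂ (left_mem_Icc.2 hlt.le) r hr'
  have h3 := hlip r₃ (right_mem_Icc.2 hlt.le) r hr'
  rw [h.zero_r₂, sub_zero, Real.norm_eq_abs, Real.norm_eq_abs, abs_of_pos (sub_pos.2 hr.1)] at h2
  rw [h.zero_r₃, sub_zero, Real.norm_eq_abs, Real.norm_eq_abs, abs_of_neg (sub_neg.2 hr.2)] at h3
  have hK1 := le_max_left K 1
  constructor
  · calc _ ≤ _ := le_abs_self _
      _ ≤ _ := h2
      _ ≤ _ := by gcongr; linarith [hr.1]
  · calc _ ≤ _ := le_abs_self _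
      _ ≤ _ := h3
      _ = K * (r₃ - r) := by ring
      _ ≤ _ := by gcongr; linarith [hr.2]

lemma hasDerivAt_reggeWheeler (h : Exterior M Q Λ r₂ P r₃ P₁) {r : ℝ} (hr : r ∈ Ioo r₂ r₃) :
    HasDerivAt (reggeWheeler M Q Λ) (1 / horizonFn M Q Λ r) r := by
  have hc : ∀ x ∈ Ioo r₂ r₃, ContinuousAt (fun x => 1 / horizonFn M Q Λ x) x := fun x hx =>
    continuousAt_const.div
      (hasDerivAt_horizonFn M Q Λ (h.pos_of_mem hx).ne').continuousAt (h.pos x hx).ne'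
  have hsub : uIcc P r ⊆ Ioo r₂ r₃ := ordConnected_Ioo.uIcc_subset h.P_mem hr
  unfold reggeWheeler
  rw [h.photon]
  refine intervalIntegral.integral_hasDerivAt_right ?_ ?_ (hc r hr)
  · exact ContinuousOn.intervalIntegrable fun x hx => (hc x (hsub hx)).continuousWithinAt
  · exact ContinuousAt.stronglyMeasurableAtFilter isOpen_Ioo hc r hr

lemma reggeWheeler_photon (h : Exterior M Q Λ r₂ P r₃ P₁) : reggeWheeler M Q Λ P = 0 := by
  unfold reggeWheeler
  rw [h.photon, intervalIntegral.integral_same]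

lemma strictMonoOn_reggeWheeler (h : Exterior M Q Λ r₂ P r₃ P₁) :
    StrictMonoOn (reggeWheeler M Q Λ) (Ioo r₂ r₃) := by
  refine strictMonoOn_of_deriv_pos (convex_Ioo _ _)
    (fun r hr => (h.hasDerivAt_reggeWheeler hr).continuousAt.continuousWithinAt) fun r hr => ?_
  rw [interior_Ioo] at hr
  rw [(h.hasDerivAt_reggeWheeler hr).deriv]
  have := h.pos r hr
  positivity

/-- The Regge-Wheeler coordinate is onto: it grows at least logarithmically at the horizons. -/
lemma surjOn_reggeWheeler (h : Exterior M Q Λ r₂ P r₃ P₁) (s : ℝ) :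
    ∃ r ∈ Ioo r₂ r₃, reggeWheeler M Q Λ r = s := by
  obtain ⟨K, hK, hKle⟩ := h.exists_lipschitz
  have hlog2 : MonotoneOn (fun r => reggeWheeler M Q Λ r - 1 / K * Real.log (r - r₂))
      (Ioo r₂ r₃) := by
    have hd : ∀ r ∈ Ioo r₂ r₃, HasDerivAt (fun r => reggeWheeler M Q Λ r
        - 1 / K * Real.log (r - r₂)) (1 / horizonFn M Q Λ r - 1 / K * (1 / (r - r₂))) r :=
      fun r hr => (h.hasDerivAt_reggeWheeler hr).sub
        ((((hasDerivAt_id r).sub_const r₂).log (sub_pos.2 hr.1).ne').const_mul (1 / K))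
    refine monotoneOn_of_deriv_nonneg (convex_Ioo _ _)
      (fun r hr => (hd r hr).continuousAt.continuousWithinAt)
      (fun r hr => (hd r (interior_subset hr)).differentiableAt.differentiableWithinAt)
      fun r hr => ?_
    rw [interior_Ioo] at hr
    rw [(hd r hr).deriv, sub_nonneg, one_div_mul_one_div]
    have h1 := sub_pos.2 hr.1
    exact one_div_le_one_div_of_le (h.pos r hr) (hKle r hr).1
  have hlog3 : MonotoneOn (fun r => reggeWheeler M Q Λ r + 1 / K * Real.log (r₃ - r))
      (Ioo r₂ r₃) := by
    have hd : ∀ r ∈ Ioo r₂ r₃, HasDerivAt (fun r => reggeWheeler M Q Λ r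
        + 1 / K * Real.log (r₃ - r)) (1 / horizonFn M Q Λ r + 1 / K * (-1 / (r₃ - r))) r :=
      fun r hr => (h.hasDerivAt_reggeWheeler hr).add
        ((((hasDerivAt_id r).const_sub r₃).log (sub_pos.2 hr.2).ne').const_mul (1 / K))
    refine monotoneOn_of_deriv_nonneg (convex_Ioo _ _)
      (fun r hr => (hd r hr).continuousAt.continuousWithinAt)
      (fun r hr => (hd r (interior_subset hr)).differentiableAt.differentiableWithinAt)
      fun r hr => ?_
    rw [interior_Ioo] at hr
    have e : 1 / K * (-1 / (r₃ - r)) = -(1 / (K * (r₃ - r))) := by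
      rw [← one_div_mul_one_div]
      ring
    rw [(hd r hr).deriv, e, ← sub_eq_add_neg, sub_nonneg]
    exact one_div_le_one_div_of_le (h.pos r hr) (hKle r hr).2
  -- radii at which the logarithmic bounds exceed the prescribed value
  have hu : ∃ x ∈ Ioo r₂ r₃, s ≤ reggeWheeler M Q Λ x := by
    have hd0 : 0 < r₃ - P := sub_pos.2 h.lt_r₃
    have hE : Real.exp (-(K * |s|)) ≤ 1 := Real.exp_le_one_iff.2 (by
      have := abs_nonneg s
      nlinarith)
    have hE0 := Real.exp_pos (-(K * |s|))
    have hx : P ≤ r₃ - (r₃ - P) * Real.exp (-(K * |s|)) := by nlinarith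
    have hxm : r₃ - (r₃ - P) * Real.exp (-(K * |s|)) ∈ Ioo r₂ r₃ :=
      ⟨h.r₂_lt.trans_le hx, by nlinarith⟩
    refine ⟨_, hxm, ?_⟩
    have := hlog3 h.P_mem hxm hx
    simp only [h.reggeWheeler_photon, sub_sub_cancel, Real.log_mul hd0.ne' hE0.ne',
      Real.log_exp] at this
    have e : 1 / K * (Real.log (r₃ - P) + -(K * |s|)) = 1 / K * Real.log (r₃ - P) - |s| := by
      field_simp
      ring
    rw [e] at this
    linarith [le_abs_self s]
  have hl : ∃ x ∈ Ioo r₂ r₃, reggeWheeler M Q Λ x ≤ s := by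
    have hd0 : 0 < P - r₂ := sub_pos.2 h.r₂_lt
    have hE : Real.exp (-(K * |s|)) ≤ 1 := Real.exp_le_one_iff.2 (by
      have := abs_nonneg s
      nlinarith)
    have hE0 := Real.exp_pos (-(K * |s|))
    have hx : r₂ + (P - r₂) * Real.exp (-(K * |s|)) ≤ P := by nlinarith
    have hxm : r₂ + (P - r₂) * Real.exp (-(K * |s|)) ∈ Ioo r₂ r₃ :=
      ⟨by nlinarith, hx.trans_lt h.lt_r₃⟩
    refine ⟨_, hxm, ?_⟩
    have := hlog2 hxm h.P_mem hx
    simp only [h.reggeWheeler_photon, add_sub_cancel_left, Real.log_mul hd0.ne' hE0.ne',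
      Real.log_exp] at this
    have e : 1 / K * (Real.log (P - r₂) + -(K * |s|)) = 1 / K * Real.log (P - r₂) - |s| := by
      field_simp
      ring
    rw [e] at this
    linarith [neg_abs_le s]
  obtain ⟨x, hx, hxs⟩ := hl
  obtain ⟨y, hy, hys⟩ := hu
  have hsub : uIcc x y ⊆ Ioo r₂ r₃ := ordConnected_Ioo.uIcc_subset hx hy
  have hcont : ContinuousOn (reggeWheeler M Q Λ) (uIcc x y) := fun r hr =>
    (h.hasDerivAt_reggeWheeler (hsub hr)).continuousAt.continuousWithinAt
  obtain ⟨r, hr, hrs⟩ := intermediate_value_uIcc hcont (mem_uIcc_of_le hxs hys)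
  exact ⟨r, hsub hr, hrs⟩

lemma radius_mem (h : Exterior M Q Λ r₂ P r₃ P₁) (s : ℝ) : radius M Q Λ s ∈ Ioo r₂ r₃ := by
  unfold radius
  rw [h.cosmologicalHorizon_eq, h.outerHorizon_eq]
  exact Function.invFunOn_mem (h.surjOn_reggeWheeler s)

lemma reggeWheeler_radius (h : Exterior M Q Λ r₂ P r₃ P₁) (s : ℝ) :
    reggeWheeler M Q Λ (radius M Q Λ s) = s := by
  unfold radius
  rw [h.cosmologicalHorizon_eq, h.outerHorizon_eq]
  exact Function.invFunOn_eq (h.surjOn_reggeWheeler s)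

lemma radius_reggeWheeler (h : Exterior M Q Λ r₂ P r₃ P₁) {r : ℝ} (hr : r ∈ Ioo r₂ r₃) :
    radius M Q Λ (reggeWheeler M Q Λ r) = r :=
  h.strictMonoOn_reggeWheeler.injOn (h.radius_mem _) hr (h.reggeWheeler_radius _)

lemma strictMono_radius (h : Exterior M Q Λ r₂ P r₃ P₁) : StrictMono (radius M Q Λ) := by
  intro s t hst
  refine (h.strictMonoOn_reggeWheeler.lt_iff_lt (h.radius_mem s) (h.radius_mem t)).1 ?_
  rwa [h.reggeWheeler_radius, h.reggeWheeler_radius]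

lemma continuousAt_radius (h : Exterior M Q Λ r₂ P r₃ P₁) (s : ℝ) :
    ContinuousAt (radius M Q Λ) s := by
  refine (h.strictMono_radius.strictMonoOn univ).continuousAt_of_image_mem_nhds Filter.univ_mem ?_
  refine Filter.mem_of_superset (isOpen_Ioo.mem_nhds (h.radius_mem s)) fun r hr => ?_
  exact ⟨_, mem_univ _, h.radius_reggeWheeler hr⟩

lemma hasDerivAt_radius (h : Exterior M Q Λ r₂ P r₃ P₁) (s : ℝ) :
    HasDerivAt (radius M Q Λ) (horizonFn M Q Λ (radius M Q Λ s)) s := by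
  have hpos := h.pos _ (h.radius_mem s)
  have := HasDerivAt.of_local_left_inverse (h.continuousAt_radius s)
    (h.hasDerivAt_reggeWheeler (h.radius_mem s)) (by positivity)
    (.of_forall fun t => h.reggeWheeler_radius t)
  simpa using this

/-- The factor `q` is at most `3`: this only uses that `f` is positive. -/
lemma factor_le (h : Exterior M Q Λ r₂ P r₃ P₁) {r : ℝ} (hr : r ∈ Ioo r₂ r₃) :
    2 * (P / r) * (1 - P₁ / r) ≤ 3 := by
  have hr0 := h.pos_of_mem hr
  have hf := h.pos r hr
  have hb0 : 0 < P₁ / r := div_pos h.P₁_pos hr0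
  have hb1 : P₁ / r < 1 := (div_lt_one hr0).2 (h.P₁_lt.trans hr.1)
  have e : horizonFn M Q Λ r
      = 1 - 2 / 3 * (P / r + P₁ / r) + 1 / 2 * (P / r) * (P₁ / r) - Λ * r ^ 2 := by
    have e1 : 2 * M / r = 2 / 3 * (P / r + P₁ / r) := by
      rw [← add_div, h.sum_eq]
      ring
    have e2 : Q ^ 2 / r ^ 2 = 1 / 2 * (P / r) * (P₁ / r) := by
      rw [mul_assoc, div_mul_div_comm, h.prod_eq]
      ring
    unfold horizonFn
    rw [e1, e2]
  have hΛ : 0 < Λ * r ^ 2 := mul_pos h.cosm_pos (by positivity)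
  rw [e] at hf
  set a := P / r
  set b := P₁ / r
  have h1 : a * (4 - 3 * b) < 6 - 4 * b := by nlinarith
  have h2 : a * (1 - b) * (4 - 3 * b) ≤ 3 / 2 * (4 - 3 * b) := by nlinarith
  have h3 := le_of_mul_le_mul_right h2 (by linarith : (0 : ℝ) < 4 - 3 * b)
  linarith

/-- The potential of the exterior region, with `g = 1 / P - 1 / r`. -/
lemma trappingPotential (h : Exterior M Q Λ r₂ P r₃ P₁) :
    TrappingPotential (potential M Q Λ) (fun s => 1 / P - 1 / radius M Q Λ s)
      (fun s => 2 * (P / radius M Q Λ s) * (1 - P₁ / radius M Q Λ s))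
      (2 * (P / r₃) * (1 - P₁ / r₂))
      (1 / r₂ ^ 2 + Q ^ 2 / r₂ ^ 4 + 1 / P + 1 / r₂) := by
  have hP := h.P_pos
  have hr2 := h.r₂_pos
  have hr3 : 0 < r₃ := hP.trans h.lt_r₃
  have hM : 0 < M := by linarith [h.sum_eq, h.P₁_pos]
  have hq2 : 0 < 1 - P₁ / r₂ := sub_pos.2 ((div_lt_one hr2).2 h.P₁_lt)
  have hr0 : ∀ s, 0 < radius M Q Λ s := fun s => h.pos_of_mem (h.radius_mem s)
  have hcont : Continuous (radius M Q Λ) :=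
    continuous_iff_continuousAt.2 h.continuousAt_radius
  have hΛ := h.cosm_pos
  refine ⟨by positivity, fun s => ?_, fun s => ?_, fun s => ?_, fun s => ?_,
    fun s => h.factor_le (h.radius_mem s), ?_, fun s => ?_, fun s => ?_, ?_⟩
  · exact div_pos (h.pos _ (h.radius_mem s)) (pow_pos (hr0 s) 2)
  · have hm := h.radius_mem s
    have hrs := hr0 s
    have e : potential M Q Λ s ≤ 1 / radius M Q Λ s ^ 2 + Q ^ 2 / radius M Q Λ s ^ 4 := by
      unfold potential
      set r := radius M Q Λ s
      have e2 : 1 / r ^ 2 + Q ^ 2 / r ^ 4 = (1 + Q ^ 2 / r ^ 2) / r ^ 2 := by field_simp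
      rw [e2]
      gcongr
      unfold horizonFn
      have : 0 < 2 * M / r := by positivity
      have : 0 < Λ * r ^ 2 := by positivity
      linarith
    have hle := hm.1.le
    have e3 : 1 / radius M Q Λ s ^ 2 + Q ^ 2 / radius M Q Λ s ^ 4
        ≤ 1 / r₂ ^ 2 + Q ^ 2 / r₂ ^ 4 := by gcongr
    have : 0 < 1 / P + 1 / r₂ := by positivity
    linarith
  · have hle := (h.radius_mem s).1.le
    have hrs := hr0 s
    have e1 : 1 / radius M Q Λ s ≤ 1 / r₂ := by gcongr
    have e2 : 0 < 1 / radius M Q Λ s := by positivity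
    have e3 : 0 < 1 / P := by positivity
    have e4 : 0 < 1 / r₂ := by positivity
    have e5 : 0 ≤ 1 / r₂ ^ 2 + Q ^ 2 / r₂ ^ 4 := by positivity
    rw [abs_le]
    constructor <;> linarith
  · have hle := (h.radius_mem s).1.le
    have hle3 := (h.radius_mem s).2.le
    have hrs := hr0 s
    have hP1 := h.P₁_pos
    gcongr
  · have : radius M Q Λ 0 = P := by
      rw [← h.reggeWheeler_photon, h.radius_reggeWheeler h.P_mem]
    simp [this]
  · have h1 : HasDerivAt (fun s => 1 / radius M Q Λ s) _ s :=
      (hasDerivAt_const s (1 : ℝ)).div (h.hasDerivAt_radius s) (hr0 s).ne'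
    refine (h1.const_sub (1 / P)).congr_deriv ?_
    simp [potential, neg_div]
  · have hrs := hr0 s
    have h1 : HasDerivAt (fun s => horizonFn M Q Λ (radius M Q Λ s)) _ s :=
      (hasDerivAt_horizonFn M Q Λ hrs.ne').comp s (h.hasDerivAt_radius s)
    have h2 : HasDerivAt (fun s => radius M Q Λ s ^ 2) _ s := (h.hasDerivAt_radius s).pow 2
    have h3 : HasDerivAt (potential M Q Λ) _ s := h1.div h2 (by positivity)
    refine h3.congr_deriv ?_
    unfold potential
    set f := horizonFn M Q Λ (radius M Q Λ s) with hf
    set r := radius M Q Λ s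
    have ef : f * r ^ 2 = r ^ 2 - 2 * M * r + Q ^ 2 - Λ * r ^ 4 := by
      rw [hf]
      unfold horizonFn
      field_simp
    have hs := h.sum_eq
    have hp := h.prod_eq
    have key : (2 * M / r ^ 2 - 2 * Q ^ 2 / r ^ 3 - 2 * Λ * r) * r - 2 * f
        = -(2 * (r - P) * (r - P₁)) / r ^ 2 := by
      have e3 : (r - P) * (r - P₁) = r ^ 2 - 3 * M * r + 2 * Q ^ 2 := by
        linear_combination -r * hs + hp
      rw [mul_assoc 2 (r - P), e3]
      field_simp
      linear_combination (-1) * ef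
    have e4 : ((2 * M / r ^ 2 - 2 * Q ^ 2 / r ^ 3 - 2 * Λ * r) * f * r ^ 2
        - f * ((2 : ℕ) * r ^ (2 - 1) * f)) / (r ^ 2) ^ 2
        = f * ((2 * M / r ^ 2 - 2 * Q ^ 2 / r ^ 3 - 2 * Λ * r) * r - 2 * f) / r ^ 3 := by
      field_simp
      push_cast
      ring
    rw [e4, key]
    field_simp
  · have h0 : ∀ s, radius M Q Λ s ≠ 0 := fun s => (hr0 s).ne'
    fun_prop (disch := exact h0 _)

end Exterior

/-- The potential of the exterior of a subextremal black hole traps at the photon sphere. -/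
lemma Admissible.exists_trappingPotential {M Q Λ : ℝ} (h : Admissible M Q Λ) :
    ∃ g q q₀ B, TrappingPotential (potential M Q Λ) g q q₀ B := by
  obtain ⟨r₂, P, r₃, P₁, hE⟩ := h.exists_exterior
  exact ⟨_, _, _, _, hE.trappingPotential⟩

/-! ### Weighted balance laws on the line -/

lemma hasDerivAt_max_pow (k : ℕ) (x : ℝ) :
    HasDerivAt (fun y : ℝ => max y 0 ^ (k + 2)) ((k + 2) * max x 0 ^ (k + 1)) x := by
  have hne : ∀ y : ℝ, y ≠ 0 →
      HasDerivAt (fun y : ℝ => max y 0 ^ (k + 2)) ((k + 2) * max y 0 ^ (k + 1)) y := by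
    intro y hy
    rcases hy.lt_or_gt with h | h
    · refine HasDerivAt.congr_of_eventuallyEq (f := fun _ => (0 : ℝ)) ?_ ?_
      · simpa [max_eq_right h.le] using hasDerivAt_const y (0 : ℝ)
      · filter_upwards [Iio_mem_nhds h] with z hz
        simp [max_eq_right (le_of_lt (mem_Iio.1 hz))]
    · refine HasDerivAt.congr_of_eventuallyEq (f := fun z : ℝ => z ^ (k + 2)) ?_ ?_
      · have := hasDerivAt_pow (k + 2) y
        rw [max_eq_left h.le]
        refine this.congr_deriv ?_
        push_cast
        rfl
      · filter_upwards [Ioi_mem_nhds h] with z hz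
        simp [max_eq_left (le_of_lt (mem_Ioi.1 hz))]
  by_cases hx : x = 0
  · subst hx
    exact hasDerivAt_of_hasDerivAt_of_ne hne (by fun_prop) (by fun_prop)
  · exact hne x hx

/-- The balance law for a density `D` with flux `F`, integrated against a weight that vanishes at
the end points of the interval. -/
lemma hasDerivAt_weighted_integral {R : ℝ} (hR : 0 ≤ R) {w wt ws D Dt F Fs : ℝ → ℝ → ℝ}
    (cw : Continuous (Function.uncurry w)) (cwt : Continuous (Function.uncurry wt))
    (cws : Continuous (Function.uncurry ws)) (cD : Continuous (Function.uncurry D))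
    (cDt : Continuous (Function.uncurry Dt)) (cF : Continuous (Function.uncurry F))
    (cFs : Continuous (Function.uncurry Fs))
    (hwt : ∀ t s, HasDerivAt (fun τ => w τ s) (wt t s) t)
    (hws : ∀ t s, HasDerivAt (fun σ => w t σ) (ws t s) s)
    (hD : ∀ t s, HasDerivAt (fun τ => D τ s) (Dt t s) t)
    (hF : ∀ t s, HasDerivAt (fun σ => F t σ) (Fs t s) s)
    {t : ℝ} (h1 : w t R = 0) (h2 : w t (-R) = 0) :
    HasDerivAt (fun τ => ∫ s in Icc (-R) R, w τ s * D τ s)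
      (∫ s in Icc (-R) R,
        (wt t s * D t s - ws t s * F t s + w t s * (Dt t s - Fs t s))) t := by
  have sl : ∀ {f : ℝ → ℝ → ℝ}, Continuous (Function.uncurry f) → Continuous (f t) :=
    fun hf => hf.comp (Continuous.prodMk_right t)
  have c1 := sl cw
  have c2 := sl cwt
  have c3 := sl cws
  have c4 := sl cD
  have c5 := sl cDt
  have c6 := sl cF
  have c7 := sl cFs
  have key := hasDerivAt_setIntegral_of_continuous (μ := (volume : Measure ℝ))
    (f := fun τ s => w τ s * D τ s) (f' := fun τ s => wt τ s * D τ s + w τ s * Dt τ s)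
    (isCompact_Icc (a := -R) (b := R)) measurableSet_Icc
    (cw.mul cD) ((cwt.mul cD).add (cw.mul cDt)) (fun τ s => (hwt τ s).mul (hD τ s)) t
  refine key.congr_deriv ?_
  have flux : ∫ s in Icc (-R) R, (ws t s * F t s + w t s * Fs t s) = 0 := by
    rw [integral_Icc_eq_integral_Ioc, ← intervalIntegral.integral_of_le (by linarith),
      intervalIntegral.integral_eq_sub_of_hasDerivAt (f := fun s => w t s * F t s)
        (fun s _ => (hws t s).mul (hF t s))
        (((c3.mul c6).add (c1.mul c7)).intervalIntegrable _ _), h1, h2]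
    simp
  have i1 : IntegrableOn (fun s => wt t s * D t s + w t s * Dt t s) (Icc (-R) R) :=
    ((c2.mul c4).add (c1.mul c5)).integrableOn_Icc
  have i2 : IntegrableOn (fun s => ws t s * F t s + w t s * Fs t s) (Icc (-R) R) :=
    ((c3.mul c6).add (c1.mul c7)).integrableOn_Icc
  calc ∫ s in Icc (-R) R, (wt t s * D t s + w t s * Dt t s)
      = (∫ s in Icc (-R) R, (wt t s * D t s + w t s * Dt t s))
        - ∫ s in Icc (-R) R, (ws t s * F t s + w t s * Fs t s) := by rw [flux, sub_zero]
    _ = _ := by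
        rw [← integral_sub i1 i2]
        refine integral_congr_ae (.of_forall fun s => ?_)
        ring

/-- A cut-off for the slice `{t}`, supported in the cone `|s| ≤ R - t` and nonincreasing along all
causal directions. -/
def coneCutoff (R t s : ℝ) : ℝ := max ((R - t) ^ 2 - s ^ 2) 0 ^ 2 / R ^ 4

/-- The part of the Morawetz weight that depends on `s`; it is supported in the light cone. -/
def lightConeWeight (t s : ℝ) : ℝ := max (t ^ 2 - s ^ 2) 0 ^ 3

section cutoffs

lemma hasDerivAt_coneCutoff_fst (R t s : ℝ) : HasDerivAt (fun τ => coneCutoff R τ s)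
    (-(4 * (R - t) * max ((R - t) ^ 2 - s ^ 2) 0) / R ^ 4) t := by
  have h1 : HasDerivAt (fun τ : ℝ => (R - τ) ^ 2 - s ^ 2) (-2 * (R - t)) t := by
    have := ((((hasDerivAt_id t).const_sub R).pow 2).sub_const (s ^ 2))
    refine this.congr_deriv ?_
    simp
  have h2 := ((hasDerivAt_max_pow 0 _).comp t h1).div_const (R ^ 4)
  refine h2.congr_deriv ?_
  push_cast
  ring

lemma hasDerivAt_coneCutoff_snd (R t s : ℝ) : HasDerivAt (fun σ => coneCutoff R t σ)
    (-(4 * s * max ((R - t) ^ 2 - s ^ 2) 0) / R ^ 4) s := by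
  have h1 : HasDerivAt (fun σ : ℝ => (R - t) ^ 2 - σ ^ 2) (-2 * s) s := by
    have := (hasDerivAt_pow 2 s).const_sub ((R - t) ^ 2)
    refine this.congr_deriv ?_
    simp
  have h2 := ((hasDerivAt_max_pow 0 _).comp s h1).div_const (R ^ 4)
  refine h2.congr_deriv ?_
  push_cast
  ring

lemma hasDerivAt_lightConeWeight_fst (t s : ℝ) : HasDerivAt (fun τ => lightConeWeight τ s)
    (6 * t * max (t ^ 2 - s ^ 2) 0 ^ 2) t := by
  have h1 : HasDerivAt (fun τ : ℝ => τ ^ 2 - s ^ 2) (2 * t) t := by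
    have := (hasDerivAt_pow 2 t).sub_const (s ^ 2)
    refine this.congr_deriv ?_
    simp
  refine ((hasDerivAt_max_pow 1 _).comp t h1).congr_deriv ?_
  push_cast
  ring

lemma hasDerivAt_lightConeWeight_snd (t s : ℝ) : HasDerivAt (fun σ => lightConeWeight t σ)
    (-(6 * s * max (t ^ 2 - s ^ 2) 0 ^ 2)) s := by
  have h1 : HasDerivAt (fun σ : ℝ => t ^ 2 - σ ^ 2) (-2 * s) s := by
    have := (hasDerivAt_pow 2 s).const_sub (t ^ 2)
    refine this.congr_deriv ?_
    simp
  refine ((hasDerivAt_max_pow 1 _).comp s h1).congr_deriv ?_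
  push_cast
  ring

lemma coneCutoff_nonneg (R t s : ℝ) : 0 ≤ coneCutoff R t s := by unfold coneCutoff; positivity

variable {R t s : ℝ}

lemma coneCutoff_le_one (hR : 0 < R) (ht : 0 ≤ t) (htR : t ≤ R) : coneCutoff R t s ≤ 1 := by
  unfold coneCutoff
  rw [div_le_one (by positivity)]
  have h : max ((R - t) ^ 2 - s ^ 2) 0 ≤ R ^ 2 := max_le (by nlinarith [sq_nonneg s]) (sq_nonneg R)
  calc max ((R - t) ^ 2 - s ^ 2) 0 ^ 2 ≤ (R ^ 2) ^ 2 := by gcongr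
    _ = R ^ 4 := by ring

lemma coneCutoff_ge (hR : 0 < R) (htR : t ≤ R / 4) (hs : |s| ≤ R / 4) :
    1 / 4 ≤ coneCutoff R t s := by
  unfold coneCutoff
  rw [le_div_iff₀ (by positivity)]
  have hs2 : s ^ 2 ≤ (R / 4) ^ 2 := sq_le_sq' (abs_le.1 hs).1 (abs_le.1 hs).2
  have h : R ^ 2 / 2 ≤ max ((R - t) ^ 2 - s ^ 2) 0 := le_max_of_le_left (by nlinarith)
  calc 1 / 4 * R ^ 4 = (R ^ 2 / 2) ^ 2 := by ring
    _ ≤ _ := by gcongr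

lemma coneCutoff_endpoint (ht : 0 ≤ t) (htR : t ≤ R) (hs : s ^ 2 = R ^ 2) :
    coneCutoff R t s = 0 := by
  unfold coneCutoff
  rw [max_eq_right (by nlinarith)]
  simp

lemma abs_mul_max_le (htR : t ≤ R) :
    |s| * max ((R - t) ^ 2 - s ^ 2) 0 ≤ (R - t) * max ((R - t) ^ 2 - s ^ 2) 0 := by
  by_cases h : (R - t) ^ 2 - s ^ 2 ≤ 0
  · simp [max_eq_right h]
  · exact mul_le_mul_of_nonneg_right (abs_le_of_sq_le_sq (by linarith) (by linarith))
      (le_max_right _ _)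

end cutoffs

/-! ### Densities and fluxes of the reduced problem -/

section

variable {V g q : ℝ → ℝ} {q₀ B : ℝ}

lemma TrappingPotential.cont_V (T : TrappingPotential V g q q₀ B) : Continuous V :=
  continuous_iff_continuousAt.2 fun s => (T.deriv_V s).continuousAt

lemma TrappingPotential.cont_g (T : TrappingPotential V g q q₀ B) : Continuous g :=
  continuous_iff_continuousAt.2 fun s => (T.deriv_g s).continuousAt

lemma TrappingPotential.B_pos (T : TrappingPotential V g q q₀ B) : 0 < B :=
  (T.V_pos 0).trans_le (T.V_le 0)

lemma TrappingPotential.strictMono_g (T : TrappingPotential V g q q₀ B) : StrictMono g :=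
  strictMono_of_deriv_pos fun s => by rw [(T.deriv_g s).deriv]; exact T.V_pos s

lemma TrappingPotential.mul_g_nonneg (T : TrappingPotential V g q q₀ B) (s : ℝ) :
    0 ≤ s * g s := by
  have hm := T.strictMono_g.monotone
  rcases le_total 0 s with h | h
  · exact mul_nonneg h (T.g_zero ▸ hm h)
  · exact mul_nonneg_of_nonpos_of_nonpos h (T.g_zero ▸ hm h)

/-- Far from the photon sphere the potential decays at least like `s⁻²` in the infinitesimal
sense; there the conformal charge has a good sign. -/
lemma TrappingPotential.exists_radius (T : TrappingPotential V g q q₀ B) :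
    ∃ S : ℝ, 0 < S ∧ ∀ s, S ≤ |s| → 2 ≤ s * g s * q s := by
  have hm := T.strictMono_g
  have h1 : 0 < g 1 := by simpa [T.g_zero] using hm one_pos
  have h2 : g (-1) < 0 := by simpa [T.g_zero] using hm (show (-1 : ℝ) < 0 by norm_num)
  set c := min (g 1) (-g (-1)) with hc
  have hc0 : 0 < c := lt_min h1 (by linarith)
  have hq0 := T.q₀_pos
  refine ⟨max 1 (2 / (c * q₀)), by positivity, fun s hs => ?_⟩
  have hs1 : 1 ≤ |s| := (le_max_left _ _).trans hs
  have hs2 : 2 / (c * q₀) ≤ |s| := (le_max_right _ _).trans hs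
  rw [div_le_iff₀ (by positivity)] at hs2
  have hgs : |s| * c ≤ s * g s := by
    rcases le_total 0 s with h | h
    · rw [abs_of_nonneg h] at *
      exact mul_le_mul_of_nonneg_left ((min_le_left _ _).trans (hm.monotone hs1)) h
    · rw [abs_of_nonpos h] at *
      have : g s ≤ g (-1) := hm.monotone (by linarith)
      have h3 : c ≤ -g (-1) := min_le_right _ _
      nlinarith
  calc (2 : ℝ) ≤ |s| * (c * q₀) := hs2
    _ = |s| * c * q₀ := by ring
    _ ≤ s * g s * q s := mul_le_mul hgs (T.le_q s) hq0.le (T.mul_g_nonneg s)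

namespace ReducedWave

variable (W : ReducedWave V)

/-- The energy density. -/
def e (t s : ℝ) : ℝ := W.a t s + W.b t s + V s * W.n t s

/-- The conformal charge density. -/
def eC (t s : ℝ) : ℝ := 1 / 2 * (t ^ 2 + s ^ 2) * W.e t s + 2 * t * s * W.p t s + W.e t s

/-- The flux of the conformal charge. -/
def fluxC (t s : ℝ) : ℝ :=
  (t ^ 2 + s ^ 2 + 2) * W.p t s + t * s * (W.a t s + W.b t s - V s * W.n t s)

lemma n_nonneg (t s : ℝ) : 0 ≤ W.n t s := by
  linarith [W.poincare t s, W.z_nonneg t s]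

lemma e_nonneg (hV : ∀ s, 0 < V s) (t s : ℝ) : 0 ≤ W.e t s :=
  add_nonneg (add_nonneg (W.a_nonneg t s) (W.b_nonneg t s))
    (mul_nonneg (hV s).le (W.n_nonneg t s))

lemma two_abs_p_le (t s : ℝ) : 2 * |W.p t s| ≤ W.a t s + W.b t s := by
  have h1 := W.quad_p t s 1
  have h2 := W.quad_p t s (-1)
  rcases abs_cases (W.p t s) with h | h <;> linarith

lemma Vn_nonneg (hV : ∀ s, 0 < V s) (t s : ℝ) : 0 ≤ V s * W.n t s :=
  mul_nonneg (hV s).le (W.n_nonneg t s)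

/-- Positivity of the conformal charge density, with the weight by which it exceeds the energy
density away from the light cone. -/
lemma weight_mul_e_le (hV : ∀ s, 0 < V s) {t s δ : ℝ} (h1 : δ ≤ (t + s) ^ 2)
    (h2 : δ ≤ (t - s) ^ 2) : (δ + 2) * W.e t s ≤ 2 * W.eC t s := by
  have hp1 := W.quad_p t s 1
  have hp2 := W.quad_p t s (-1)
  have hn := W.Vn_nonneg hV t s
  have a1 := mul_nonneg (sub_nonneg.2 h1)
    (show 0 ≤ W.a t s + W.b t s + 2 * W.p t s by linarith)
  have a2 := mul_nonneg (sub_nonneg.2 h2)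
    (show 0 ≤ W.a t s + W.b t s - 2 * W.p t s by linarith)
  have a3 : 0 ≤ ((t + s) ^ 2 - δ + ((t - s) ^ 2 - δ)) * (V s * W.n t s) :=
    mul_nonneg (by linarith) hn
  unfold eC e
  linarith

lemma e_le_eC (hV : ∀ s, 0 < V s) (t s : ℝ) : W.e t s ≤ W.eC t s := by
  have := W.weight_mul_e_le hV (sq_nonneg (t + s)) (sq_nonneg (t - s))
  linarith

lemma eC_nonneg (hV : ∀ s, 0 < V s) (t s : ℝ) : 0 ≤ W.eC t s :=
  (W.e_nonneg hV t s).trans (W.e_le_eC hV t s)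

lemma abs_fluxC_le (hV : ∀ s, 0 < V s) (t s : ℝ) : |W.fluxC t s| ≤ W.eC t s := by
  have hp1 := W.quad_p t s 1
  have hp2 := W.quad_p t s (-1)
  have hn := W.Vn_nonneg hV t s
  have a1 := mul_nonneg (show 0 ≤ (t + s) ^ 2 + 2 by positivity)
    (show 0 ≤ W.a t s + W.b t s + 2 * W.p t s by linarith)
  have a2 := mul_nonneg (show 0 ≤ (t - s) ^ 2 + 2 by positivity)
    (show 0 ≤ W.a t s + W.b t s - 2 * W.p t s by linarith)
  have a3 := mul_nonneg (show 0 ≤ (t + s) ^ 2 + 2 by positivity) hn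
  have a4 := mul_nonneg (show 0 ≤ (t - s) ^ 2 + 2 by positivity) hn
  rw [abs_le]
  unfold fluxC eC e
  constructor <;> linarith

/-- The Morawetz density for the multiplier `g ∂_s`. -/
def mora (V g : ℝ → ℝ) (W : ReducedWave V) (t s : ℝ) : ℝ :=
  g s * W.p t s + 1 / 2 * V s * W.y₁ t s

/-- The Morawetz flux, with a multiple of `V |u|²` added in order to gain control of `u` itself at
the photon sphere. -/
def moraFlux (V g : ℝ → ℝ) (W : ReducedWave V) (ε t s : ℝ) : ℝ :=
  1 / 2 * g s * (W.a t s + W.b t s) - 1 / 2 * g s * V s * W.n t s + 1 / 2 * V s * W.y₂ t s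
    + ε * g s * V s * W.z t s

variable {W}

lemma two_abs_y₁_le (t s : ℝ) : 2 * |W.y₁ t s| ≤ W.a t s + W.z t s := by
  have h1 := W.quad_y₁ t s 1
  have h2 := W.quad_y₁ t s (-1)
  rcases abs_cases (W.y₁ t s) with h | h <;> linarith

lemma two_abs_y₂_le (t s : ℝ) : 2 * |W.y₂ t s| ≤ W.b t s + W.z t s := by
  have h1 := W.quad_y₂ t s 1
  have h2 := W.quad_y₂ t s (-1)
  rcases abs_cases (W.y₂ t s) with h | h <;> linarith

lemma potential_mul_z_le (T : TrappingPotential V g q q₀ B) (t s : ℝ) :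
    V s * W.z t s ≤ 2 * (V s * W.n t s) := by
  have := mul_le_mul_of_nonneg_left (W.poincare t s) (T.V_pos s).le
  linarith

lemma abs_mora_le (T : TrappingPotential V g q q₀ B) (t s : ℝ) :
    |W.mora V g t s| ≤ (2 * B + 1) * W.e t s := by
  have hV := T.V_pos s
  have hB := T.B_pos
  have ha := W.a_nonneg t s
  have hb := W.b_nonneg t s
  have hn := W.Vn_nonneg T.V_pos t s
  have h1 : |g s * W.p t s| ≤ B * (1 / 2 * (W.a t s + W.b t s)) := by
    rw [abs_mul]
    exact mul_le_mul (T.g_le s) (by linarith [W.two_abs_p_le t s]) (abs_nonneg _) hB.le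
  have h2 : |1 / 2 * V s * W.y₁ t s| ≤ 1 / 4 * (B * W.a t s) + 1 / 2 * (V s * W.n t s) := by
    rw [abs_mul, abs_of_nonneg (by positivity : (0 : ℝ) ≤ 1 / 2 * V s)]
    have k1 := mul_le_mul_of_nonneg_left (two_abs_y₁_le (W := W) t s) hV.le
    have k2 := mul_le_mul_of_nonneg_right (T.V_le s) ha
    have k3 := potential_mul_z_le (W := W) T t s
    linarith
  have h3 := abs_add_le (g s * W.p t s) (1 / 2 * V s * W.y₁ t s)
  have k4 := mul_nonneg hB.le ha
  have k5 := mul_nonneg hB.le hb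
  have k6 := mul_nonneg hB.le hn
  unfold mora e
  linarith

lemma abs_moraFlux_le (T : TrappingPotential V g q q₀ B) {ε : ℝ} (hε : 0 ≤ ε) (hε1 : ε ≤ 1 / 16)
    (t s : ℝ) : |W.moraFlux V g ε t s| ≤ (2 * B + 1) * W.e t s := by
  have hV := T.V_pos s
  have hB := T.B_pos
  have ha := W.a_nonneg t s
  have hb := W.b_nonneg t s
  have hn := W.Vn_nonneg T.V_pos t s
  have hz := W.z_nonneg t s
  have k3 := potential_mul_z_le (W := W) T t s
  have h1 : |1 / 2 * g s * (W.a t s + W.b t s)| ≤ 1 / 2 * (B * (W.a t s + W.b t s)) := by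
    rw [abs_mul, abs_mul, abs_of_nonneg (by positivity : (0 : ℝ) ≤ W.a t s + W.b t s),
      abs_of_pos (by norm_num : (0 : ℝ) < 1 / 2), mul_assoc]
    have := T.g_le s
    gcongr
  have h2 : |1 / 2 * g s * V s * W.n t s| ≤ 1 / 2 * (B * (V s * W.n t s)) := by
    rw [mul_assoc, abs_mul, abs_mul, abs_of_nonneg hn,
      abs_of_pos (by norm_num : (0 : ℝ) < 1 / 2), mul_assoc]
    have := T.g_le s
    gcongr
  have h4 : |1 / 2 * V s * W.y₂ t s| ≤ 1 / 4 * (B * W.b t s) + 1 / 2 * (V s * W.n t s) := by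
    rw [abs_mul, abs_of_nonneg (by positivity : (0 : ℝ) ≤ 1 / 2 * V s)]
    have k1 := mul_le_mul_of_nonneg_left (two_abs_y₂_le (W := W) t s) hV.le
    have k2 := mul_le_mul_of_nonneg_right (T.V_le s) hb
    linarith
  have h5 : |ε * g s * V s * W.z t s| ≤ 1 / 16 * (B * (2 * (V s * W.n t s))) := by
    rw [mul_assoc, abs_mul, abs_mul, abs_of_nonneg (by positivity : 0 ≤ V s * W.z t s),
      abs_of_nonneg hε, mul_assoc]
    have := T.g_le s
    gcongr
  have h6 := abs_add_le (1 / 2 * g s * (W.a t s + W.b t s) - 1 / 2 * g s * V s * W.n t s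
    + 1 / 2 * V s * W.y₂ t s) (ε * g s * V s * W.z t s)
  have h7 := abs_add_le (1 / 2 * g s * (W.a t s + W.b t s) - 1 / 2 * g s * V s * W.n t s)
    (1 / 2 * V s * W.y₂ t s)
  have h8 := abs_sub (1 / 2 * g s * (W.a t s + W.b t s)) (1 / 2 * g s * V s * W.n t s)
  have k4 := mul_nonneg hB.le ha
  have k5 := mul_nonneg hB.le hb
  have k6 := mul_nonneg hB.le hn
  unfold moraFlux e
  linarith

/-- `∂_t` of the Morawetz density. -/
def mora_t (V g : ℝ → ℝ) (W : ReducedWave V) (t s : ℝ) : ℝ :=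
  g s * (1 / 2 * W.abs_s t s - 1 / 2 * V s * W.n_s t s)
    + 1 / 2 * V s * (W.y₂s t s + W.a t s - W.b t s - V s * W.n t s)

/-- `∂_s` of the Morawetz flux. -/
def moraFlux_s (V g q : ℝ → ℝ) (W : ReducedWave V) (ε t s : ℝ) : ℝ :=
  1 / 2 * (V s * (W.a t s + W.b t s) + g s * W.abs_s t s)
    - 1 / 2 * ((V s * V s - g s * (V s * g s * q s)) * W.n t s + g s * V s * W.n_s t s)
    + 1 / 2 * (-(V s * g s * q s) * W.y₂ t s + V s * W.y₂s t s)
    + ε * ((V s * V s - g s * (V s * g s * q s)) * W.z t s + g s * V s * (2 * W.y₂ t s))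

lemma hasDerivAt_mora (t s : ℝ) :
    HasDerivAt (fun τ => W.mora V g τ s) (W.mora_t V g t s) t :=
  ((W.momentum_law t s).const_mul (g s)).add ((W.virial_law t s).const_mul (1 / 2 * V s))

lemma hasDerivAt_moraFlux (T : TrappingPotential V g q q₀ B) (ε t s : ℝ) :
    HasDerivAt (fun σ => W.moraFlux V g ε t σ) (W.moraFlux_s V g q ε t s) s := by
  have hg := T.deriv_g s
  have hV := T.deriv_V s
  have h := (((((hg.mul (W.deriv_ab t s)).const_mul (1 / 2)).sub
    (((hg.mul hV).mul (W.deriv_n t s)).const_mul (1 / 2))).add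
    ((hV.mul (W.deriv_y₂ t s)).const_mul (1 / 2))).add
    (((hg.mul hV).mul (W.deriv_z t s)).const_mul ε))
  refine (h.congr_of_eventuallyEq (.of_forall fun σ => ?_)).congr_deriv ?_
  · simp only [moraFlux, Pi.add_apply, Pi.sub_apply, Pi.mul_apply]
    ring
  · simp only [moraFlux_s, Pi.mul_apply]
    ring

/-- The bulk term of the Morawetz identity is positive: the multiplier `g` vanishes exactly at the
maximum of `V`, and the Poincaré inequality on the sphere absorbs the indefinite terms. -/
lemma mora_t_sub_moraFlux_s_le (T : TrappingPotential V g q q₀ B) {ε : ℝ} (hε : 0 ≤ ε)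
    (hε1 : ε ≤ 1 / 16) (hε2 : ε ≤ q₀ / 4) (t s : ℝ) :
    W.mora_t V g t s - W.moraFlux_s V g q ε t s ≤ -(ε * V s ^ 2 * W.z t s) := by
  have hV := T.V_pos s
  have hz := W.z_nonneg t s
  have hq := T.le_q s
  have hq3 := T.q_le s
  have hq0 := T.q₀_pos
  have e1 : W.mora_t V g t s - W.moraFlux_s V g q ε t s = -(V s * (W.b t s
      + 2 * (g s * (ε - q s / 4)) * W.y₂ t s + 1 / 2 * g s ^ 2 * q s * W.n t s
      + ε * (V s - g s ^ 2 * q s) * W.z t s)) := by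
    unfold mora_t moraFlux_s
    ring
  have h1 := W.quad_y₂ t s (g s * (ε - q s / 4))
  have h2 : g s ^ 2 * q s * W.z t s ≤ g s ^ 2 * q s * (2 * W.n t s) :=
    mul_le_mul_of_nonneg_left (W.poincare t s) (mul_nonneg (sq_nonneg _) (by linarith))
  -- discriminant condition for the quadratic form in `(∂_s u, u)`
  have h3 : (ε - q s / 4) ^ 2 ≤ (1 / 4 - ε) * q s := by nlinarith
  have h4 : (g s * (ε - q s / 4)) ^ 2 * W.z t s ≤ g s ^ 2 * ((1 / 4 - ε) * q s) * W.z t s := by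
    rw [mul_pow]
    gcongr
  have h5 : ε * V s * W.z t s ≤ W.b t s
      + 2 * (g s * (ε - q s / 4)) * W.y₂ t s + 1 / 2 * g s ^ 2 * q s * W.n t s
      + ε * (V s - g s ^ 2 * q s) * W.z t s := by linarith
  rw [e1, neg_le_neg_iff]
  calc ε * V s ^ 2 * W.z t s = V s * (ε * V s * W.z t s) := by ring
    _ ≤ _ := mul_le_mul_of_nonneg_left h5 hV.le

lemma cont_e (T : TrappingPotential V g q q₀ B) : Continuous (Function.uncurry W.e) :=
  (W.cont_a.add W.cont_b).add ((T.cont_V.comp continuous_snd).mul W.cont_n)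

lemma cont_eC (T : TrappingPotential V g q q₀ B) : Continuous (Function.uncurry W.eC) := by
  have h1 := W.cont_p
  have h2 := cont_e (W := W) T
  change Continuous fun x : ℝ × ℝ => 1 / 2 * (x.1 ^ 2 + x.2 ^ 2) * Function.uncurry W.e x
    + 2 * x.1 * x.2 * Function.uncurry W.p x + Function.uncurry W.e x
  fun_prop

/-- `∂_t` of the conformal charge density. -/
def eC_t (W : ReducedWave V) (t s : ℝ) : ℝ :=
  t * W.e t s + (t ^ 2 + s ^ 2 + 2) * W.p_s t s + 2 * s * W.p t s
    + t * s * (W.abs_s t s - V s * W.n_s t s)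

/-- `∂_s` of the flux of the conformal charge. -/
def fluxC_s (g q : ℝ → ℝ) (W : ReducedWave V) (t s : ℝ) : ℝ :=
  2 * s * W.p t s + (t ^ 2 + s ^ 2 + 2) * W.p_s t s
    + t * (W.a t s + W.b t s - V s * W.n t s)
    + t * s * (W.abs_s t s + V s * g s * q s * W.n t s - V s * W.n_s t s)

lemma cont_fluxC (T : TrappingPotential V g q q₀ B) : Continuous (Function.uncurry W.fluxC) := by
  have h1 := W.cont_p
  have h2 := W.cont_a
  have h3 := W.cont_b
  have h4 := W.cont_n
  have hV := T.cont_V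
  change Continuous fun x : ℝ × ℝ => (x.1 ^ 2 + x.2 ^ 2 + 2) * Function.uncurry W.p x
    + x.1 * x.2 * (Function.uncurry W.a x + Function.uncurry W.b x
      - V x.2 * Function.uncurry W.n x)
  fun_prop

lemma cont_eC_t (T : TrappingPotential V g q q₀ B) : Continuous (Function.uncurry W.eC_t) := by
  have h1 := cont_e (W := W) T
  have h2 := W.cont_p_s
  have h3 := W.cont_p
  have h4 := W.cont_ab_s
  have h5 := W.cont_n_s
  have hV := T.cont_V
  change Continuous fun x : ℝ × ℝ => x.1 * Function.uncurry W.e x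
    + (x.1 ^ 2 + x.2 ^ 2 + 2) * Function.uncurry W.p_s x + 2 * x.2 * Function.uncurry W.p x
    + x.1 * x.2 * (Function.uncurry W.abs_s x - V x.2 * Function.uncurry W.n_s x)
  fun_prop

lemma cont_fluxC_s (T : TrappingPotential V g q q₀ B) :
    Continuous (Function.uncurry (W.fluxC_s g q)) := by
  have h1 := W.cont_p
  have h2 := W.cont_p_s
  have h3 := W.cont_a
  have h4 := W.cont_b
  have h5 := W.cont_n
  have h6 := W.cont_ab_s
  have h7 := W.cont_n_s
  have hV := T.cont_V
  have hg := T.cont_g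
  have hq := T.cont_q
  change Continuous fun x : ℝ × ℝ => 2 * x.2 * Function.uncurry W.p x
    + (x.1 ^ 2 + x.2 ^ 2 + 2) * Function.uncurry W.p_s x
    + x.1 * (Function.uncurry W.a x + Function.uncurry W.b x - V x.2 * Function.uncurry W.n x)
    + x.1 * x.2 * (Function.uncurry W.abs_s x + V x.2 * g x.2 * q x.2 * Function.uncurry W.n x
      - V x.2 * Function.uncurry W.n_s x)
  fun_prop

lemma cont_mora (T : TrappingPotential V g q q₀ B) :
    Continuous (Function.uncurry (W.mora V g)) := by
  have h1 := W.cont_p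
  have h2 := W.cont_y₁
  have hV := T.cont_V
  have hg := T.cont_g
  change Continuous fun x : ℝ × ℝ => g x.2 * Function.uncurry W.p x
    + 1 / 2 * V x.2 * Function.uncurry W.y₁ x
  fun_prop

lemma cont_moraFlux (T : TrappingPotential V g q q₀ B) (ε : ℝ) :
    Continuous (Function.uncurry (W.moraFlux V g ε)) := by
  have h1 := W.cont_a
  have h2 := W.cont_b
  have h3 := W.cont_n
  have h4 := W.cont_y₂
  have h5 := W.cont_z
  have hV := T.cont_V
  have hg := T.cont_g
  change Continuous fun x : ℝ × ℝ =>
    1 / 2 * g x.2 * (Function.uncurry W.a x + Function.uncurry W.b x)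
    - 1 / 2 * g x.2 * V x.2 * Function.uncurry W.n x + 1 / 2 * V x.2 * Function.uncurry W.y₂ x
    + ε * g x.2 * V x.2 * Function.uncurry W.z x
  fun_prop

lemma cont_mora_t (T : TrappingPotential V g q q₀ B) :
    Continuous (Function.uncurry (W.mora_t V g)) := by
  have h1 := W.cont_a
  have h2 := W.cont_b
  have h3 := W.cont_n
  have h4 := W.cont_ab_s
  have h5 := W.cont_n_s
  have h6 := W.cont_y₂s
  have hV := T.cont_V
  have hg := T.cont_g
  change Continuous fun x : ℝ × ℝ =>
    g x.2 * (1 / 2 * Function.uncurry W.abs_s x - 1 / 2 * V x.2 * Function.uncurry W.n_s x)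
    + 1 / 2 * V x.2 * (Function.uncurry W.y₂s x + Function.uncurry W.a x - Function.uncurry W.b x
      - V x.2 * Function.uncurry W.n x)
  fun_prop

lemma cont_moraFlux_s (T : TrappingPotential V g q q₀ B) (ε : ℝ) :
    Continuous (Function.uncurry (W.moraFlux_s V g q ε)) := by
  have h1 := W.cont_a
  have h2 := W.cont_b
  have h3 := W.cont_n
  have h4 := W.cont_ab_s
  have h5 := W.cont_n_s
  have h6 := W.cont_y₂s
  have h7 := W.cont_y₂
  have h8 := W.cont_z
  have hV := T.cont_V
  have hg := T.cont_g
  have hq := T.cont_q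
  change Continuous fun x : ℝ × ℝ =>
    1 / 2 * (V x.2 * (Function.uncurry W.a x + Function.uncurry W.b x)
      + g x.2 * Function.uncurry W.abs_s x)
    - 1 / 2 * ((V x.2 * V x.2 - g x.2 * (V x.2 * g x.2 * q x.2)) * Function.uncurry W.n x
      + g x.2 * V x.2 * Function.uncurry W.n_s x)
    + 1 / 2 * (-(V x.2 * g x.2 * q x.2) * Function.uncurry W.y₂ x
      + V x.2 * Function.uncurry W.y₂s x)
    + ε * ((V x.2 * V x.2 - g x.2 * (V x.2 * g x.2 * q x.2)) * Function.uncurry W.z x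
      + g x.2 * V x.2 * (2 * Function.uncurry W.y₂ x))
  fun_prop

lemma hasDerivAt_eC (t s : ℝ) : HasDerivAt (fun τ => W.eC τ s) (W.eC_t t s) t := by
  have h1 := W.energy_law t s
  have h2 := W.momentum_law t s
  have h3 : HasDerivAt (fun τ : ℝ => 1 / 2 * (τ ^ 2 + s ^ 2)) t t := by
    have := (((hasDerivAt_pow 2 t).add_const (s ^ 2)).const_mul (1 / 2))
    refine this.congr_deriv ?_
    push_cast
    ring
  have h4 : HasDerivAt (fun τ : ℝ => 2 * τ * s) (2 * s) t := by
    simpa using ((hasDerivAt_id t).const_mul 2).mul_const s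
  refine (((h3.mul h1).add (h4.mul h2)).add h1).congr_deriv ?_
  unfold eC_t e
  ring

lemma hasDerivAt_fluxC (T : TrappingPotential V g q q₀ B) (t s : ℝ) :
    HasDerivAt (fun σ => W.fluxC t σ) (W.fluxC_s g q t s) s := by
  have h1 := W.deriv_p t s
  have h3 : HasDerivAt (fun σ : ℝ => t ^ 2 + σ ^ 2 + 2) (2 * s) s := by
    have := ((hasDerivAt_pow 2 s).const_add (t ^ 2)).add_const 2
    refine this.congr_deriv ?_
    push_cast
    ring
  have h4 : HasDerivAt (fun σ : ℝ => t * σ) t s := by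
    simpa using (hasDerivAt_id s).const_mul t
  refine ((h3.mul h1).add (h4.mul ((W.deriv_ab t s).sub
    ((T.deriv_V s).mul (W.deriv_n t s))))).congr_deriv ?_
  simp only [fluxC_s, Pi.sub_apply, Pi.mul_apply]
  ring

end ReducedWave

end

/-! ### An integral inequality of Gronwall type -/

lemma le_of_hasDerivAt_nonpos {f : ℝ → ℝ} {a b : ℝ} (hab : a ≤ b)
    (h : ∀ t ∈ Icc a b, ∃ d, HasDerivAt f d t ∧ d ≤ 0) : f b ≤ f a := by
  refine antitoneOn_of_deriv_nonpos (convex_Icc a b)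
    (fun t ht => (h t ht).choose_spec.1.continuousAt.continuousWithinAt)
    (fun t ht => ((h t (interior_subset ht)).choose_spec.1.differentiableAt).differentiableWithinAt)
    (fun t ht => ?_) (left_mem_Icc.2 hab) (right_mem_Icc.2 hab) hab
  obtain ⟨d, hd, hd0⟩ := h t (interior_subset ht)
  rw [hd.deriv]
  exact hd0

/-- Closing the hierarchy of inequalities. The growth of `E` is controlled by a localised quantity
`t * N`, which up to an exact derivative is bounded by `E` times an integrable function of time;
the exact derivative is of a quantity `J` that is small compared with `E` for large times. -/
lemma exists_gronwall_bound {L L₁ K₁ K₂ K₃ t₁ : ℝ} (hL : 0 ≤ L) (hL₁ : 0 ≤ L₁) (hK₁ : 0 ≤ K₁)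
    (hK₂ : 0 ≤ K₂) (hK₃ : 0 ≤ K₃) (ht₁ : 1 ≤ t₁)
    (hsmall : L * K₁ * K₃ * t₁ ^ (-1 / 4 : ℝ) ≤ 1 / 2) :
    ∃ C : ℝ, 0 < C ∧ ∀ (T F : ℝ) (E J N : ℝ → ℝ), 0 ≤ T → 0 ≤ F → Continuous N →
      (∀ t ∈ Icc 0 T, 0 ≤ E t) →
      (∀ t ∈ Icc 0 T, ∃ d, HasDerivAt E d t ∧ d ≤ L * (t * N t)) →
      (∀ t ∈ Icc 0 T, t ≤ t₁ → t * N t ≤ L₁ * E t) →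
      (∀ t ∈ Icc t₁ T, ∃ d, HasDerivAt J d t ∧
        t * N t ≤ -K₁ * d + K₂ * t ^ (-5 / 4 : ℝ) * (E t + F)) →
      (∀ t ∈ Icc t₁ T, |J t| ≤ K₃ * t ^ (-1 / 4 : ℝ) * E t) →
      E T ≤ C * (E 0 + F) ∧ ∫ t in 0..T, t * N t ≤ C * (E 0 + F) := by
  set c₁ := Real.exp (L * L₁ * t₁) with hc₁
  set c₂ := 2 * (Real.exp (8 * L * K₂) * (3 / 2 * c₁ + 1)) with hc₂
  have hc₁1 : 1 ≤ c₁ := Real.one_le_exp (by positivity)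
  have hc₂0 : 0 < c₂ := by positivity
  refine ⟨c₁ + c₂ + t₁ * (L₁ * c₁) + 2 * (K₁ * (K₃ * c₂)) + 4 * K₂ * (c₂ + 1), by positivity, ?_⟩
  intro T F E J N hT hF hN hE hEd hcrude hJ hJb
  have hE0 : 0 ≤ E 0 := hE 0 ⟨le_rfl, hT⟩
  have cN : Continuous fun t => t * N t := continuous_id.mul hN
  have iN : ∀ a b : ℝ, IntervalIntegrable (fun t => t * N t) volume a b :=
    fun a b => cN.intervalIntegrable a b
  -- the initial time interval
  have step1 : ∀ t ∈ Icc 0 T, t ≤ t₁ → E t ≤ c₁ * E 0 := by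
    intro t ht htt
    have h := le_of_hasDerivAt_nonpos (f := fun τ => E τ * Real.exp (-(L * L₁) * τ)) ht.1
      (fun τ hτ => by
        have hτT : τ ∈ Icc 0 T := ⟨hτ.1, hτ.2.trans ht.2⟩
        obtain ⟨d, hd, hd1⟩ := hEd τ hτT
        have h1 : HasDerivAt (fun τ : ℝ => Real.exp (-(L * L₁) * τ))
            (Real.exp (-(L * L₁) * τ) * -(L * L₁)) τ := by
          simpa using ((hasDerivAt_id τ).const_mul (-(L * L₁))).exp
        refine ⟨_, hd.mul h1, ?_⟩
        have h2 := mul_le_mul_of_nonneg_left (hcrude τ hτT (hτ.2.trans htt)) hL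
        have h3 : d - L * L₁ * E τ ≤ 0 := by linarith
        have h4 := mul_nonpos_of_nonpos_of_nonneg h3 (Real.exp_pos (-(L * L₁) * τ)).le
        linarith)
    simp only [mul_zero, Real.exp_zero, mul_one] at h
    have h2 : E t = E t * Real.exp (-(L * L₁) * t) * Real.exp (L * L₁ * t) := by
      rw [mul_assoc, ← Real.exp_add]
      simp
    rw [h2, mul_comm c₁]
    exact mul_le_mul h (Real.exp_le_exp.2 (by gcongr)) (Real.exp_pos _).le hE0
  have int1 : ∀ t ∈ Icc 0 T, t ≤ t₁ → ∫ τ in 0..t, τ * N τ ≤ t₁ * (L₁ * c₁) * E 0 := by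
    intro t ht htt
    have h := intervalIntegral.integral_mono_on (g := fun _ => L₁ * (c₁ * E 0)) ht.1 (iN 0 t)
      (intervalIntegrable_const) (fun τ hτ => by
        have hτT : τ ∈ Icc 0 T := ⟨hτ.1, hτ.2.trans ht.2⟩
        exact (hcrude τ hτT (hτ.2.trans htt)).trans
          (mul_le_mul_of_nonneg_left (step1 τ hτT (hτ.2.trans htt)) hL₁))
    refine h.trans ?_
    rw [intervalIntegral.integral_const, smul_eq_mul, sub_zero,
      show t₁ * (L₁ * c₁) * E 0 = t₁ * (L₁ * (c₁ * E 0)) by ring]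
    gcongr
  have hEF : 0 ≤ E 0 + F := by positivity
  have hle : E 0 ≤ E 0 + F := by linarith
  rcases le_total T t₁ with hTt | hTt
  · constructor
    · calc E T ≤ c₁ * E 0 := step1 T ⟨hT, le_rfl⟩ hTt
        _ ≤ c₁ * (E 0 + F) := by gcongr
        _ ≤ _ := mul_le_mul_of_nonneg_right (by
          have : 0 ≤ c₂ + t₁ * (L₁ * c₁) + 2 * (K₁ * (K₃ * c₂)) + 4 * K₂ * (c₂ + 1) := by
            positivity
          linarith) hEF
    · calc ∫ t in 0..T, t * N t ≤ t₁ * (L₁ * c₁) * E 0 := int1 T ⟨hT, le_rfl⟩ hTt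
        _ ≤ t₁ * (L₁ * c₁) * (E 0 + F) := by gcongr
        _ ≤ _ := mul_le_mul_of_nonneg_right (by
          have : 0 ≤ c₁ + c₂ + 2 * (K₁ * (K₃ * c₂)) + 4 * K₂ * (c₂ + 1) := by
            positivity
          linarith) hEF
  have ht₁0 : 0 < t₁ := by linarith
  have hpow : ∀ t ∈ Icc t₁ T, t ^ (-1 / 4 : ℝ) ≤ t₁ ^ (-1 / 4 : ℝ) ∧ t ^ (-1 / 4 : ℝ) ≤ 1 :=
    fun t ht => ⟨Real.rpow_le_rpow_of_nonpos ht₁0 ht.1 (by norm_num),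
      Real.rpow_le_one_of_one_le_of_nonpos (ht₁.trans ht.1) (by norm_num)⟩
  have hpd : ∀ t ∈ Icc t₁ T, HasDerivAt (fun τ : ℝ => τ ^ (-1 / 4 : ℝ))
      (-1 / 4 * t ^ (-5 / 4 : ℝ)) t := by
    intro t ht
    have := Real.hasDerivAt_rpow_const (x := t) (p := (-1 / 4 : ℝ))
      (Or.inl (ht₁0.trans_le ht.1).ne')
    rwa [show (-1 / 4 : ℝ) - 1 = -5 / 4 by norm_num] at this
  -- the correction by `J` changes `E` by at most one half
  have hYE : ∀ t ∈ Icc t₁ T, |L * K₁ * J t| ≤ 1 / 2 * E t := by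
    intro t ht
    have hEt := hE t ⟨ht₁0.le.trans ht.1, ht.2⟩
    rw [abs_mul, abs_of_nonneg (by positivity : 0 ≤ L * K₁)]
    calc L * K₁ * |J t| ≤ L * K₁ * (K₃ * t ^ (-1 / 4 : ℝ) * E t) := by gcongr; exact hJb t ht
      _ ≤ L * K₁ * (K₃ * t₁ ^ (-1 / 4 : ℝ) * E t) := by
        have := (hpow t ht).1
        gcongr
      _ = L * K₁ * K₃ * t₁ ^ (-1 / 4 : ℝ) * E t := by ring
      _ ≤ 1 / 2 * E t := by gcongr
  have hE1 : E t₁ ≤ c₁ * E 0 := step1 t₁ ⟨ht₁0.le, hTt⟩ le_rfl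
  -- `-4 * t ^ (-1 / 4)` is a primitive of `t ^ (-5 / 4)`, so the exponential below is the
  -- integrating factor; it stays bounded because the coefficient is integrable at infinity
  have step2 : ∀ t ∈ Icc t₁ T, E t ≤ c₂ * (E 0 + F) := by
    intro t ht
    have h := le_of_hasDerivAt_nonpos
      (f := fun τ => (E τ + L * K₁ * J τ + F) * Real.exp (8 * L * K₂ * τ ^ (-1 / 4 : ℝ))) ht.1
      (fun τ hτ => by
        have hτT : τ ∈ Icc t₁ T := ⟨hτ.1, hτ.2.trans ht.2⟩
        have hτ0 : τ ∈ Icc 0 T := ⟨ht₁0.le.trans hτ.1, hτT.2⟩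
        obtain ⟨d, hd, hd1⟩ := hEd τ hτ0
        obtain ⟨j, hj, hj1⟩ := hJ τ hτT
        have h1 := ((hpd τ hτT).const_mul (8 * L * K₂)).exp
        refine ⟨_, ((hd.add (hj.const_mul (L * K₁))).add_const F).mul h1, ?_⟩
        have hY := abs_le.1 (hYE τ hτT)
        have hw : 0 ≤ τ ^ (-5 / 4 : ℝ) := Real.rpow_nonneg hτ0.1 _
        have h2 := mul_le_mul_of_nonneg_left hj1 hL
        have h3 : L * K₂ * τ ^ (-5 / 4 : ℝ) * (E τ + F)
            ≤ L * K₂ * τ ^ (-5 / 4 : ℝ) * (2 * (E τ + L * K₁ * J τ + F)) := by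
          gcongr
          linarith
        have h4 : d + L * K₁ * j
            - 2 * L * K₂ * τ ^ (-5 / 4 : ℝ) * (E τ + L * K₁ * J τ + F) ≤ 0 := by
          linarith
        have h5 := mul_nonpos_of_nonpos_of_nonneg h4
          (Real.exp_pos (8 * L * K₂ * τ ^ (-1 / 4 : ℝ))).le
        simp only [Pi.add_apply]
        linarith)
    have hY := abs_le.1 (hYE t ht)
    have hY1 := abs_le.1 (hYE t₁ ⟨le_rfl, hTt⟩)
    have hEt := hE t ⟨ht₁0.le.trans ht.1, ht.2⟩
    have hpt : 0 ≤ t ^ (-1 / 4 : ℝ) := Real.rpow_nonneg (ht₁0.le.trans ht.1) _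
    have h6 : 1 ≤ Real.exp (8 * L * K₂ * t ^ (-1 / 4 : ℝ)) := Real.one_le_exp (by positivity)
    have h7 : Real.exp (8 * L * K₂ * t₁ ^ (-1 / 4 : ℝ)) ≤ Real.exp (8 * L * K₂) :=
      Real.exp_le_exp.2 (mul_le_of_le_one_right (by positivity) (hpow t₁ ⟨le_rfl, hTt⟩).2)
    have hE1' : 0 ≤ E t₁ := hE t₁ ⟨ht₁0.le, hTt⟩
    calc E t ≤ 2 * (E t + L * K₁ * J t + F) := by linarith
      _ ≤ 2 * ((E t + L * K₁ * J t + F) * Real.exp (8 * L * K₂ * t ^ (-1 / 4 : ℝ))) := by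
          have : 0 ≤ E t + L * K₁ * J t + F := by linarith
          have := le_mul_of_one_le_right this h6
          linarith
      _ ≤ 2 * ((E t₁ + L * K₁ * J t₁ + F) * Real.exp (8 * L * K₂ * t₁ ^ (-1 / 4 : ℝ))) := by
          linarith
      _ ≤ 2 * ((3 / 2 * (c₁ * E 0) + F) * Real.exp (8 * L * K₂)) := by
          have : E t₁ + L * K₁ * J t₁ + F ≤ 3 / 2 * (c₁ * E 0) + F := by linarith
          have := mul_le_mul this h7 (Real.exp_pos _).le (by positivity)
          linarith
      _ ≤ 2 * (((3 / 2 * c₁ + 1) * (E 0 + F)) * Real.exp (8 * L * K₂)) := by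
          have : 0 ≤ c₁ * F := by positivity
          gcongr
          linarith
      _ = c₂ * (E 0 + F) := by rw [hc₂]; ring
  constructor
  · calc E T ≤ c₂ * (E 0 + F) := step2 T ⟨hTt, le_rfl⟩
      _ ≤ _ := mul_le_mul_of_nonneg_right (by
          have : 0 ≤ c₁ + t₁ * (L₁ * c₁) + 2 * (K₁ * (K₃ * c₂)) + 4 * K₂ * (c₂ + 1) := by
            positivity
          linarith) hEF
  · set m := c₂ * (E 0 + F) with hm
    have hm0 : 0 ≤ m := by positivity
    have h := le_of_hasDerivAt_nonpos
      (f := fun t => (∫ τ in 0..t, τ * N τ) + K₁ * J t + 4 * K₂ * (m + F) * t ^ (-1 / 4 : ℝ)) hTt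
      (fun t ht => by
        obtain ⟨j, hj, hj1⟩ := hJ t ht
        have h0 : HasDerivAt (fun t => ∫ τ in 0..t, τ * N τ) (t * N t) t :=
          intervalIntegral.integral_hasDerivAt_right (iN 0 t)
            (cN.stronglyMeasurableAtFilter _ _) cN.continuousAt
        refine ⟨_, (h0.add (hj.const_mul K₁)).add ((hpd t ht).const_mul (4 * K₂ * (m + F))), ?_⟩
        have hw : 0 ≤ t ^ (-5 / 4 : ℝ) := Real.rpow_nonneg (ht₁0.le.trans ht.1) _
        have h3 : K₂ * t ^ (-5 / 4 : ℝ) * (E t + F) ≤ K₂ * t ^ (-5 / 4 : ℝ) * (m + F) := by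
          gcongr
          exact step2 t ht
        linarith)
    have hJm : ∀ t ∈ Icc t₁ T, |J t| ≤ K₃ * m := by
      intro t ht
      have h1 := step2 t ht
      have hEt := hE t ⟨ht₁0.le.trans ht.1, ht.2⟩
      calc |J t| ≤ K₃ * t ^ (-1 / 4 : ℝ) * E t := hJb t ht
        _ ≤ K₃ * 1 * m := by
          have := (hpow t ht).2
          gcongr
        _ = K₃ * m := by ring
    have j1 := mul_le_mul_of_nonneg_left (abs_le.1 (hJm T ⟨hTt, le_rfl⟩)).1 hK₁
    have j2 := mul_le_mul_of_nonneg_left (abs_le.1 (hJm t₁ ⟨le_rfl, hTt⟩)).2 hK₁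
    have hp1 : 4 * K₂ * (m + F) * t₁ ^ (-1 / 4 : ℝ) ≤ 4 * K₂ * (m + F) :=
      mul_le_of_le_one_right (by positivity) (hpow t₁ ⟨le_rfl, hTt⟩).2
    have hp2 : 0 ≤ 4 * K₂ * (m + F) * T ^ (-1 / 4 : ℝ) := by
      have := Real.rpow_nonneg hT (-1 / 4 : ℝ)
      positivity
    have hi := int1 t₁ ⟨ht₁0.le, hTt⟩ le_rfl
    have hf : 4 * K₂ * (m + F) ≤ 4 * K₂ * ((c₂ + 1) * (E 0 + F)) := by
      gcongr
      rw [hm]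
      linarith
    have hi2 : t₁ * (L₁ * c₁) * E 0 ≤ t₁ * (L₁ * c₁) * (E 0 + F) := by gcongr
    have hr : 0 ≤ (c₁ + c₂) * (E 0 + F) := by positivity
    have hm2 : K₁ * (K₃ * m) = K₁ * (K₃ * c₂) * (E 0 + F) := by rw [hm]; ring
    linarith

/-! ### The conformal charge inside a cone -/

section

variable {V g q : ℝ → ℝ} {q₀ B : ℝ}

lemma continuous_coneCutoff (R : ℝ) : Continuous (Function.uncurry (coneCutoff R)) := by
  change Continuous fun x : ℝ × ℝ => max ((R - x.1) ^ 2 - x.2 ^ 2) 0 ^ 2 / R ^ 4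
  fun_prop

lemma continuous_lightConeWeight : Continuous (Function.uncurry lightConeWeight) := by
  change Continuous fun x : ℝ × ℝ => max (x.1 ^ 2 - x.2 ^ 2) 0 ^ 3
  fun_prop

lemma continuous_slice {f : ℝ → ℝ → ℝ} (hf : Continuous (Function.uncurry f)) (t : ℝ) :
    Continuous (f t) := hf.comp (Continuous.prodMk_right t)

/-- Integration of a pointwise bound by a function and a multiple of a function localised to a
shorter interval. -/
lemma setIntegral_le_add_indicator {R S : ℝ} (hSR : S ≤ R) {f k l : ℝ → ℝ} (hf : Continuous f)
    (hk : Continuous k) (hl : Continuous l)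
    (h1 : ∀ s ∈ Icc (-R) R, |s| ≤ S → f s ≤ k s + l s)
    (h2 : ∀ s ∈ Icc (-R) R, S < |s| → f s ≤ k s) :
    ∫ s in Icc (-R) R, f s ≤ (∫ s in Icc (-R) R, k s) + ∫ s in Icc (-S) S, l s := by
  have hsub : Icc (-S) S ⊆ Icc (-R) R := Icc_subset_Icc (by linarith) hSR
  have il : IntegrableOn ((Icc (-S) S).indicator l) (Icc (-R) R) :=
    hl.integrableOn_Icc.indicator measurableSet_Icc
  have e1 : ∫ s in Icc (-S) S, l s = ∫ s in Icc (-R) R, (Icc (-S) S).indicator l s := by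
    rw [setIntegral_indicator measurableSet_Icc, inter_eq_self_of_subset_right hsub]
  rw [e1, ← integral_add hk.integrableOn_Icc il]
  refine setIntegral_mono_on hf.integrableOn_Icc (hk.integrableOn_Icc.add il) measurableSet_Icc
    fun s hs => ?_
  by_cases hsS : s ∈ Icc (-S) S
  · simp only [indicator_of_mem hsS]
    exact h1 s hs (abs_le.2 hsS)
  · simp only [indicator_of_notMem hsS, add_zero]
    exact h2 s hs (lt_of_not_ge fun h => hsS (abs_le.1 h))

namespace ReducedWave

variable {W : ReducedWave V}

/-- The energy inside the cone of radius `R`. -/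
def coneEnergy (W : ReducedWave V) (R t : ℝ) : ℝ :=
  ∫ s in Icc (-R) R, coneCutoff R t s * W.e t s

/-- The conformal charge inside the cone of radius `R`. -/
def coneCharge (W : ReducedWave V) (R t : ℝ) : ℝ :=
  ∫ s in Icc (-R) R, coneCutoff R t s * W.eC t s

lemma coneCharge_nonneg (hV : ∀ s, 0 < V s) (R t : ℝ) : 0 ≤ W.coneCharge R t :=
  integral_nonneg fun s => mul_nonneg (coneCutoff_nonneg R t s) (W.eC_nonneg hV t s)

/-- Through the boundary of the cone a flux dominated by the density only leaves. -/
lemma coneCutoff_flux_nonpos {R t s D F : ℝ} (htR : t ≤ R) (hD : |F| ≤ D) :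
    -(4 * (R - t) * max ((R - t) ^ 2 - s ^ 2) 0) / R ^ 4 * D
      - -(4 * s * max ((R - t) ^ 2 - s ^ 2) 0) / R ^ 4 * F ≤ 0 := by
  have hR : 0 ≤ R ^ 4 := by positivity
  set k := max ((R - t) ^ 2 - s ^ 2) 0 with hk
  have hk0 : 0 ≤ k := le_max_right _ _
  have h1 : |s| * k ≤ (R - t) * k := abs_mul_max_le htR
  have h2 : s * k * F ≤ (R - t) * k * D := by
    calc s * k * F ≤ |s * k * F| := le_abs_self _
      _ = |s| * k * |F| := by rw [abs_mul, abs_mul, abs_of_nonneg hk0]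
      _ ≤ (R - t) * k * D := mul_le_mul h1 hD (abs_nonneg _)
          ((mul_nonneg (abs_nonneg s) hk0).trans h1)
  have h3 : -(4 * (R - t) * k) / R ^ 4 * D - -(4 * s * k) / R ^ 4 * F
      = -(4 * ((R - t) * k * D - s * k * F) / R ^ 4) := by ring
  rw [h3, neg_nonpos]
  exact div_nonneg (by linarith) hR

/-- The energy is conserved, and the cone cutoff only lets it decrease. -/
lemma coneEnergy_le (T : TrappingPotential V g q q₀ B) {R t : ℝ} (ht : 0 ≤ t) (htR : t ≤ R) :
    W.coneEnergy R t ≤ W.coneEnergy R 0 := by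
  refine le_of_hasDerivAt_nonpos ht fun τ hτ => ?_
  have hτR : τ ≤ R := hτ.2.trans htR
  have c1 : Continuous fun x : ℝ × ℝ =>
      -(4 * (R - x.1) * max ((R - x.1) ^ 2 - x.2 ^ 2) 0) / R ^ 4 := by fun_prop
  have c2 : Continuous fun x : ℝ × ℝ =>
      -(4 * x.2 * max ((R - x.1) ^ 2 - x.2 ^ 2) 0) / R ^ 4 := by fun_prop
  refine ⟨_, hasDerivAt_weighted_integral (ht.trans htR)
    (wt := fun t s => -(4 * (R - t) * max ((R - t) ^ 2 - s ^ 2) 0) / R ^ 4)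
    (ws := fun t s => -(4 * s * max ((R - t) ^ 2 - s ^ 2) 0) / R ^ 4)
    (Dt := fun t s => 2 * W.p_s t s) (F := fun t s => 2 * W.p t s)
    (Fs := fun t s => 2 * W.p_s t s) (continuous_coneCutoff R) c1 c2
    (cont_e T) (W.cont_p_s.const_mul 2) (W.cont_p.const_mul 2) (W.cont_p_s.const_mul 2)
    (hasDerivAt_coneCutoff_fst R) (hasDerivAt_coneCutoff_snd R) W.energy_law
    (fun t s => (W.deriv_p t s).const_mul 2) (coneCutoff_endpoint hτ.1 hτR rfl)
    (coneCutoff_endpoint hτ.1 hτR (by ring)), ?_⟩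
  refine integral_nonpos fun s => ?_
  have hF : |2 * W.p τ s| ≤ W.e τ s := by
    rw [abs_mul, abs_of_pos (by norm_num : (0 : ℝ) < 2)]
    have := W.two_abs_p_le τ s
    have := W.Vn_nonneg T.V_pos τ s
    unfold e
    linarith
  have := coneCutoff_flux_nonpos (s := s) hτR hF
  simpa using this

/-- The conformal charge grows only through the region where the potential does not yet decay. -/
lemma exists_hasDerivAt_coneCharge (T : TrappingPotential V g q q₀ B) {S R t : ℝ} (hS0 : 0 < S)
    (hS : ∀ s, S ≤ |s| → 2 ≤ s * g s * q s) (hSR : S ≤ R) (ht : 0 ≤ t) (htR : t ≤ R) :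
    ∃ d, HasDerivAt (W.coneCharge R) d t ∧
      d ≤ 2 * B * (t * ∫ s in Icc (-S) S, W.n t s) := by
  have hR : 0 < R := hS0.trans_le hSR
  have c1 : Continuous fun x : ℝ × ℝ =>
      -(4 * (R - x.1) * max ((R - x.1) ^ 2 - x.2 ^ 2) 0) / R ^ 4 := by fun_prop
  have c2 : Continuous fun x : ℝ × ℝ =>
      -(4 * x.2 * max ((R - x.1) ^ 2 - x.2 ^ 2) 0) / R ^ 4 := by fun_prop
  refine ⟨_, hasDerivAt_weighted_integral hR.le
    (wt := fun t s => -(4 * (R - t) * max ((R - t) ^ 2 - s ^ 2) 0) / R ^ 4)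
    (ws := fun t s => -(4 * s * max ((R - t) ^ 2 - s ^ 2) 0) / R ^ 4)
    (continuous_coneCutoff R) c1 c2 (cont_eC T) (cont_eC_t T)
    (cont_fluxC (W := W) T) (cont_fluxC_s T)
    (hasDerivAt_coneCutoff_fst R) (hasDerivAt_coneCutoff_snd R) hasDerivAt_eC
    (hasDerivAt_fluxC T) (coneCutoff_endpoint ht htR rfl)
    (coneCutoff_endpoint ht htR (by ring)), ?_⟩
  have e1 : 2 * B * (t * ∫ s in Icc (-S) S, W.n t s)
      = (∫ s in Icc (-R) R, (0 : ℝ)) + ∫ s in Icc (-S) S, 2 * B * t * W.n t s := by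
    rw [integral_const_mul]
    simp [mul_assoc]
  rw [e1]
  -- `eC_t - fluxC_s` equals `t * (2 * V + s * V') * n`, and `V' = -(V * g * q)`
  have hpt : ∀ s, -(4 * (R - t) * max ((R - t) ^ 2 - s ^ 2) 0) / R ^ 4 * W.eC t s
      - -(4 * s * max ((R - t) ^ 2 - s ^ 2) 0) / R ^ 4 * W.fluxC t s
      + coneCutoff R t s * (W.eC_t t s - W.fluxC_s g q t s)
      ≤ coneCutoff R t s * t * (V s * W.n t s) * (2 - s * g s * q s) := by
    intro s
    have h1 := coneCutoff_flux_nonpos (s := s) htR (W.abs_fluxC_le T.V_pos t s)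
    unfold eC_t fluxC_s e
    linarith
  refine setIntegral_le_add_indicator hSR ?_ continuous_const ((continuous_slice W.cont_n t).const_mul _)
    (fun s _ hs => (hpt s).trans ?_) (fun s _ hs => (hpt s).trans ?_)
  · have cc := ((c1.mul (cont_eC (W := W) T)).sub (c2.mul (cont_fluxC (W := W) T))).add
      ((continuous_coneCutoff R).mul ((cont_eC_t (W := W) T).sub
        (cont_fluxC_s (W := W) T)))
    exact cc.comp (Continuous.prodMk_right t)
  · have hζ := coneCutoff_le_one (s := s) hR ht htR
    have hζ0 := coneCutoff_nonneg R t s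
    have hn := W.n_nonneg t s
    have hV := (T.V_pos s).le
    have hsg : 0 ≤ s * g s * q s :=
      mul_nonneg (T.mul_g_nonneg s) (T.q₀_pos.le.trans (T.le_q s))
    have hVB := T.V_le s
    have hB := T.B_pos
    calc coneCutoff R t s * t * (V s * W.n t s) * (2 - s * g s * q s)
        ≤ coneCutoff R t s * t * (V s * W.n t s) * 2 := by gcongr; linarith
      _ ≤ 1 * t * (B * W.n t s) * 2 := by gcongr
      _ = 0 + 2 * B * t * W.n t s := by ring
  · have h0 : 0 ≤ coneCutoff R t s * t * (V s * W.n t s) :=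
      mul_nonneg (mul_nonneg (coneCutoff_nonneg R t s) ht) (W.Vn_nonneg T.V_pos t s)
    exact mul_nonpos_of_nonneg_of_nonpos h0 (by linarith [hS s hs.le])

end ReducedWave

end

/-! ### The Morawetz estimate inside the light cone -/

section

variable {V g q : ℝ → ℝ} {q₀ B : ℝ}

lemma lightConeWeight_nonneg (t s : ℝ) : 0 ≤ lightConeWeight t s := by
  unfold lightConeWeight
  positivity

/-- Deep inside the light cone the Morawetz weight has its full size. -/
lemma lightConeWeight_ge {t s S : ℝ} (hSt : 2 * S ≤ t) (hs : |s| ≤ S) :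
    t ^ 6 / 4 ≤ lightConeWeight t s := by
  have hS : 0 ≤ S := (abs_nonneg s).trans hs
  have ht : 0 ≤ t := by linarith
  have hs2 : s ^ 2 ≤ (t / 2) ^ 2 :=
    sq_le_sq' (by linarith [(abs_le.1 hs).1]) (by linarith [(abs_le.1 hs).2])
  have h : 3 / 4 * t ^ 2 ≤ max (t ^ 2 - s ^ 2) 0 := le_max_of_le_left (by linarith)
  calc t ^ 6 / 4 ≤ 27 / 64 * t ^ 6 := by
        have : 0 ≤ t ^ 6 := by positivity
        linarith
    _ = (3 / 4 * t ^ 2) ^ 3 := by ring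
    _ ≤ lightConeWeight t s := by unfold lightConeWeight; gcongr

namespace ReducedWave

variable {W : ReducedWave V}

/-- The square of the defining function of the light cone compensates the degeneracy of the
conformal charge density there. -/
lemma max_sq_mul_e_le (hV : ∀ s, 0 < V s) {R t : ℝ} (s : ℝ) (ht : 0 ≤ t) (hR : 0 < R)
    (htR : t ≤ R / 4) :
    max (t ^ 2 - s ^ 2) 0 ^ 2 * W.e t s ≤ 32 * t ^ 2 * (coneCutoff R t s * W.eC t s) := by
  have heC := W.eC_nonneg hV t s
  have he := W.e_nonneg hV t s
  have hζ := coneCutoff_nonneg R t s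
  by_cases h : t ^ 2 - s ^ 2 ≤ 0
  · rw [max_eq_right h]
    have : 0 ≤ 32 * t ^ 2 * (coneCutoff R t s * W.eC t s) := by positivity
    simpa using this
  · have hst : |s| ≤ t := abs_le_of_sq_le_sq (by linarith) ht
    have hs1 := abs_le.1 hst
    rw [max_eq_left (not_le.1 h).le]
    have hs2 : |s| ^ 2 = s ^ 2 := sq_abs s
    have h1 : (t - |s|) ^ 2 ≤ (t + s) ^ 2 :=
      pow_le_pow_left₀ (by linarith) (by linarith [neg_abs_le s]) 2
    have h2 : (t - |s|) ^ 2 ≤ (t - s) ^ 2 :=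
      pow_le_pow_left₀ (by linarith) (by linarith [le_abs_self s]) 2
    have h3 := W.weight_mul_e_le hV h1 h2
    have h4 : (t ^ 2 - s ^ 2) ^ 2 ≤ 4 * t ^ 2 * (t - |s|) ^ 2 := by
      have e1 : t ^ 2 - s ^ 2 = (t + |s|) * (t - |s|) := by rw [← hs2]; ring
      rw [e1, mul_pow, show 4 * t ^ 2 = (2 * t) ^ 2 by ring]
      gcongr
      linarith
    have h5 : 1 / 4 ≤ coneCutoff R t s := coneCutoff_ge hR htR (hst.trans htR)
    have h6 : 1 / 4 * W.eC t s ≤ coneCutoff R t s * W.eC t s := by gcongr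
    calc (t ^ 2 - s ^ 2) ^ 2 * W.e t s ≤ 4 * t ^ 2 * (t - |s|) ^ 2 * W.e t s := by gcongr
      _ = 4 * t ^ 2 * ((t - |s|) ^ 2 * W.e t s) := by ring
      _ ≤ 4 * t ^ 2 * (8 * (coneCutoff R t s * W.eC t s)) :=
          mul_le_mul_of_nonneg_left (by linarith) (by positivity)
      _ = _ := by ring

/-- The Morawetz functional, weighted inside the light cone. -/
def moraIntegral (V g : ℝ → ℝ) (W : ReducedWave V) (R t : ℝ) : ℝ :=
  ∫ s in Icc (-R) R, lightConeWeight t s * W.mora V g t s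

lemma abs_moraIntegral_le (T : TrappingPotential V g q q₀ B) {R t : ℝ} (ht : 0 ≤ t) (hR : 0 < R)
    (htR : t ≤ R / 4) :
    |W.moraIntegral V g R t| ≤ 32 * (2 * B + 1) * t ^ 4 * W.coneCharge R t := by
  have hB := T.B_pos
  unfold moraIntegral coneCharge
  rw [← integral_const_mul, ← Real.norm_eq_abs]
  refine norm_integral_le_of_norm_le ?_ (.of_forall fun s => ?_)
  · exact (continuous_const.mul ((continuous_slice (continuous_coneCutoff R) t).mul
      (continuous_slice (cont_eC T) t))).integrableOn_Icc
  · have h1 := max_sq_mul_e_le (W := W) T.V_pos s ht hR htR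
    have h2 : max (t ^ 2 - s ^ 2) 0 ≤ t ^ 2 := max_le (by nlinarith [sq_nonneg s]) (sq_nonneg t)
    have he := W.e_nonneg T.V_pos t s
    rw [Real.norm_eq_abs, abs_mul, abs_of_nonneg (lightConeWeight_nonneg t s)]
    calc lightConeWeight t s * |W.mora V g t s|
        ≤ lightConeWeight t s * ((2 * B + 1) * W.e t s) :=
          mul_le_mul_of_nonneg_left (abs_mora_le T t s) (lightConeWeight_nonneg t s)
      _ = (2 * B + 1) * (max (t ^ 2 - s ^ 2) 0 * (max (t ^ 2 - s ^ 2) 0 ^ 2 * W.e t s)) := by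
          unfold lightConeWeight
          ring
      _ ≤ (2 * B + 1) * (t ^ 2 * (32 * t ^ 2 * (coneCutoff R t s * W.eC t s))) := by gcongr
      _ = _ := by ring

/-- The Morawetz estimate: `u` itself is controlled near the photon sphere. -/
lemma exists_hasDerivAt_moraIntegral (T : TrappingPotential V g q q₀ B) {ε v S R t : ℝ}
    (hε : 0 ≤ ε) (hε1 : ε ≤ 1 / 16) (hε2 : ε ≤ q₀ / 4) (hv : 0 ≤ v)
    (hvS : ∀ s, |s| ≤ S → v ≤ V s) (hSt : 2 * S ≤ t) (ht : 0 < t) (hR : 0 < R)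
    (htR : t ≤ R / 4) :
    ∃ d, HasDerivAt (W.moraIntegral V g R) d t ∧
      ε * v ^ 2 * (t ^ 6 / 4) * ∫ s in Icc (-S) S, W.z t s
        ≤ -d + 384 * (2 * B + 1) * t ^ 3 * W.coneCharge R t := by
  have hB := T.B_pos
  have c1 : Continuous fun x : ℝ × ℝ => 6 * x.1 * max (x.1 ^ 2 - x.2 ^ 2) 0 ^ 2 := by fun_prop
  have c2 : Continuous fun x : ℝ × ℝ => -(6 * x.2 * max (x.1 ^ 2 - x.2 ^ 2) 0 ^ 2) := by fun_prop
  have end0 : ∀ s, s ^ 2 = R ^ 2 → lightConeWeight t s = 0 := by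
    intro s hs
    unfold lightConeWeight
    rw [max_eq_right (by nlinarith)]
    simp
  refine ⟨_, hasDerivAt_weighted_integral hR.le
    (wt := fun t s => 6 * t * max (t ^ 2 - s ^ 2) 0 ^ 2)
    (ws := fun t s => -(6 * s * max (t ^ 2 - s ^ 2) 0 ^ 2))
    continuous_lightConeWeight c1 c2 (cont_mora (W := W) T) (cont_mora_t T)
    (cont_moraFlux (W := W) T ε) (cont_moraFlux_s T ε)
    hasDerivAt_lightConeWeight_fst hasDerivAt_lightConeWeight_snd hasDerivAt_mora
    (hasDerivAt_moraFlux T ε) (end0 R rfl) (end0 (-R) (by ring)), ?_⟩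
  have main := setIntegral_le_add_indicator (R := R) (S := S) (by linarith)
    (f := fun s => 6 * t * max (t ^ 2 - s ^ 2) 0 ^ 2 * W.mora V g t s
      - -(6 * s * max (t ^ 2 - s ^ 2) 0 ^ 2) * W.moraFlux V g ε t s
      + lightConeWeight t s * (W.mora_t V g t s - W.moraFlux_s V g q ε t s))
    (k := fun s => 384 * (2 * B + 1) * t ^ 3 * (coneCutoff R t s * W.eC t s))
    (l := fun s => -(ε * v ^ 2 * (t ^ 6 / 4)) * W.z t s) ?_ ?_ ?_ ?_ ?_
  · rw [integral_const_mul, integral_const_mul] at main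
    unfold coneCharge
    linarith
  · have cc := ((c1.mul (cont_mora (W := W) T)).sub (c2.mul (cont_moraFlux (W := W) T ε))).add
      (continuous_lightConeWeight.mul ((cont_mora_t (W := W) T).sub
        (cont_moraFlux_s (W := W) T ε)))
    exact cc.comp (Continuous.prodMk_right t)
  · exact continuous_const.mul ((continuous_slice (continuous_coneCutoff R) t).mul
      (continuous_slice (cont_eC T) t))
  · exact (continuous_slice W.cont_z t).const_mul _
  all_goals
    intro s _ hs
    have hz := W.z_nonneg t s
    have hw := lightConeWeight_nonneg t s
    have hV := T.V_pos s
    set k := max (t ^ 2 - s ^ 2) 0 ^ 2 with hk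
    have hk0 : 0 ≤ k := by positivity
    have he := W.e_nonneg T.V_pos t s
    have h1 : k * W.e t s ≤ 32 * t ^ 2 * (coneCutoff R t s * W.eC t s) :=
      max_sq_mul_e_le T.V_pos s ht.le hR htR
    have h2 : k * W.mora V g t s ≤ (2 * B + 1) * (k * W.e t s) := by
      have := mul_le_mul_of_nonneg_left ((le_abs_self _).trans (abs_mora_le (W := W) T t s)) hk0
      linarith
    have h3 : s * k ≤ t * k ∧ -(t * k) ≤ s * k := by
      by_cases h : t ^ 2 - s ^ 2 ≤ 0
      · simp [hk, max_eq_right h]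
      · have := abs_le.1 (abs_le_of_sq_le_sq (a := s) (b := t) (by linarith) ht.le)
        exact ⟨by gcongr; exact this.2, by nlinarith⟩
    have h4 : s * k * W.moraFlux V g ε t s ≤ t * ((2 * B + 1) * (k * W.e t s)) := by
      calc s * k * W.moraFlux V g ε t s ≤ |s * k * W.moraFlux V g ε t s| := le_abs_self _
        _ = |s * k| * |W.moraFlux V g ε t s| := abs_mul _ _
        _ ≤ (t * k) * ((2 * B + 1) * W.e t s) :=
          mul_le_mul (abs_le.2 ⟨h3.2, h3.1⟩) (abs_moraFlux_le T hε hε1 t s) (abs_nonneg _)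
            (by positivity)
        _ = _ := by ring
    have h5 := mul_le_mul_of_nonneg_left (mora_t_sub_moraFlux_s_le (W := W) T hε hε1 hε2 t s) hw
    have h6 := mul_le_mul_of_nonneg_left h2 ht.le
    have h7 : t * ((2 * B + 1) * (k * W.e t s))
        ≤ t * ((2 * B + 1) * (32 * t ^ 2 * (coneCutoff R t s * W.eC t s))) := by gcongr
  · have h8 : ε * v ^ 2 * (t ^ 6 / 4) * W.z t s
        ≤ lightConeWeight t s * (ε * V s ^ 2 * W.z t s) := by
      have a1 := lightConeWeight_ge hSt hs
      have a2 := hvS s hs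
      calc ε * v ^ 2 * (t ^ 6 / 4) * W.z t s = t ^ 6 / 4 * (ε * v ^ 2 * W.z t s) := by ring
        _ ≤ _ := by gcongr
    linarith
  · have h8 : 0 ≤ lightConeWeight t s * (ε * V s ^ 2 * W.z t s) := by positivity
    linarith

end ReducedWave

end

/-! ### The uniform bound for the reduced problem -/

section

variable {V g q : ℝ → ℝ} {q₀ B : ℝ}

namespace ReducedWave

variable {W : ReducedWave V}

lemma coneEnergy_le_coneCharge (T : TrappingPotential V g q q₀ B) (R t : ℝ) :
    W.coneEnergy R t ≤ W.coneCharge R t := by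
  have c0 := continuous_slice (continuous_coneCutoff R) t
  exact setIntegral_mono_on (c0.mul (continuous_slice (cont_e T) t)).integrableOn_Icc
    (c0.mul (continuous_slice (cont_eC T) t)).integrableOn_Icc measurableSet_Icc
    fun s _ => mul_le_mul_of_nonneg_left (W.e_le_eC T.V_pos t s) (coneCutoff_nonneg R t s)

/-- On bounded sets the potential is bounded below, and the cone cutoff is at least `1 / 4`. -/
lemma integral_n_le_coneEnergy (T : TrappingPotential V g q q₀ B) {v S R t : ℝ} (hv : 0 < v)
    (hvS : ∀ s, |s| ≤ S → v ≤ V s) (hR : 0 < R) (hSR : S ≤ R / 4) (htR : t ≤ R / 4) :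
    ∫ s in Icc (-S) S, W.n t s ≤ 4 / v * W.coneEnergy R t := by
  have c0 := (continuous_slice (continuous_coneCutoff R) t).mul
    (continuous_slice (cont_e (W := W) T) t)
  unfold coneEnergy
  rw [← integral_const_mul]
  have hnn : ∀ s, 0 ≤ 4 / v * (coneCutoff R t s * W.e t s) := fun s =>
    mul_nonneg (by positivity) (mul_nonneg (coneCutoff_nonneg R t s) (W.e_nonneg T.V_pos t s))
  calc ∫ s in Icc (-S) S, W.n t s
      ≤ ∫ s in Icc (-S) S, 4 / v * (coneCutoff R t s * W.e t s) := by
        refine setIntegral_mono_on (continuous_slice W.cont_n t).integrableOn_Icc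
          (c0.const_mul _).integrableOn_Icc measurableSet_Icc fun s hs => ?_
        have hs' : |s| ≤ S := abs_le.2 hs
        have hζ : 1 / 4 ≤ coneCutoff R t s := coneCutoff_ge hR htR (hs'.trans hSR)
        have hn := W.n_nonneg t s
        have h1 : v * W.n t s ≤ W.e t s := by
          have := mul_le_mul_of_nonneg_right (hvS s hs') hn
          have := W.a_nonneg t s
          have := W.b_nonneg t s
          unfold e
          linarith
        have he := W.e_nonneg T.V_pos t s
        calc W.n t s = 4 / v * (1 / 4 * (v * W.n t s)) := by field_simp
          _ ≤ 4 / v * (coneCutoff R t s * W.e t s) := by gcongr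
    _ ≤ _ := setIntegral_mono_set (c0.const_mul _).integrableOn_Icc
        (.of_forall hnn) (Icc_subset_Icc (by linarith) (by linarith)).eventuallyLE

lemma integral_eC_le_coneCharge (T : TrappingPotential V g q q₀ B) {ρ R t : ℝ}
    (hR : 0 < R) (hρR : ρ ≤ R / 4) (htR : t ≤ R / 4) :
    ∫ s in Icc (-ρ) ρ, W.eC t s ≤ 4 * W.coneCharge R t := by
  have c0 := (continuous_slice (continuous_coneCutoff R) t).mul
    (continuous_slice (cont_eC (W := W) T) t)
  unfold coneCharge
  rw [← integral_const_mul]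
  calc ∫ s in Icc (-ρ) ρ, W.eC t s
      ≤ ∫ s in Icc (-ρ) ρ, 4 * (coneCutoff R t s * W.eC t s) := by
        refine setIntegral_mono_on (continuous_slice (cont_eC T) t).integrableOn_Icc
          (c0.const_mul _).integrableOn_Icc measurableSet_Icc fun s hs => ?_
        have hζ : 1 / 4 ≤ coneCutoff R t s := coneCutoff_ge hR htR ((abs_le.2 hs).trans hρR)
        have := mul_le_mul_of_nonneg_right hζ (W.eC_nonneg T.V_pos t s)
        linarith
    _ ≤ _ := setIntegral_mono_set (c0.const_mul _).integrableOn_Icc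
        (.of_forall fun s => mul_nonneg (by norm_num)
          (mul_nonneg (coneCutoff_nonneg R t s) (W.eC_nonneg T.V_pos t s)))
        (Icc_subset_Icc (by linarith) (by linarith)).eventuallyLE

/-- Local decay. The bound on `u` near the photon sphere is interpolated with the energy of
`Δ² u`, the parameter `t ^ (3 / 4)` being chosen so that all errors are integrable in time. -/
lemma exists_hasDerivAt_local_decay (T : TrappingPotential V g q q₀ B) {ε v S R t F : ℝ}
    {W₄ : ReducedWave V} (hε : 0 < ε) (hε1 : ε ≤ 1 / 16) (hε2 : ε ≤ q₀ / 4) (hv : 0 < v)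
    (hvS : ∀ s, |s| ≤ S → v ≤ V s) (hSt : 2 * S ≤ t) (ht : 0 < t) (hR : 0 < R)
    (hSR : S ≤ R / 4) (htR : t ≤ R / 4)
    (hint : ∀ t s A, 0 < A → W.n t s ≤ A * W.z t s + (A ^ 3)⁻¹ * W₄.z t s)
    (hF : W₄.coneEnergy R 0 ≤ F) :
    ∃ d, HasDerivAt (fun τ => τ ^ (-17 / 4 : ℝ) * W.moraIntegral V g R τ) d t ∧
      t * ∫ s in Icc (-S) S, W.n t s ≤ -(4 / (ε * v ^ 2)) * d
        + (4 / (ε * v ^ 2) * (520 * (2 * B + 1)) + 8 / v) * t ^ (-5 / 4 : ℝ)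
          * (W.coneCharge R t + F) := by
  have hB := T.B_pos
  obtain ⟨d, hd, hd1⟩ := exists_hasDerivAt_moraIntegral (W := W) T hε.le hε1 hε2 hv.le hvS hSt ht
    hR htR
  have hp := Real.hasDerivAt_rpow_const (x := t) (p := (-17 / 4 : ℝ)) (Or.inl ht.ne')
  rw [show (-17 / 4 : ℝ) - 1 = -21 / 4 by norm_num] at hp
  refine ⟨_, hp.mul hd, ?_⟩
  have rp : ∀ (x y : ℝ) (k : ℕ), x + k = y → t ^ x * t ^ k = t ^ y := by
    intro x y k h
    rw [← Real.rpow_natCast, ← Real.rpow_add ht, h]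
  set w := t ^ (-5 / 4 : ℝ) with hw
  have hw0 : 0 < w := Real.rpow_pos_of_pos ht _
  have e1 : t ^ (-17 / 4 : ℝ) * t ^ 3 = w := rp _ _ 3 (by norm_num)
  have e2 : t ^ (-21 / 4 : ℝ) * t ^ 4 = w := rp _ _ 4 (by norm_num)
  have e3 : t * t ^ (3 / 4 : ℝ) = w * t ^ 3 := by
    rw [rp (-5 / 4) (7 / 4) 3 (by norm_num), mul_comm, ← rp (3 / 4) (7 / 4) 1 (by norm_num),
      pow_one]
  have e4 : t * ((t ^ (3 / 4 : ℝ)) ^ 3)⁻¹ = w := by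
    rw [← Real.rpow_natCast, ← Real.rpow_mul ht.le, ← Real.rpow_neg ht.le, mul_comm, hw,
      ← rp (-9 / 4) (-5 / 4) 1 (by norm_num), pow_one]
    norm_num
  set p := t ^ (-17 / 4 : ℝ) with hpdef
  have hp0 : 0 < p := Real.rpow_pos_of_pos ht _
  set p' := t ^ (-21 / 4 : ℝ) with hp'def
  have hp'0 : 0 < p' := Real.rpow_pos_of_pos ht _
  set E := W.coneCharge R t with hE
  have hE0 : 0 ≤ E := coneCharge_nonneg T.V_pos R t
  set Z := ∫ s in Icc (-S) S, W.z t s with hZ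
  have hI := abs_le.1 (abs_moraIntegral_le (W := W) T ht.le hR htR)
  have s1 : ε * v ^ 2 / 4 * (w * t ^ 3 * Z)
      ≤ -(-17 / 4 * p' * W.moraIntegral V g R t + p * d) + 520 * (2 * B + 1) * w * E := by
    have k1 := mul_le_mul_of_nonneg_left hd1 hp0.le
    have k2 := mul_le_mul_of_nonneg_left hI.1 hp'0.le
    have k3 : p * (ε * v ^ 2 * (t ^ 6 / 4) * Z) = ε * v ^ 2 / 4 * (w * t ^ 3 * Z) := by
      rw [← e1]; ring
    have k4 : p * (-d + 384 * (2 * B + 1) * t ^ 3 * E)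
        = -(p * d) + 384 * (2 * B + 1) * w * E := by
      rw [← e1]; ring
    have k5 : p' * -(32 * (2 * B + 1) * t ^ 4 * E) = -(32 * (2 * B + 1) * w * E) := by
      rw [← e2]; ring
    rw [k3, k4] at k1
    rw [k5] at k2
    linarith
  have s2 : w * t ^ 3 * Z ≤ -(4 / (ε * v ^ 2)) * (-17 / 4 * p' * W.moraIntegral V g R t + p * d)
      + 4 / (ε * v ^ 2) * (520 * (2 * B + 1)) * w * E := by
    have k1 := mul_le_mul_of_nonneg_left s1 (by positivity : 0 ≤ 4 / (ε * v ^ 2))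
    have k2 : 4 / (ε * v ^ 2) * (ε * v ^ 2 / 4 * (w * t ^ 3 * Z)) = w * t ^ 3 * Z := by
      field_simp
    rw [k2] at k1
    linarith
  have s3 : ∫ s in Icc (-S) S, W₄.z t s ≤ 8 / v * F := by
    calc ∫ s in Icc (-S) S, W₄.z t s ≤ ∫ s in Icc (-S) S, 2 * W₄.n t s :=
          setIntegral_mono_on (continuous_slice W₄.cont_z t).integrableOn_Icc
            ((continuous_slice W₄.cont_n t).const_mul _).integrableOn_Icc measurableSet_Icc
            fun s _ => W₄.poincare t s
      _ = 2 * ∫ s in Icc (-S) S, W₄.n t s := integral_const_mul _ _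
      _ ≤ 2 * (4 / v * F) := by
          have k1 := integral_n_le_coneEnergy (W := W₄) T hv hvS hR hSR htR
          have k2 := coneEnergy_le (W := W₄) T ht.le (show t ≤ R by linarith)
          have k3 : 4 / v * W₄.coneEnergy R t ≤ 4 / v * F := by
            gcongr
            exact k2.trans hF
          linarith
      _ = 8 / v * F := by ring
  have s4 : t * ∫ s in Icc (-S) S, W.n t s
      ≤ w * t ^ 3 * Z + w * ∫ s in Icc (-S) S, W₄.z t s := by
    rw [hZ, ← integral_const_mul, ← integral_const_mul, ← integral_const_mul,
      ← integral_add ((continuous_slice W.cont_z t).const_mul _).integrableOn_Icc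
        ((continuous_slice W₄.cont_z t).const_mul _).integrableOn_Icc]
    refine setIntegral_mono_on ((continuous_slice W.cont_n t).const_mul _).integrableOn_Icc
      (((continuous_slice W.cont_z t).const_mul _).add
        ((continuous_slice W₄.cont_z t).const_mul _)).integrableOn_Icc measurableSet_Icc
      fun s _ => ?_
    have k1 := mul_le_mul_of_nonneg_left
      (hint t s (t ^ (3 / 4 : ℝ)) (Real.rpow_pos_of_pos ht _)) ht.le
    calc t * W.n t s ≤ _ := k1
      _ = t * t ^ (3 / 4 : ℝ) * W.z t s + t * ((t ^ (3 / 4 : ℝ)) ^ 3)⁻¹ * W₄.z t s := by ring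
      _ = _ := by rw [e3, e4]
  have s5 := mul_le_mul_of_nonneg_left s3 hw0.le
  have hF0 : 0 ≤ F := le_trans (integral_nonneg fun s =>
    mul_nonneg (coneCutoff_nonneg R 0 s) (W₄.e_nonneg T.V_pos 0 s)) hF
  have r1 : 0 ≤ 4 / (ε * v ^ 2) * (520 * (2 * B + 1)) * w * F := by positivity
  have r2 : 0 ≤ 8 / v * w * E := by positivity
  linarith

/-- The uniform bound on the conformal charge and on the local energy integrated in time. -/
theorem exists_conformal_bound (T : TrappingPotential V g q q₀ B) (S₁ : ℝ) :
    ∃ C : ℝ, 0 < C ∧ ∀ W W₄ : ReducedWave V,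
      (∀ t s A, 0 < A → W.n t s ≤ A * W.z t s + (A ^ 3)⁻¹ * W₄.z t s) →
      ∀ E₀ F : ℝ, (∀ R, ∫ s in Icc (-R) R, W.eC 0 s ≤ E₀) →
        (∀ R, ∫ s in Icc (-R) R, W₄.e 0 s ≤ F) →
        ∀ t, 0 ≤ t → (∀ ρ, ∫ s in Icc (-ρ) ρ, W.eC t s ≤ C * (E₀ + F)) ∧
          ∫ τ in 0..t, τ * ∫ s in Icc (-S₁) S₁, W.n τ s ≤ C * (E₀ + F) := by
  obtain ⟨S₀, hS₀, hfar⟩ := T.exists_radius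
  set S := max S₀ S₁ with hS
  have hS0 : 0 < S := lt_max_of_lt_left hS₀
  have hfar' : ∀ s, S ≤ |s| → 2 ≤ s * g s * q s := fun s hs =>
    hfar s ((le_max_left _ _).trans hs)
  obtain ⟨v, hv, hvS⟩ : ∃ v, 0 < v ∧ ∀ s, |s| ≤ S → v ≤ V s := by
    obtain ⟨x, _, hx⟩ := (isCompact_Icc (a := -S) (b := S)).exists_isMinOn
      ⟨0, by simp [hS0.le]⟩ T.cont_V.continuousOn
    exact ⟨V x, T.V_pos x, fun s hs => hx (abs_le.1 hs)⟩
  have hB := T.B_pos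
  have hq0 := T.q₀_pos
  set ε := min (1 / 16) (q₀ / 4) with hεdef
  have hε : 0 < ε := lt_min (by norm_num) (by positivity)
  have hε1 : ε ≤ 1 / 16 := min_le_left _ _
  have hε2 : ε ≤ q₀ / 4 := min_le_right _ _
  set K₁ := 4 / (ε * v ^ 2) with hK₁
  set K₃ := 32 * (2 * B + 1) with hK₃
  obtain ⟨t₁, hsmall, ht₁⟩ : ∃ t₁ : ℝ, 2 * B * K₁ * K₃ * t₁ ^ (-1 / 4 : ℝ) ≤ 1 / 2 ∧
      max 1 (2 * S) ≤ t₁ := by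
    have h1 := (tendsto_rpow_neg_atTop (y := 1 / 4) (by norm_num)).const_mul (2 * B * K₁ * K₃)
    rw [mul_zero] at h1
    obtain ⟨x, hx1, hx2⟩ := ((h1.eventually (ge_mem_nhds (by norm_num : (0 : ℝ) < 1 / 2))).and
      (Filter.eventually_ge_atTop (max 1 (2 * S)))).exists
    exact ⟨x, by rwa [show (-1 / 4 : ℝ) = -(1 / 4) by norm_num], hx2⟩
  have ht₁1 : 1 ≤ t₁ := (le_max_left _ _).trans ht₁
  have ht₁S : 2 * S ≤ t₁ := (le_max_right _ _).trans ht₁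
  obtain ⟨C, hC, hG⟩ := exists_gronwall_bound (L := 2 * B) (L₁ := t₁ * (4 / v)) (K₁ := K₁)
    (K₂ := K₁ * (520 * (2 * B + 1)) + 8 / v) (K₃ := K₃) (by positivity) (by positivity)
    (by positivity) (by positivity) (by positivity) ht₁1 hsmall
  refine ⟨4 * C, by positivity, ?_⟩
  intro W W₄ hint E₀ F hE₀ hF t ht
  -- a bound in each cone of large radius `R`, with a constant that does not depend on `R`
  have main : ∀ R, 0 < R → t ≤ R / 4 → S ≤ R / 4 → W.coneCharge R t ≤ C * (E₀ + F) ∧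
      ∫ τ in 0..t, τ * ∫ s in Icc (-S) S, W.n τ s ≤ C * (E₀ + F) := by
    intro R hR htR hSR
    have hF' : W₄.coneEnergy R 0 ≤ F := by
      refine le_trans (setIntegral_mono_on ((continuous_slice (continuous_coneCutoff R) 0).mul
        (continuous_slice (cont_e T) 0)).integrableOn_Icc
        (continuous_slice (cont_e T) 0).integrableOn_Icc measurableSet_Icc fun s _ => ?_) (hF R)
      exact mul_le_of_le_one_left (W₄.e_nonneg T.V_pos 0 s) (coneCutoff_le_one hR le_rfl hR.le)
    have hE' : W.coneCharge R 0 ≤ E₀ := by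
      refine le_trans (setIntegral_mono_on ((continuous_slice (continuous_coneCutoff R) 0).mul
        (continuous_slice (cont_eC T) 0)).integrableOn_Icc
        (continuous_slice (cont_eC T) 0).integrableOn_Icc measurableSet_Icc fun s _ => ?_) (hE₀ R)
      exact mul_le_of_le_one_left (W.eC_nonneg T.V_pos 0 s) (coneCutoff_le_one hR le_rfl hR.le)
    have hF0 : 0 ≤ F := le_trans (integral_nonneg fun s =>
      mul_nonneg (coneCutoff_nonneg R 0 s) (W₄.e_nonneg T.V_pos 0 s)) hF'
    have res := hG t F (W.coneCharge R) (fun τ => τ ^ (-17 / 4 : ℝ) * W.moraIntegral V g R τ)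
      (fun τ => ∫ s in Icc (-S) S, W.n τ s) ht hF0
      (continuous_parametric_integral_of_continuous W.cont_n isCompact_Icc)
      (fun τ _ => coneCharge_nonneg T.V_pos R τ)
      (fun τ hτ => exists_hasDerivAt_coneCharge T hS0 hfar' (by linarith) hτ.1
        (by linarith [hτ.2]))
      (fun τ hτ hτ1 => ?_) (fun τ hτ => ?_) (fun τ hτ => ?_)
    · have hle : C * (W.coneCharge R 0 + F) ≤ C * (E₀ + F) := by gcongr
      exact ⟨res.1.trans hle, res.2.trans hle⟩
    · have k1 := integral_n_le_coneEnergy (W := W) T hv hvS hR hSR (hτ.2.trans htR)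
      have k2 := coneEnergy_le_coneCharge (W := W) T R τ
      have k3 := coneCharge_nonneg (W := W) T.V_pos R τ
      have hτ0 := hτ.1
      calc τ * ∫ s in Icc (-S) S, W.n τ s ≤ τ * (4 / v * W.coneCharge R τ) := by
            gcongr
            exact k1.trans (by gcongr)
        _ ≤ t₁ * (4 / v * W.coneCharge R τ) := by gcongr
        _ = _ := by ring
    · exact exists_hasDerivAt_local_decay T hε hε1 hε2 hv hvS (ht₁S.trans hτ.1)
        (by linarith [hτ.1]) hR hSR (hτ.2.trans htR) hint hF'
    · have hτ0 : 0 < τ := by linarith [hτ.1]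
      have k1 := abs_moraIntegral_le (W := W) T hτ0.le hR (hτ.2.trans htR)
      have hp := (Real.rpow_pos_of_pos hτ0 (-17 / 4)).le
      have e1 : τ ^ (-1 / 4 : ℝ) = τ ^ (-17 / 4 : ℝ) * τ ^ 4 := by
        rw [← Real.rpow_natCast, ← Real.rpow_add hτ0]
        norm_num
      rw [abs_mul, abs_of_nonneg hp, e1]
      calc _ ≤ τ ^ (-17 / 4 : ℝ) * (32 * (2 * B + 1) * τ ^ 4 * W.coneCharge R τ) := by gcongr
        _ = _ := by rw [hK₃]; ring
  have hmax : ∀ ρ, ∃ R, 0 < R ∧ t ≤ R / 4 ∧ S ≤ R / 4 ∧ ρ ≤ R / 4 := fun ρ =>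
    ⟨4 * (max t (max S ρ)), by
      have : 0 < max t (max S ρ) := lt_max_of_lt_right (lt_max_of_lt_left hS0)
      positivity, by
      rw [mul_div_cancel_left₀ _ (by norm_num)]
      exact ⟨le_max_left _ _, (le_max_left _ _).trans (le_max_right _ _),
        (le_max_right _ _).trans (le_max_right _ _)⟩⟩
  constructor
  · intro ρ
    obtain ⟨R, hR, htR, hSR, hρR⟩ := hmax ρ
    have k1 := integral_eC_le_coneCharge (W := W) T hR hρR htR
    have k2 := (main R hR htR hSR).1
    linarith
  · obtain ⟨R, hR, htR, hSR, -⟩ := hmax 0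
    have k2 := main R hR htR hSR
    have k0 := coneCharge_nonneg (W := W) T.V_pos R t
    have k3 : 0 ≤ C * (E₀ + F) := k0.trans k2.1
    have cN : ∀ S' : ℝ, Continuous fun τ => τ * ∫ s in Icc (-S') S', W.n τ s := fun S' =>
      continuous_id.mul (continuous_parametric_integral_of_continuous W.cont_n isCompact_Icc)
    calc ∫ τ in 0..t, τ * ∫ s in Icc (-S₁) S₁, W.n τ s
        ≤ ∫ τ in 0..t, τ * ∫ s in Icc (-S) S, W.n τ s := by
          refine intervalIntegral.integral_mono_on ht ((cN S₁).intervalIntegrable _ _)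
            ((cN S).intervalIntegrable _ _) fun τ hτ => mul_le_mul_of_nonneg_left ?_ hτ.1
          have hSS : S₁ ≤ S := le_max_right _ _
          exact setIntegral_mono_set (continuous_slice W.cont_n τ).integrableOn_Icc
            (.of_forall fun s => W.n_nonneg τ s)
            (Icc_subset_Icc (by linarith) hSS).eventuallyLE
      _ ≤ 4 * C * (E₀ + F) := by linarith [k2.2]

end ReducedWave

end

/-! ### From the reduced problem to solutions -/

section

instance : SFinite sliceMeasure := by unfold sliceMeasure; infer_instance

instance : IsFiniteMeasureOnCompacts sliceMeasure := by unfold sliceMeasure; infer_instance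

open Filter in
/-- A nonnegative continuous density on a slice is integrable as soon as its integrals over
bounded parts of the slice are bounded. -/
lemma integrable_slice_of_bounded {f : ℝ × S2 → ℝ} (hf : Continuous f) (h0 : ∀ p, 0 ≤ f p)
    {G : ℝ → ℝ} (hG : Continuous G) (hfG : ∀ s, ∫ w, f (s, w) ∂area = G s) {K : ℝ}
    (hK : ∀ ρ, ∫ s in Icc (-ρ) ρ, G s ≤ K) :
    Integrable f sliceMeasure ∧ ∫ p, f p ∂sliceMeasure ≤ K := by
  have hG0 : ∀ s, 0 ≤ G s := fun s => by
    rw [← hfG]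
    exact integral_nonneg fun w => h0 _
  have hint : ∀ ρ : ℝ, 0 ≤ ρ → ∫ s in (-ρ)..ρ, G s ≤ K := fun ρ hρ => by
    rw [intervalIntegral.integral_of_le (by linarith), ← integral_Icc_eq_integral_Ioc]
    exact hK ρ
  have iG : Integrable G := by
    refine integrable_of_intervalIntegral_norm_bounded K (a := fun ρ : ℝ => -ρ) (b := fun ρ => ρ)
      (l := atTop) (fun ρ => hG.integrableOn_Ioc) tendsto_neg_atTop_atBot tendsto_id ?_
    filter_upwards [eventually_ge_atTop 0] with ρ hρ
    simpa only [Real.norm_of_nonneg (hG0 _)] using hint ρ hρ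
  have hle : ∫ s, G s ≤ K := by
    refine le_of_tendsto (intervalIntegral_tendsto_integral iG tendsto_neg_atTop_atBot tendsto_id) ?_
    filter_upwards [eventually_ge_atTop 0] with ρ hρ using hint ρ hρ
  have i1 : Integrable f sliceMeasure := by
    refine (integrable_prod_iff hf.aestronglyMeasurable).2 ⟨.of_forall fun s =>
      integrable_area (hf.comp (Continuous.prodMk_right s)), ?_⟩
    refine iG.congr (.of_forall fun s => ?_)
    simp only [Real.norm_of_nonneg (h0 _), hfG]
  refine ⟨i1, ?_⟩
  unfold sliceMeasure at i1 ⊢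
  rw [integral_prod _ i1]
  simpa only [hfG] using hle

lemma setIntegral_le_of_integrable_slice {f : ℝ × S2 → ℝ} (h0 : ∀ p, 0 ≤ f p)
    {G : ℝ → ℝ} (hfG : ∀ s, ∫ w, f (s, w) ∂area = G s) (hf : Integrable f sliceMeasure) (ρ : ℝ) :
    ∫ s in Icc (-ρ) ρ, G s ≤ ∫ p, f p ∂sliceMeasure := by
  have hG0 : ∀ s, 0 ≤ G s := fun s => by
    rw [← hfG]
    exact integral_nonneg fun w => h0 _
  unfold sliceMeasure at hf ⊢
  rw [integral_prod _ hf]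
  simp only [hfG]
  have := hf.integral_prod_left
  simp only [hfG] at this
  exact setIntegral_le_integral this (.of_forall hG0)

variable {M Q Λ : ℝ} {u : ℝ → ℝ → S2 → ℂ}

lemma SmoothField.continuous_sphGradSq (hu : SmoothField u) :
    Continuous fun p : (ℝ × ℝ) × S2 => sphGradSq (u p.1.1 p.1.2) p.2 := by
  have e : ∀ (p : (ℝ × ℝ) × S2), sphGradSq (u p.1.1 p.1.2) p.2
      = ∑ i, ‖pd (xDir i) (fieldExt u) (p.1, (p.2 : E3))‖ ^ 2 := by
    intro p
    unfold sphGradSq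
    refine Finset.sum_congr rfl fun i _ => ?_
    rw [show pd (xDir i) (fieldExt u) (p.1, (p.2 : E3)) = _ from (fderiv_slice (q := p.1)
      (hu.smoothOff.differentiableAt (p := (p.1, (p.2 : E3))) (S2.coe_ne_zero p.2))
      (basisVec i)).symm]
    rfl
  simp only [e]
  exact continuous_finsetSum _ fun i _ =>
    ((hu.smoothOff.pd (xDir i)).smoothField.continuous).norm.pow 2

lemma SmoothField.continuous_energyDensity (hV : Continuous (potential M Q Λ))
    (hu : SmoothField u) (t : ℝ) :
    Continuous fun p : ℝ × S2 => energyDensity M Q Λ u t p.1 p.2 := by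
  have c : Continuous fun p : ℝ × S2 => (((t, p.1), p.2) : (ℝ × ℝ) × S2) := by fun_prop
  have h2 : Continuous fun p : ℝ × S2 => RNdS.dt u t p.1 p.2 := hu.dt.continuous.comp c
  have h3 : Continuous fun p : ℝ × S2 => RNdS.dr u t p.1 p.2 := hu.dr.continuous.comp c
  have h4 := hu.continuous_sphGradSq.comp c
  simp only [Function.comp_def] at h4
  have h5 : Continuous fun p : ℝ × S2 => potential M Q Λ p.1 := hV.comp continuous_fst
  unfold energyDensity
  exact ((h2.norm.pow 2).add (h3.norm.pow 2)).add (h5.mul h4)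

lemma SmoothField.continuous_conformalDensity (hV : Continuous (potential M Q Λ))
    (hu : SmoothField u) (t : ℝ) :
    Continuous fun p : ℝ × S2 => conformalDensity M Q Λ u t p.1 p.2 := by
  have c : Continuous fun p : ℝ × S2 => (((t, p.1), p.2) : (ℝ × ℝ) × S2) := by fun_prop
  have h1 := hu.continuous_energyDensity hV t
  have h2 : Continuous fun p : ℝ × S2 => RNdS.dt u t p.1 p.2 := hu.dt.continuous.comp c
  have h3 : Continuous fun p : ℝ × S2 => RNdS.dr u t p.1 p.2 := hu.dr.continuous.comp c
  have h4 : Continuous fun p : ℝ × S2 =>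
      (RNdS.dt u t p.1 p.2 * (starRingEnd ℂ) (RNdS.dr u t p.1 p.2)).re :=
    Complex.continuous_re.comp (h2.mul (Complex.continuous_conj.comp h3))
  have h5 : Continuous fun p : ℝ × S2 => 1 / 2 * (t ^ 2 + p.1 ^ 2) := by fun_prop
  have h6 : Continuous fun p : ℝ × S2 => 2 * t * p.1 := by fun_prop
  unfold conformalDensity
  exact ((h5.mul h1).add (h6.mul h4)).add h1

lemma energyDensity_nonneg (hV : ∀ s, 0 < potential M Q Λ s) (u : ℝ → ℝ → S2 → ℂ) (t s : ℝ)
    (w : S2) : 0 ≤ energyDensity M Q Λ u t s w := by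
  have := mul_nonneg (hV s).le (sphGradSq_nonneg (u t s) w)
  unfold energyDensity
  positivity

lemma conformalDensity_nonneg (hV : ∀ s, 0 < potential M Q Λ s) (u : ℝ → ℝ → S2 → ℂ) (t s : ℝ)
    (w : S2) : 0 ≤ conformalDensity M Q Λ u t s w := by
  have hn := mul_nonneg (hV s).le (sphGradSq_nonneg (u t s) w)
  set x := dt u t s w
  set y := dr u t s w
  have h1 : |(x * (starRingEnd ℂ) y).re| ≤ ‖x‖ * ‖y‖ := by
    refine (Complex.abs_re_le_norm _).trans ?_
    rw [norm_mul, Complex.norm_conj]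
  have h2 : |2 * t * s * (x * (starRingEnd ℂ) y).re| ≤ 1 / 2 * (t ^ 2 + s ^ 2)
      * (‖x‖ ^ 2 + ‖y‖ ^ 2) := by
    have e1 : |2 * t * s| ≤ t ^ 2 + s ^ 2 := by
      rw [abs_le]
      constructor <;> nlinarith [sq_nonneg (t + s), sq_nonneg (t - s)]
    have e2 : ‖x‖ * ‖y‖ ≤ 1 / 2 * (‖x‖ ^ 2 + ‖y‖ ^ 2) := by
      nlinarith [sq_nonneg (‖x‖ - ‖y‖)]
    rw [abs_mul]
    calc _ ≤ (t ^ 2 + s ^ 2) * (1 / 2 * (‖x‖ ^ 2 + ‖y‖ ^ 2)) :=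
          mul_le_mul e1 (h1.trans e2) (abs_nonneg _) (by positivity)
      _ = _ := by ring
  have h3 := (abs_le.1 h2).1
  have h4 : 0 ≤ 1 / 2 * (t ^ 2 + s ^ 2) * (potential M Q Λ s * sphGradSq (u t s) w) := by positivity
  have h5 := energyDensity_nonneg hV u t s w
  unfold conformalDensity
  have e : energyDensity M Q Λ u t s w
    = ‖x‖ ^ 2 + ‖y‖ ^ 2 + potential M Q Λ s * sphGradSq (u t s) w := rfl
  rw [e] at h5 ⊢
  linarith

lemma integral_energyDensity (hu : SmoothField u) (h : WaveLike M Q Λ u) (h0 : NoZeroMode u)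
    (t s : ℝ) : ∫ w, energyDensity M Q Λ u t s w ∂area = (reducedWave hu h h0).e t s := by
  have i1 : Integrable (fun w => ‖dt u t s w‖ ^ 2) area :=
    integrable_area ((hu.dt.continuous_slice t s).norm.pow 2)
  have i2 : Integrable (fun w => ‖dr u t s w‖ ^ 2) area :=
    integrable_area ((hu.dr.continuous_slice t s).norm.pow 2)
  have i3 : Integrable (fun w => potential M Q Λ s * sphGradSq (u t s) w) area :=
    (integrable_area (hu.smoothS t s).continuous_sphGradSq).const_mul _
  have i12 : Integrable (fun w => ‖dt u t s w‖ ^ 2 + ‖dr u t s w‖ ^ 2) area := i1.add i2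
  unfold energyDensity
  rw [integral_add i12 i3, integral_add i1 i2, integral_const_mul, integral_sphGradSq hu,
    ← ip_self, ← ip_self]
  rfl

lemma integral_conformalDensity (hu : SmoothField u) (h : WaveLike M Q Λ u) (h0 : NoZeroMode u)
    (t s : ℝ) : ∫ w, conformalDensity M Q Λ u t s w ∂area = (reducedWave hu h h0).eC t s := by
  have ie : Integrable (fun w => energyDensity M Q Λ u t s w) area := by
    refine integrable_area ?_
    exact (((hu.dt.continuous_slice t s).norm.pow 2).add
      ((hu.dr.continuous_slice t s).norm.pow 2)).add
      ((hu.smoothS t s).continuous_sphGradSq.const_mul _)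
  have e : ∀ w, (dt u t s w * (starRingEnd ℂ) (dr u t s w)).re
      = inner ℝ (dt u t s w) (dr u t s w) := by
    intro w
    rw [Complex.inner]
    simp
    ring
  have i1 : Integrable (fun w => 1 / 2 * (t ^ 2 + s ^ 2) * energyDensity M Q Λ u t s w) area :=
    ie.const_mul _
  have i2 : Integrable (fun w => 2 * t * s * inner ℝ (dt u t s w) (dr u t s w)) area :=
    (integrable_inner hu.dt hu.dr t s).const_mul _
  have i12 : Integrable (fun w => 1 / 2 * (t ^ 2 + s ^ 2) * energyDensity M Q Λ u t s w
    + 2 * t * s * inner ℝ (dt u t s w) (dr u t s w)) area := i1.add i2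
  unfold conformalDensity
  simp only [e]
  rw [integral_add i12 ie, integral_add i1 i2, integral_const_mul, integral_const_mul,
    integral_energyDensity hu h h0]
  rfl

/-- The estimates of the reduced problem, stated for the solution itself. -/
lemma exists_reduced_bound (hadm : Admissible M Q Λ) (S : ℝ) :
    ∃ C : ℝ, 0 < C ∧ ∀ (u : ℝ → ℝ → S2 → ℂ) (hu : SmoothField u) (h : WaveLike M Q Λ u)
      (h0 : NoZeroMode u), FiniteConformalCharge M Q Λ u 0 →
      FiniteEnergy M Q Λ (lap (lap u)) 0 → ∀ t, 0 ≤ t →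
        (∀ ρ, ∫ s in Icc (-ρ) ρ, (reducedWave hu h h0).eC t s
          ≤ 2 * C * (conformalCharge M Q Λ u 0 + energy M Q Λ (lap (lap u)) 0)) ∧
        ∫ τ in 0..t, τ * ∫ s in Icc (-S) S, -ip u (lap u) τ s
          ≤ 2 * C * (conformalCharge M Q Λ u 0 + energy M Q Λ (lap (lap u)) 0) := by
  obtain ⟨g, q, q₀, B, T⟩ := hadm.exists_trappingPotential
  obtain ⟨C, hC, hb⟩ := ReducedWave.exists_conformal_bound T S
  refine ⟨C, hC, fun u hu h h0 hfin hfin4 t ht => ?_⟩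
  have hu2 := hu.lap.lap
  have hw2 : WaveLike M Q Λ (lap (lap u)) := WaveLike.lap hu.lap (WaveLike.lap hu h)
  have hz2 : NoZeroMode (lap (lap u)) := NoZeroMode.lap hu.lap
  have hE := fun ρ => setIntegral_le_of_integrable_slice
    (fun p => conformalDensity_nonneg T.V_pos u 0 p.1 p.2)
    (fun s => integral_conformalDensity hu h h0 0 s) hfin ρ
  have hF := fun ρ => setIntegral_le_of_integrable_slice
    (fun p => energyDensity_nonneg T.V_pos (lap (lap u)) 0 p.1 p.2)
    (fun s => integral_energyDensity hu2 hw2 hz2 0 s) hfin4 ρ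
  have hint : ∀ t s A, 0 < A → (reducedWave hu h h0).n t s
      ≤ A * (reducedWave hu h h0).z t s + (A ^ 3)⁻¹ * (reducedWave hu2 hw2 hz2).z t s :=
    fun t s A hA => ip_lap_interpolation hu t s hA
  have key := hb (reducedWave hu h h0) (reducedWave hu2 hw2 hz2) hint _ _ hE hF t ht
  -- the factor `2` undoes the `1 / 2` in the definitions of energy and conformal charge
  have e : C * (∫ p : ℝ × S2, conformalDensity M Q Λ u 0 p.1 p.2 ∂sliceMeasure
      + ∫ p : ℝ × S2, energyDensity M Q Λ (lap (lap u)) 0 p.1 p.2 ∂sliceMeasure)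
      = 2 * C * (conformalCharge M Q Λ u 0 + energy M Q Λ (lap (lap u)) 0) := by
    unfold conformalCharge energy
    ring
  rw [e] at key
  exact key

lemma continuous_localized (hu : SmoothField u) {χ : ℝ → ℝ} (hχ : Continuous χ) :
    Continuous fun p : ℝ × ℝ × S2 => p.1 * χ p.2.1 * sphGradSq (u p.1 p.2.1) p.2.2 := by
  have c1 : Continuous fun p : ℝ × ℝ × S2 => (((p.1, p.2.1), p.2.2) : (ℝ × ℝ) × S2) := by fun_prop
  have c2 := hu.continuous_sphGradSq.comp c1
  simp only [Function.comp_def] at c2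
  have c3 : Continuous fun p : ℝ × ℝ × S2 => χ p.2.1 := by fun_prop
  exact (continuous_fst.mul c3).mul c2

lemma integrable_slice_localized (hu : SmoothField u) {χ : ℝ → ℝ} (hχ : Continuous χ) {S : ℝ}
    (hχS : ∀ s, S < |s| → χ s = 0) (τ : ℝ) :
    Integrable (fun y : ℝ × S2 => τ * χ y.1 * sphGradSq (u τ y.1) y.2) sliceMeasure := by
  have c := (continuous_localized hu hχ).comp (Continuous.prodMk_right τ)
  simp only [Function.comp_def] at c
  refine c.integrable_of_hasCompactSupport ?_
  refine HasCompactSupport.intro (isCompact_Icc.prod isCompact_univ :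
    IsCompact (Icc (-S) S ×ˢ (univ : Set S2))) fun p hp => ?_
  rw [hχS _ (lt_of_not_ge fun hle => hp ⟨abs_le.1 hle, mem_univ _⟩), mul_zero, zero_mul]

lemma integral_slice_localized_le (hu : SmoothField u) {χ : ℝ → ℝ} (hχ : Continuous χ) {c S : ℝ}
    (hχc : ∀ s, |χ s| ≤ c) (hχS : ∀ s, S < |s| → χ s = 0) {τ : ℝ} (hτ : 0 ≤ τ) :
    ∫ y : ℝ × S2, ‖τ * χ y.1 * sphGradSq (u τ y.1) y.2‖ ∂sliceMeasure
      ≤ c * (τ * ∫ s in Icc (-S) S, -ip u (lap u) τ s) := by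
  have i1 := (integrable_slice_localized hu hχ hχS τ).norm
  unfold sliceMeasure at i1 ⊢
  rw [integral_prod _ i1]
  have e1 : ∀ s, ∫ w, ‖τ * χ s * sphGradSq (u τ s) w‖ ∂area
      = τ * |χ s| * -ip u (lap u) τ s := by
    intro s
    rw [← integral_sphGradSq hu, ← integral_const_mul]
    refine integral_congr_ae (.of_forall fun w => ?_)
    simp only [norm_mul, Real.norm_eq_abs, abs_of_nonneg hτ, abs_of_nonneg (sphGradSq_nonneg _ w)]
  simp only [e1]
  rw [← setIntegral_eq_integral_of_forall_compl_eq_zero (s := Icc (-S) S) fun s hs => by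
    rw [hχS s (lt_of_not_ge fun hle => hs (abs_le.1 hle)), abs_zero, mul_zero, zero_mul]]
  have cn : Continuous fun s => -ip u (lap u) τ s :=
    (continuous_slice (continuous_ip hu hu.lap) τ).neg
  rw [← mul_assoc, ← integral_const_mul]
  refine setIntegral_mono_on ((continuous_const.mul hχ.abs).mul cn).integrableOn_Icc
    (cn.const_mul _).integrableOn_Icc measurableSet_Icc fun s _ => ?_
  have hn : 0 ≤ -ip u (lap u) τ s := by
    rw [← integral_sphGradSq hu]
    exact integral_nonneg fun w => sphGradSq_nonneg _ w
  have := hχc s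
  calc τ * |χ s| * -ip u (lap u) τ s ≤ τ * c * -ip u (lap u) τ s := by gcongr
    _ = _ := by ring

open Filter in
/-- Integrability in space-time of a localised derivative, from bounds on finite time intervals. -/
lemma integrable_future (hu : SmoothField u) {χ : ℝ → ℝ} (hχ : Continuous χ) {c S K : ℝ}
    (hc : 0 ≤ c) (hχc : ∀ s, |χ s| ≤ c) (hχS : ∀ s, S < |s| → χ s = 0)
    (hK : ∀ t, 0 ≤ t → ∫ τ in 0..t, τ * ∫ s in Icc (-S) S, -ip u (lap u) τ s ≤ K) :
    Integrable (fun p : ℝ × ℝ × S2 => p.1 * χ p.2.1 * sphGradSq (u p.1 p.2.1) p.2.2)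
      futureMeasure ∧
    ∫ p : ℝ × ℝ × S2, p.1 * χ p.2.1 * sphGradSq (u p.1 p.2.1) p.2.2 ∂futureMeasure ≤ c * K := by
  set f : ℝ × ℝ × S2 → ℝ := fun p => p.1 * χ p.2.1 * sphGradSq (u p.1 p.2.1) p.2.2 with hf
  have cf : Continuous f := continuous_localized hu hχ
  have cn : Continuous (Function.uncurry fun τ s => -ip u (lap u) τ s) :=
    (continuous_ip hu hu.lap).neg
  have hn0 : ∀ τ s, 0 ≤ -ip u (lap u) τ s := fun τ s => by
    rw [← integral_sphGradSq hu]
    exact integral_nonneg fun w => sphGradSq_nonneg _ w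
  set h : ℝ → ℝ := fun τ => τ * ∫ s in Icc (-S) S, -ip u (lap u) τ s with hh
  have ch : Continuous h :=
    continuous_id.mul (continuous_parametric_integral_of_continuous cn isCompact_Icc)
  have hh0 : ∀ τ, 0 ≤ τ → 0 ≤ h τ := fun τ hτ =>
    mul_nonneg hτ (integral_nonneg fun s => hn0 τ s)
  have ih : IntegrableOn h (Ioi 0) := by
    refine integrableOn_Ioi_of_intervalIntegral_norm_bounded K 0 (b := fun t : ℝ => t) (l := atTop)
      (fun t => ch.integrableOn_Ioc) tendsto_id ?_
    filter_upwards [eventually_ge_atTop 0] with t ht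
    refine le_trans (le_of_eq ?_) (hK t ht)
    refine intervalIntegral.integral_congr fun τ hτ => ?_
    rw [uIcc_of_le ht] at hτ
    exact Real.norm_of_nonneg (hh0 τ hτ.1)
  have hle : ∫ τ in Ioi 0, h τ ≤ K := by
    refine le_of_tendsto (intervalIntegral_tendsto_integral_Ioi 0 ih tendsto_id) ?_
    filter_upwards [eventually_ge_atTop 0] with t ht using hK t ht
  rw [← integral_Ici_eq_integral_Ioi] at hle
  rw [← integrableOn_Ici_iff_integrableOn_Ioi] at ih
  have islice : ∀ τ, Integrable (fun y => f (τ, y)) sliceMeasure :=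
    fun τ => integrable_slice_localized hu hχ hχS τ
  have bslice : ∀ τ, 0 ≤ τ → ∫ y, ‖f (τ, y)‖ ∂sliceMeasure ≤ c * h τ :=
    fun τ hτ => integral_slice_localized_le hu hχ hχc hχS hτ
  have hae : ∀ᵐ τ ∂(volume.restrict (Ici (0 : ℝ))), 0 ≤ τ := by
    filter_upwards [ae_restrict_mem measurableSet_Ici] with τ hτ using hτ
  have inorm : Integrable (fun τ => ∫ y, ‖f (τ, y)‖ ∂sliceMeasure) (volume.restrict (Ici 0)) := by
    refine Integrable.mono' (ih.const_mul c) ?_ ?_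
    · have : AEStronglyMeasurable (fun p => ‖f p‖)
          ((volume.restrict (Ici (0 : ℝ))).prod sliceMeasure) := cf.norm.aestronglyMeasurable
      exact this.integral_prod_right'
    · filter_upwards [hae] with τ hτ
      rw [Real.norm_of_nonneg (integral_nonneg fun y => norm_nonneg _)]
      exact bslice τ hτ
  have iall : Integrable f futureMeasure :=
    (integrable_prod_iff cf.aestronglyMeasurable).2 ⟨.of_forall islice, inorm⟩
  refine ⟨iall, ?_⟩
  unfold futureMeasure at iall ⊢
  rw [integral_prod _ iall]
  calc ∫ τ in Ici 0, ∫ y, f (τ, y) ∂sliceMeasure ≤ ∫ τ in Ici 0, c * h τ := by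
        refine integral_mono_ae iall.integral_prod_left (ih.const_mul c) ?_
        filter_upwards [hae] with τ hτ
        exact ((Real.le_norm_self _).trans (norm_integral_le_integral_norm _)).trans (bslice τ hτ)
    _ = c * ∫ τ in Ici 0, h τ := integral_const_mul _ _
    _ ≤ c * K := by gcongr

end

end RNdS

end

theorem mainTheorem4 (M Q Λ : ℝ) (hadm : RNdS.Admissible M Q Λ) :
    (∃ C : ℝ, 0 < C ∧ ∀ u : ℝ → ℝ → RNdS.S2 → ℂ,
      RNdS.SmoothField u → RNdS.WaveLike M Q Λ u → RNdS.NoZeroMode u →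
      RNdS.FiniteConformalCharge M Q Λ u 0 →
      RNdS.FiniteEnergy M Q Λ (RNdS.lap (RNdS.lap u)) 0 →
      ∀ t : ℝ, 0 ≤ t →
        RNdS.FiniteConformalCharge M Q Λ u t ∧
        RNdS.conformalCharge M Q Λ u t ≤
          C * (RNdS.conformalCharge M Q Λ u 0
            + RNdS.energy M Q Λ (RNdS.lap (RNdS.lap u)) 0)) ∧
    (∀ χ : ℝ → ℝ, ContDiff ℝ ∞ χ → HasCompactSupport χ →
      ∃ C : ℝ, 0 < C ∧ ∀ u : ℝ → ℝ → RNdS.S2 → ℂ,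
        RNdS.SmoothField u → RNdS.WaveLike M Q Λ u → RNdS.NoZeroMode u →
        RNdS.FiniteConformalCharge M Q Λ u 0 →
        RNdS.FiniteEnergy M Q Λ (RNdS.lap (RNdS.lap u)) 0 →
          Integrable (fun p : ℝ × ℝ × RNdS.S2 =>
            p.1 * χ p.2.1 * RNdS.sphGradSq (u p.1 p.2.1) p.2.2) RNdS.futureMeasure ∧
          ∫ p : ℝ × ℝ × RNdS.S2,
              p.1 * χ p.2.1 * RNdS.sphGradSq (u p.1 p.2.1) p.2.2 ∂(RNdS.futureMeasure) ≤
            C * (RNdS.conformalCharge M Q Λ u 0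
              + RNdS.energy M Q Λ (RNdS.lap (RNdS.lap u)) 0)) := by
  obtain ⟨g, q, q₀, B, T⟩ := hadm.exists_trappingPotential
  constructor
  · obtain ⟨C, hC, hb⟩ := RNdS.exists_reduced_bound hadm 0
    refine ⟨C, hC, fun u hu h h0 hfin hfin4 t ht => ?_⟩
    have res := RNdS.integrable_slice_of_bounded (hu.continuous_conformalDensity T.cont_V t)
      (fun p => RNdS.conformalDensity_nonneg T.V_pos u t p.1 p.2)
      (RNdS.continuous_slice (RNdS.ReducedWave.cont_eC T) t)
      (fun s => RNdS.integral_conformalDensity hu h h0 t s) (hb u hu h h0 hfin hfin4 t ht).1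
    refine ⟨res.1, ?_⟩
    have := res.2
    rw [RNdS.conformalCharge]
    linarith
  · intro χ hχ hχc
    obtain ⟨S, hS⟩ := hχc.isCompact.isBounded.subset_closedBall 0
    obtain ⟨c, hc⟩ := hχ.continuous.bounded_above_of_compact_support hχc
    have hc0 : 0 ≤ c := (norm_nonneg _).trans (hc 0)
    obtain ⟨C, hC, hb⟩ := RNdS.exists_reduced_bound hadm S
    refine ⟨(c + 1) * (2 * C), by positivity, fun u hu h h0 hfin hfin4 => ?_⟩
    have res := RNdS.integrable_future hu hχ.continuous (c := c + 1) (S := S) (by positivity)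
      (fun s => (hc s).trans (by linarith))
      (fun s hs => image_eq_zero_of_notMem_tsupport fun hmem => by
        have := hS hmem
        rw [mem_closedBall_zero_iff, Real.norm_eq_abs] at this
        linarith)
      (fun t ht => (hb u hu h h0 hfin hfin4 t ht).2)
    refine ⟨res.1, res.2.trans (le_of_eq ?_)⟩
    ring
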